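/- **Networks.** Let $N=(G,S,T,c)$ be a network: $G=(V,E)$ is a finite directed graph without loops and parallel edges, $n=|V|$, $m=|E|$; $S$ (sources) and $T$ (sinks) are disjoint subsets of $V$; $c:E\to\mathbb R_{\ge 0}$ gives the capacities. Vertices outside $S\cup T$ are called inner. Every inner vertex $v$ has a strict linear order on the set $\delta^{in}(v)$ of entering edges and one on the set $\delta^{out}(v)$ of leaving edges (earlier edges, also said to be more to the left, are preferred). Assume condition (P): no edge enters a source and no edge leaves a sink. **Stable flows.** For $f:E\to\mathbb R$ let $\mathrm{ex}_f(v)=\sum_{e\in\delta^{in}(v)}f(e)-\sum_{e\in\delta^{out}(v)}f(e)$. An edge is saturated if $f(e)=c(e)$ and free if $f(e)=0$. A preflow is a function $f$ with $0\le f\le c$ and $\mathrm{ex}_f(v)\ge 0$ for all $v\in V\setminus S$; a flow is a preflow with $\mathrm{ex}_f(v)=0$ for all inner $v$. A flow $f$ is stable if for every nontrivial directed path $(v_0,e_1,v_1,\dots,e_k,v_k)$ with all edges unsaturated (vertices may repeat, in particular $v_0=v_k$ is allowed), either $v_0$ is inner and every edge of $\delta^{out}(v_0)$ later than $e_1$ is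 free, or $v_k$ is inner and every edge of $\delta^{in}(v_k)$ later than $e_k$ is free. **The modified algorithm.** It maintains a preflow $f$ with its excesses, a set of closed edges, for each inner vertex $v$ an active edge in $\delta^{out}(v)$ (or none), and possibly a critical edge in $\delta^{in}(v)$. Initially $f(e)=c(e)$ on the edges leaving sources and $f(e)=0$ elsewhere, no edge is closed or critical, and the active edge of $v$ is its first unsaturated leaving edge. * *Pushing* at $v$ (when $v$ has an active edge): $f$ is increased on the unclosed edges of $\delta^{out}(v)$, from left to right starting with the active edge, each time by the minimum of the current excess of $v$ and $c(e)-f(e)$, until the excess of $v$ vanishes or no unclosed unsaturated edge is left. The active edge is always the leftmost leaving edge that is neither closed nor saturated. * *Balancing* at $v$ (when $v$ has no active edge): $f$ is decreased on the edges of $\delta^{in}(v)$, from right to left starting with the critical edge (with the last edge if $v$ is balanced for the first time), each time by the minimum of the current excess of $v$ and $f(e)$, until the excess of $v$ vanishes. The last edge where $f$ was decreased becomes critical; this edge and all later edges of $\delta^{in}(v)$ become closed, and active edges are updated. The algorithm performs *big iterations*. A big iteration ends as soon as some edge becomes saturated by pushing, free by balancing, or closed. It starts by tracing a path from an inner vertex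 with positive excess: at the current vertex $v$ one pushes (if $v$ has an active edge) or balances (otherwise), and then moves to the head of the active edge or to the tail of the critical edge, respectively. If the path returns to one of its own vertices, $f$ is increased on the active edges and decreased on the critical edges of the resulting cycle by the maximal possible equal amount, and the big iteration ends. If the path reaches a terminal or a vertex of an earlier path of the same big iteration, it is kept, and a new path is traced from an inner vertex with positive excess outside the earlier paths, if there is any. Otherwise the kept paths form disjoint trees rooted at terminals; their vertices are processed in topological order towards the roots, each vertex with positive excess being pushed (if it has an active edge) or balanced (otherwise). The algorithm stops when a big iteration ends without any such change. **Cost model.** Running time is measured on a real random access machine with unit-cost registers and arrays, holding either indices (with $\pm1$ and comparisons) or real numbers (with addition, subtraction, minimum and comparisons). The input consists of the types of the vertices (inner, source or sink), the tails, heads and capacities of the edges, and linked lists of $\delta^{out}(v)$ and $\delta^{in}(v)$ in the given orders for all inner $v$. The starting vertices of paths are selected by scanning the vertices in the order of their input numbers, once in each big iteration. **Proposition.** For every network $N$ satisfying (P), with arbitrarily numbered vertices and edges, the modified algorithm halts and returns a stable flow $f$ in $N$. Its running time is $O(nm)$: there is an absolute constant $C$ such that it makes at most $C\,n\,m$ steps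 whenever $m\ge1$. If all capacities are integers, then the returned $f$ is integral. -/

import Mathlib

namespace StableFlow

/-! ## Networks, flows, stability -/

/-- A network on a finite directed graph without loops and parallel edges (an edge `e` goes from
`tail e` to `head e`), with disjoint sets of sources `S` and sinks `T`, nonnegative real capacities
`c`, and, for every vertex `v` outside `S ∪ T`, strict linear orders on the entering edges and on
the leaving edges: `ltIn v e e'` (`ltOut v e e'`) means that `e` comes before `e'`, i.e. that
`v` prefers `e` to `e'`. -/
structure Network (V E : Type*) where
  tail : E → V
  head : E → V
  loopless : ∀ e, tail e ≠ head e
  simple : ∀ e e', tail e = tail e' → head e = head e' → e = e'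
  S : Set V
  T : Set V
  disjoint : Disjoint S T
  c : E → ℝ
  c_nonneg : ∀ e, 0 ≤ c e
  ltIn : V → E → E → Prop
  ltOut : V → E → E → Prop
  ltIn_order : ∀ v, v ∉ S ∪ T →
    IsStrictTotalOrder {e : E // head e = v} (fun e e' => ltIn v e.1 e'.1)
  ltOut_order : ∀ v, v ∉ S ∪ T →
    IsStrictTotalOrder {e : E // tail e = v} (fun e e' => ltOut v e.1 e'.1)

namespace Network

variable {V E : Type*}

/-- The inner (nonterminal) vertices. -/
def Inner (N : Network V E) (v : V) : Prop := v ∉ N.S ∪ N.T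

/-- Condition (P): no edge enters a source and no edge leaves a sink. -/
def CondP (N : Network V E) : Prop :=
  (∀ e, N.head e ∉ N.S) ∧ ∀ e, N.tail e ∉ N.T

open Classical in
/-- The excess of `f` at `v`: the inflow minus the outflow. -/
noncomputable def excess [Fintype E] (N : Network V E) (f : E → ℝ) (v : V) : ℝ :=
  (∑ e with N.head e = v, f e) - ∑ e with N.tail e = v, f e

/-- Admissible functions. -/
def Admissible (N : Network V E) (f : E → ℝ) : Prop := ∀ e, 0 ≤ f e ∧ f e ≤ N.c e

/-- Preflows. -/
def IsPreflow [Fintype E] (N : Network V E) (f : E → ℝ) : Prop :=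
  N.Admissible f ∧ ∀ v, v ∉ N.S → 0 ≤ N.excess f v

/-- Flows from `S` to `T`. -/
def IsFlow [Fintype E] (N : Network V E) (f : E → ℝ) : Prop :=
  N.IsPreflow f ∧ ∀ v, N.Inner v → N.excess f v = 0

/-- `P 0, …, P k` is the edge sequence of a nontrivial directed path (vertices may repeat); the path
starts at `tail (P 0)` and ends at `head (P k)`. -/
def IsDirectedPath (N : Network V E) {k : ℕ} (P : Fin (k + 1) → E) : Prop :=
  ∀ i : Fin k, N.head (P i.castSucc) = N.tail (P i.succ)

/-- The path is dominated at its first vertex, which is inner: every edge leaving this vertex and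
later than the first edge of the path is free of `f`. -/
def DominatedAtStart (N : Network V E) (f : E → ℝ) {k : ℕ} (P : Fin (k + 1) → E) : Prop :=
  N.Inner (N.tail (P 0)) ∧
    ∀ e, N.tail e = N.tail (P 0) → N.ltOut (N.tail (P 0)) (P 0) e → f e = 0

/-- The path is dominated at its last vertex, which is inner: every edge entering this vertex and
later than the last edge of the path is free of `f`. -/
def DominatedAtEnd (N : Network V E) (f : E → ℝ) {k : ℕ} (P : Fin (k + 1) → E) : Prop :=
  N.Inner (N.head (P (Fin.last k))) ∧
    ∀ e, N.head e = N.head (P (Fin.last k)) →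
      N.ltIn (N.head (P (Fin.last k))) (P (Fin.last k)) e → f e = 0

/-- Stable flows: flows for which every unsaturated directed path is dominated at its first or at
its last vertex. -/
def IsStableFlow [Fintype E] (N : Network V E) (f : E → ℝ) : Prop :=
  N.IsFlow f ∧
    ∀ (k : ℕ) (P : Fin (k + 1) → E), N.IsDirectedPath P → (∀ i, f (P i) < N.c (P i)) →
      N.DominatedAtStart f P ∨ N.DominatedAtEnd f P

end Network

/-! ## A real random access machine with a step count

Programs of a structured language over finitely many registers and arrays, whose contents are
natural numbers (used only as vertices, edges, list positions and flags) or real numbers. One unit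
of time is charged for each executed command or loop test and for each occurrence of an operation,
a constant, a register or an array access in the expressions that it evaluates. The arithmetic
operations are `+ 1` and `- 1` on natural numbers, and addition, subtraction and minimum on real
numbers. -/

/-- Registers for natural numbers. -/
inductive NatVar
  | n | m | i | e | u | v | w | start | pathLen | ordLen | changed | go
  deriving DecidableEq

/-- Arrays of natural numbers. -/
inductive NatArr
  | kind | tail | head | firstOut | nextOut | lastIn | prevIn
  | act | crit | closed | mark | path | ord
  deriving DecidableEq

/-- Registers for real numbers. -/
inductive RealVar
  | delta
  deriving DecidableEq

/-- Arrays of real numbers. -/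
inductive RealArr
  | c | f | ex
  deriving DecidableEq

/-- The content of the memory. -/
structure Store where
  nat : NatVar → ℕ
  natArr : NatArr → ℕ → ℕ
  real : RealVar → ℝ
  realArr : RealArr → ℕ → ℝ

/-- Expressions for natural numbers. -/
inductive NExpr
  | lit (k : ℕ)
  | var (x : NatVar)
  | get (a : NatArr) (i : NExpr)
  | succ (a : NExpr)
  | pred (a : NExpr)

/-- Expressions for real numbers. -/
inductive RExpr
  | zero
  | var (x : RealVar)
  | get (a : RealArr) (i : NExpr)
  | add (a b : RExpr)
  | sub (a b : RExpr)
  | min (a b : RExpr)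

/-- Tests. -/
inductive BExpr
  | eqN (a b : NExpr)
  | ltN (a b : NExpr)
  | eqR (a b : RExpr)
  | ltR (a b : RExpr)
  | not (a : BExpr)
  | and (a b : BExpr)
  | or (a b : BExpr)

/-- Programs: assignments to a register (`set`, `setR`) or to an array cell (`put a i x` means
`a[i] := x`, likewise `putR`), composition, branching, and loops. -/
inductive Cmd
  | skip
  | set (x : NatVar) (a : NExpr)
  | put (a : NatArr) (i : NExpr) (x : NExpr)
  | setR (x : RealVar) (a : RExpr)
  | putR (a : RealArr) (i : NExpr) (x : RExpr)
  | seq (p q : Cmd)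
  | ite (b : BExpr) (p q : Cmd)
  | loop (b : BExpr) (p : Cmd)

def NExpr.eval (σ : Store) : NExpr → ℕ
  | lit k => k
  | var x => σ.nat x
  | get a i => σ.natArr a (i.eval σ)
  | succ a => a.eval σ + 1
  | pred a => a.eval σ - 1

def NExpr.cost : NExpr → ℕ
  | lit _ => 1
  | var _ => 1
  | get _ i => i.cost + 1
  | succ a => a.cost + 1
  | pred a => a.cost + 1

noncomputable def RExpr.eval (σ : Store) : RExpr → ℝ
  | zero => 0
  | var x => σ.real x
  | get a i => σ.realArr a (i.eval σ)
  | add a b => a.eval σ + b.eval σ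
  | sub a b => a.eval σ - b.eval σ
  | min a b => Min.min (a.eval σ) (b.eval σ)

def RExpr.cost : RExpr → ℕ
  | zero => 1
  | var _ => 1
  | get _ i => i.cost + 1
  | add a b => a.cost + b.cost + 1
  | sub a b => a.cost + b.cost + 1
  | min a b => a.cost + b.cost + 1

def BExpr.Holds (σ : Store) : BExpr → Prop
  | eqN a b => a.eval σ = b.eval σ
  | ltN a b => a.eval σ < b.eval σ
  | eqR a b => a.eval σ = b.eval σ
  | ltR a b => a.eval σ < b.eval σ
  | not a => ¬ a.Holds σ
  | and a b => a.Holds σ ∧ b.Holds σ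
  | or a b => a.Holds σ ∨ b.Holds σ

def BExpr.cost : BExpr → ℕ
  | eqN a b => a.cost + b.cost + 1
  | ltN a b => a.cost + b.cost + 1
  | eqR a b => a.cost + b.cost + 1
  | ltR a b => a.cost + b.cost + 1
  | not a => a.cost + 1
  | and a b => a.cost + b.cost + 1
  | or a b => a.cost + b.cost + 1

def Store.set (σ : Store) (x : NatVar) (k : ℕ) : Store :=
  { σ with nat := Function.update σ.nat x k }

def Store.put (σ : Store) (a : NatArr) (i k : ℕ) : Store :=
  { σ with natArr := Function.update σ.natArr a (Function.update (σ.natArr a) i k) }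

def Store.setR (σ : Store) (x : RealVar) (r : ℝ) : Store :=
  { σ with real := Function.update σ.real x r }

def Store.putR (σ : Store) (a : RealArr) (i : ℕ) (r : ℝ) : Store :=
  { σ with realArr := Function.update σ.realArr a (Function.update (σ.realArr a) i r) }

/-- `Exec p σ σ' t`: the program `p`, started on the memory `σ`, halts after exactly `t` units of
time with the memory `σ'`. -/
inductive Exec : Cmd → Store → Store → ℕ → Prop
  | skip (σ : Store) : Exec .skip σ σ 1
  | set (x : NatVar) (a : NExpr) (σ : Store) :
      Exec (.set x a) σ (σ.set x (a.eval σ)) (a.cost + 1)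
  | put (a : NatArr) (i x : NExpr) (σ : Store) :
      Exec (.put a i x) σ (σ.put a (i.eval σ) (x.eval σ)) (i.cost + x.cost + 1)
  | setR (x : RealVar) (a : RExpr) (σ : Store) :
      Exec (.setR x a) σ (σ.setR x (a.eval σ)) (a.cost + 1)
  | putR (a : RealArr) (i : NExpr) (x : RExpr) (σ : Store) :
      Exec (.putR a i x) σ (σ.putR a (i.eval σ) (x.eval σ)) (i.cost + x.cost + 1)
  | seq {p q : Cmd} {σ σ' σ'' : Store} {s t : ℕ} :
      Exec p σ σ' s → Exec q σ' σ'' t → Exec (.seq p q) σ σ'' (s + t + 1)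
  | ite_true {b : BExpr} {p q : Cmd} {σ σ' : Store} {t : ℕ} :
      b.Holds σ → Exec p σ σ' t → Exec (.ite b p q) σ σ' (b.cost + t + 1)
  | ite_false {b : BExpr} {p q : Cmd} {σ σ' : Store} {t : ℕ} :
      ¬ b.Holds σ → Exec q σ σ' t → Exec (.ite b p q) σ σ' (b.cost + t + 1)
  | loop_true {b : BExpr} {p : Cmd} {σ σ' σ'' : Store} {s t : ℕ} :
      b.Holds σ → Exec p σ σ' s → Exec (.loop b p) σ' σ'' t →
        Exec (.loop b p) σ σ'' (b.cost + s + t + 1)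
  | loop_false {b : BExpr} {p : Cmd} {σ : Store} :
      ¬ b.Holds σ → Exec (.loop b p) σ σ (b.cost + 1)

/-! ## The modified algorithm -/

namespace Algorithm

open NatVar NatArr RealVar RealArr

instance : Coe NatVar NExpr := ⟨NExpr.var⟩
instance : Coe RealVar RExpr := ⟨RExpr.var⟩
instance (k : ℕ) : OfNat NExpr k := ⟨NExpr.lit k⟩
instance : CoeFun NatArr (fun _ => NExpr → NExpr) := ⟨NExpr.get⟩
instance : CoeFun RealArr (fun _ => NExpr → RExpr) := ⟨RExpr.get⟩

/-- The commands of a list, one after the other. -/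
def block : List Cmd → Cmd
  | [] => .skip
  | [p] => p
  | p :: q :: l => .seq p (block (q :: l))

/-- `when b l`: if `b` then `l`. -/
def when (b : BExpr) (l : List Cmd) : Cmd := .ite b (block l) .skip

/-- `repeatWhile b l`: while `b` do `l`. -/
def repeatWhile (b : BExpr) (l : List Cmd) : Cmd := .loop b (block l)

/-- `forBelow x bound l`: for `x = 0, …, bound - 1` do `l`. -/
def forBelow (x bound : NatVar) (l : List Cmd) : Cmd :=
  block [.set x 0, repeatWhile (.ltN x bound) (l ++ [.set x (.succ x)])]

/-- `inc a i r`: `a[i] := a[i] + r`. -/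
def inc (a : RealArr) (i : NExpr) (r : RExpr) : Cmd := .putR a i (.add (a i) r)

/-- `dec a i r`: `a[i] := a[i] - r`. -/
def dec (a : RealArr) (i : NExpr) (r : RExpr) : Cmd := .putR a i (.sub (a i) r)

/-- The vertex `x` has an active edge. In the arrays of edges, the number `m` stands for
"no edge". -/
def hasActive (x : NatVar) : BExpr := .not (.eqN (act x) m)

/-- Move the active edge of `x` to the right past all closed or saturated edges. -/
def advance (x : NatVar) : Cmd :=
  repeatWhile
    (.and (hasActive x)
      (.or (.eqN (closed (act x)) 1) (.eqR (f (act x)) (c (act x)))))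
    [.put act x (nextOut (act x))]

/-- Pushing at `x`: raise `f` on the unclosed edges leaving `x`, from left to right starting with the
active edge, until the excess of `x` vanishes or there is no such unsaturated edge. The flag
`changed` records that an edge got saturated. -/
def push (x : NatVar) : Cmd :=
  repeatWhile (.and (.ltR .zero (ex x)) (hasActive x))
    [ .set e (act x),
      .setR delta (.min (ex x) (.sub (c e) (f e))),
      inc f e delta,
      dec ex x delta,
      inc ex (head e) delta,
      when (.eqR (f e) (c e)) [.set changed 1, advance x] ]

/-- Close the edge `crit[x]`; if it was the active edge of its tail, this tail gets a new one. The
flag `changed` is raised. -/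
def closeCritical (x : NatVar) : Cmd :=
  block
    [ .set e (crit x),
      .put closed e 1,
      .set changed 1,
      .set u (tail e),
      when (.eqN (act u) e) [advance u] ]

/-- Balancing at `x`: lower `f` on the edges entering `x`, from right to left starting with the
critical edge (with the last edge at the first balancing), until the excess of `x` vanishes. All
edges passed are closed, and the last edge where `f` was lowered becomes critical. The flag
`changed` records that an edge got closed or free. -/
def balance (x : NatVar) : Cmd :=
  block
    [ when (.eqN (crit x) m) [.put crit x (lastIn x), closeCritical x],
      repeatWhile (.ltR .zero (ex x))
        [ .ite (.eqR (f (crit x)) .zero)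
            (block [.put crit x (prevIn (crit x)), closeCritical x])
            (block
              [ .set e (crit x),
                .setR delta (.min (ex x) (f e)),
                dec f e delta,
                dec ex x delta,
                inc ex (tail e) delta,
                when (.eqR (f e) .zero) [.set changed 1] ]) ] ]

/-- Push at `x` if `x` has an active edge, and balance at `x` otherwise. -/
def process (x : NatVar) : Cmd := .ite (hasActive x) (push x) (balance x)

/-- The initial preflow: `f = c` on the edges leaving the sources, and `f = 0` elsewhere. No edge is
closed, no edge is critical, and the active edge of each inner vertex is its first unsaturated
leaving edge. -/
def startPreflow : Cmd :=
  block
    [ forBelow v n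
        [ .put crit v m,
          .putR ex v .zero,
          .ite (.eqN (kind v) 0) (.put act v (firstOut v)) (.put act v m) ],
      forBelow e m
        [ .put closed e 0,
          .ite (.eqN (kind (tail e)) 1)
            (block [.putR f e (c e), dec ex (tail e) (c e), inc ex (head e) (c e)])
            (.putR f e .zero) ],
      forBelow v n [advance v] ]

/-- `delta := min(delta, residual of x)`, where the residual of `x` is `c - f` on its active edge if
there is one, and `f` on its critical edge otherwise. -/
def lowerDelta (x : NatVar) : Cmd :=
  .ite (hasActive x)
    (.setR delta (.min delta (.sub (c (act x)) (f (act x)))))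
    (.setR delta (.min delta (f (crit x))))

/-- Raise `f` by `delta` on the active edge of `x` if there is one, and otherwise lower `f` by `delta`
on its critical edge. -/
def shift (x : NatVar) : Cmd :=
  .ite (hasActive x)
    (block
      [ .set e (act x),
        inc f e delta,
        when (.eqR (f e) (c e)) [advance x] ])
    (dec f (crit x) delta)

/-- The current path has returned to its vertex `w`: change `f` along the resulting cycle, which is
formed by the vertices of the path from `w` on, by the largest possible amount. -/
def rotate : Cmd :=
  block
    [ .set i (.pred pathLen),
      .set v (path i),
      .ite (hasActive v)
        (.setR delta (.sub (c (act v)) (f (act v))))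
        (.setR delta (f (crit v))),
      repeatWhile (.not (.eqN v w))
        [.set i (.pred i), .set v (path i), lowerDelta v],
      .set i (.pred pathLen),
      .set v (path i),
      shift v,
      repeatWhile (.not (.eqN v w))
        [.set i (.pred i), .set v (path i), shift v],
      .set changed 1 ]

/-- Follow the path from the vertex `start`, moving the excess along it, until an edge gets
saturated, free or closed, or the path reaches a terminal, or a vertex of an earlier path (marked 2),
or a vertex of its own (marked 1). In the last case the cycle is rotated. If nothing changed, the
path joins the earlier ones: its vertices get the mark 2 and are appended to `ord` in reverse
order. -/
def tracePath : Cmd :=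
  block
    [ .set v start,
      .set pathLen 0,
      .set go 1,
      repeatWhile (.eqN go 1)
        [ .put mark v 1,
          .put path pathLen v,
          .set pathLen (.succ pathLen),
          process v,
          .ite (hasActive v) (.set w (head (act v))) (.set w (tail (crit v))),
          .ite (.or (.eqN changed 1) (.or (.not (.eqN (kind w) 0)) (.eqN (mark w) 2)))
            (.set go 0)
            (.ite (.eqN (mark w) 1)
              (block [.set go 0, rotate])
              (.set v w)) ],
      when (.eqN changed 0)
        [ repeatWhile (.ltN 0 pathLen)
            [ .set pathLen (.pred pathLen),
              .put mark (path pathLen) 2,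
              .put ord ordLen (path pathLen),
              .set ordLen (.succ ordLen) ] ] ]

/-- A big iteration; it ends as soon as `changed` is raised. First a path is traced from each vertex
with positive excess that does not lie on an earlier path. The traced paths form disjoint trees
rooted at terminals, and read backwards, `ord` lists their vertices in topological order. Then the
excesses left in the trees are moved towards the roots in this order. -/
def bigIteration : Cmd :=
  block
    [ .set changed 0,
      .set ordLen 0,
      forBelow v n [.put mark v 0],
      .set start 0,
      repeatWhile (.and (.eqN changed 0) (.ltN start n))
        [ when (.and (.eqN (kind start) 0)
            (.and (.eqN (mark start) 0) (.ltR .zero (ex start)))) [tracePath],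
          .set start (.succ start) ],
      repeatWhile (.and (.eqN changed 0) (.ltN 0 ordLen))
        [ .set ordLen (.pred ordLen),
          .set v (ord ordLen),
          when (.ltR .zero (ex v)) [process v] ] ]

/-- The modified algorithm: big iterations are performed until one of them ends without a change; then
no inner vertex has positive excess, and the array `f` is the output. -/
def modifiedAlgorithm : Cmd :=
  block [startPreflow, .set changed 1, repeatWhile (.eqN changed 1) [bigIteration]]

end Algorithm

/-- The memory `σ` holds the network `N` as an input: vertices are the numbers below `n`, edges the
numbers below `m`; `kind` is 0 for inner vertices, 1 for sources, 2 for sinks; and for every inner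
vertex the leaving edges are given as a linked list from the first to the last edge, the entering
edges as a linked list from the last to the first edge, where `m` stands for "no edge". The rest of
the memory is arbitrary. -/
structure Network.IsInput {n m : ℕ} (N : Network (Fin n) (Fin m)) (σ : Store) : Prop where
  n_eq : σ.nat .n = n
  m_eq : σ.nat .m = m
  kind_inner : ∀ v, N.Inner v → σ.natArr .kind v = 0
  kind_source : ∀ v ∈ N.S, σ.natArr .kind v = 1
  kind_sink : ∀ v ∈ N.T, σ.natArr .kind v = 2
  tail_eq : ∀ e : Fin m, σ.natArr .tail e = N.tail e
  head_eq : ∀ e : Fin m, σ.natArr .head e = N.head e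
  c_eq : ∀ e : Fin m, σ.realArr .c e = N.c e
  firstOut_edge : ∀ e, N.Inner (N.tail e) →
    (∀ e', N.tail e' = N.tail e → e' ≠ e → N.ltOut (N.tail e) e e') →
      σ.natArr .firstOut (N.tail e) = e
  firstOut_none : ∀ v, N.Inner v → (∀ e, N.tail e ≠ v) → σ.natArr .firstOut v = m
  nextOut_edge : ∀ e e', N.Inner (N.tail e) → N.tail e' = N.tail e →
    N.ltOut (N.tail e) e e' →
    (∀ e'', N.tail e'' = N.tail e → N.ltOut (N.tail e) e e'' → e'' ≠ e' →
      N.ltOut (N.tail e) e' e'') →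
      σ.natArr .nextOut e = e'
  nextOut_none : ∀ e, N.Inner (N.tail e) →
    (∀ e', N.tail e' = N.tail e → ¬ N.ltOut (N.tail e) e e') → σ.natArr .nextOut e = m
  lastIn_edge : ∀ e, N.Inner (N.head e) →
    (∀ e', N.head e' = N.head e → e' ≠ e → N.ltIn (N.head e) e' e) →
      σ.natArr .lastIn (N.head e) = e
  lastIn_none : ∀ v, N.Inner v → (∀ e, N.head e ≠ v) → σ.natArr .lastIn v = m
  prevIn_edge : ∀ e e', N.Inner (N.head e) → N.head e' = N.head e →
    N.ltIn (N.head e) e' e →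
    (∀ e'', N.head e'' = N.head e → N.ltIn (N.head e) e'' e → e'' ≠ e' →
      N.ltIn (N.head e) e'' e') →
      σ.natArr .prevIn e = e'
  prevIn_none : ∀ e, N.Inner (N.head e) →
    (∀ e', N.head e' = N.head e → ¬ N.ltIn (N.head e) e' e) → σ.natArr .prevIn e = m

end StableFlow

namespace StableFlow

/-! Stability follows from local invariants (`Sound`). Call an edge blocked if it is closed or
saturated. At an inner vertex the leaving edges before the active edge are blocked and those after
it are free; without an active edge all leaving edges are blocked. Only a vertex without an active
edge has a critical edge; the closed entering edges are the critical one and the later ones, and the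
later ones are free. An unclosed edge leaving a source is saturated. Now let no inner vertex have
positive excess, and take an unsaturated path. If its first edge is closed, the head of that edge
has no active edge, so the next edge is blocked, hence closed; closedness spreads to the last edge,
and all later edges entering the end are free. If the first edge is not closed, it leaves an inner
vertex, it does not precede the active edge there, and all later leaving edges are free. This is
`Valid.isStableFlow`.

The time bound is amortized. Four events are irreversible: the active edge passes an edge, an edge
becomes blocked, becomes closed, or becomes closed and free. They cannot be undone, because flow
rises only on active edges, which are unblocked, and falls only on critical edges, which are closed.
Each event happens at most once per edge, so `potential` is at most `4 * m`. Pushing and balancing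
take constant time plus constant time per event (`process_runs`). Within a big iteration marks keep
any vertex from being traced twice. Rotating a cycle by the least residual leaves all excesses
intact and causes an event (`rotate_runs`). So a big iteration costs `O(n)` plus its events
(`bigIteration_runs`). If it causes no event, the successor of every vertex stays fixed, and
processing the trees in topological order drains all excess into the terminals. Thus all big
iterations but the last consume potential, there are at most `4 * m + 1` of them, and the total is
`O(n * m)`.

Integrality holds because every amount moved arises from capacities by sums, differences and minima:
all flow values stay in the additive subgroup generated by the capacities.

Programs are analysed by weakest preconditions (`Runs`), with loop time charged to a measure
(`runs_loop`). The combinatorics lives in `State`, extracted from the memory by `view`. -/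

/-! ## A timed program logic -/

/-- The program `p`, started on `σ`, halts after `t` units of time with a memory `σ'` such that
`Q σ' t` holds. -/
def Runs (p : Cmd) (σ : Store) (Q : Store → ℕ → Prop) : Prop :=
  ∃ σ' t, Exec p σ σ' t ∧ Q σ' t

theorem Runs.mono {p : Cmd} {σ : Store} {Q Q' : Store → ℕ → Prop} (h : Runs p σ Q)
    (hQ : ∀ σ' t, Q σ' t → Q' σ' t) : Runs p σ Q' :=
  let ⟨σ', t, he, hq⟩ := h
  ⟨σ', t, he, hQ _ _ hq⟩

/-- These equivalences let `simp` execute loop-free code symbolically and add up its time; only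
loops need an invariant. -/
theorem runs_skip {σ : Store} {Q : Store → ℕ → Prop} : Runs .skip σ Q ↔ Q σ 1 :=
  ⟨fun ⟨_, _, he, hq⟩ => by cases he; exact hq, fun h => ⟨_, _, .skip _, h⟩⟩

theorem runs_set {x : NatVar} {a : NExpr} {σ : Store} {Q : Store → ℕ → Prop} :
    Runs (.set x a) σ Q ↔ Q (σ.set x (a.eval σ)) (a.cost + 1) :=
  ⟨fun ⟨_, _, he, hq⟩ => by cases he; exact hq, fun h => ⟨_, _, .set _ _ _, h⟩⟩

theorem runs_put {a : NatArr} {i x : NExpr} {σ : Store} {Q : Store → ℕ → Prop} :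
    Runs (.put a i x) σ Q ↔ Q (σ.put a (i.eval σ) (x.eval σ)) (i.cost + x.cost + 1) :=
  ⟨fun ⟨_, _, he, hq⟩ => by cases he; exact hq, fun h => ⟨_, _, .put _ _ _ _, h⟩⟩

theorem runs_setR {x : RealVar} {a : RExpr} {σ : Store} {Q : Store → ℕ → Prop} :
    Runs (.setR x a) σ Q ↔ Q (σ.setR x (a.eval σ)) (a.cost + 1) :=
  ⟨fun ⟨_, _, he, hq⟩ => by cases he; exact hq, fun h => ⟨_, _, .setR _ _ _, h⟩⟩

theorem runs_putR {a : RealArr} {i : NExpr} {x : RExpr} {σ : Store} {Q : Store → ℕ → Prop} :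
    Runs (.putR a i x) σ Q ↔ Q (σ.putR a (i.eval σ) (x.eval σ)) (i.cost + x.cost + 1) :=
  ⟨fun ⟨_, _, he, hq⟩ => by cases he; exact hq, fun h => ⟨_, _, .putR _ _ _ _, h⟩⟩

theorem runs_seq {p q : Cmd} {σ : Store} {Q : Store → ℕ → Prop} :
    Runs (.seq p q) σ Q ↔ Runs p σ fun σ' s => Runs q σ' fun σ'' t => Q σ'' (s + t + 1) :=
  ⟨fun ⟨_, _, he, hq⟩ => by cases he with | seq h₁ h₂ => exact ⟨_, _, h₁, _, _, h₂, hq⟩,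
    fun ⟨_, _, h₁, _, _, h₂, hq⟩ => ⟨_, _, .seq h₁ h₂, hq⟩⟩

theorem runs_ite {b : BExpr} {p q : Cmd} {σ : Store} {Q : Store → ℕ → Prop} :
    Runs (.ite b p q) σ Q ↔
      (b.Holds σ → Runs p σ fun σ' t => Q σ' (b.cost + t + 1)) ∧
        (¬ b.Holds σ → Runs q σ fun σ' t => Q σ' (b.cost + t + 1)) := by
  constructor
  · rintro ⟨_, _, he, hq⟩
    cases he with
    | ite_true hb h => exact ⟨fun _ => ⟨_, _, h, hq⟩, fun hb' => absurd hb hb'⟩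
    | ite_false hb h => exact ⟨fun hb' => absurd hb' hb, fun _ => ⟨_, _, h, hq⟩⟩
  · rintro ⟨h₁, h₂⟩
    by_cases hb : b.Holds σ
    · obtain ⟨_, _, h, hq⟩ := h₁ hb
      exact ⟨_, _, .ite_true hb h, hq⟩
    · obtain ⟨_, _, h, hq⟩ := h₂ hb
      exact ⟨_, _, .ite_false hb h, hq⟩

/-- A loop whose iterations are paid by the decrease of the measure `μ`. -/
theorem runs_loop {b : BExpr} {p : Cmd} (I : Store → Prop) (μ : Store → ℕ)
    (hstep : ∀ σ, I σ → b.Holds σ →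
      Runs p σ fun σ' t => I σ' ∧ b.cost + t + 1 + μ σ' ≤ μ σ)
    {σ : Store} (hσ : I σ) :
    Runs (.loop b p) σ fun σ' t => I σ' ∧ ¬ b.Holds σ' ∧ t + μ σ' ≤ μ σ + (b.cost + 1) := by
  induction hk : μ σ using Nat.strong_induction_on generalizing σ with
  | _ k ih =>
    subst hk
    by_cases hb : b.Holds σ
    · obtain ⟨σ₁, s, h₁, hI, hs⟩ := hstep σ hσ hb
      obtain ⟨σ₂, t, h₂, hI₂, hb₂, ht⟩ := ih (μ σ₁) (by omega) hI rfl
      exact ⟨σ₂, _, .loop_true hb h₁ h₂, hI₂, hb₂, by omega⟩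
    · exact ⟨σ, _, .loop_false hb, hσ, hb, by omega⟩

/-! ### Reading the memory after a write. -/

namespace Store

variable (σ : Store)

@[simp] theorem set_nat (x y : NatVar) (k : ℕ) :
    (σ.set x k).nat y = if y = x then k else σ.nat y := Function.update_apply ..

@[simp] theorem set_natArr (x : NatVar) (k : ℕ) : (σ.set x k).natArr = σ.natArr := rfl

@[simp] theorem set_real (x : NatVar) (k : ℕ) : (σ.set x k).real = σ.real := rfl

@[simp] theorem set_realArr (x : NatVar) (k : ℕ) : (σ.set x k).realArr = σ.realArr := rfl

@[simp] theorem put_nat (a : NatArr) (i k : ℕ) : (σ.put a i k).nat = σ.nat := rfl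

@[simp] theorem put_natArr (a b : NatArr) (i k : ℕ) :
    (σ.put a i k).natArr b = if b = a then Function.update (σ.natArr a) i k else σ.natArr b :=
  Function.update_apply ..

@[simp] theorem put_real (a : NatArr) (i k : ℕ) : (σ.put a i k).real = σ.real := rfl

@[simp] theorem put_realArr (a : NatArr) (i k : ℕ) : (σ.put a i k).realArr = σ.realArr := rfl

@[simp] theorem setR_nat (x : RealVar) (r : ℝ) : (σ.setR x r).nat = σ.nat := rfl

@[simp] theorem setR_natArr (x : RealVar) (r : ℝ) : (σ.setR x r).natArr = σ.natArr := rfl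

@[simp] theorem setR_real (x y : RealVar) (r : ℝ) : (σ.setR x r).real y = r := by
  cases x; cases y; simp [Store.setR]

@[simp] theorem setR_realArr (x : RealVar) (r : ℝ) : (σ.setR x r).realArr = σ.realArr := rfl

@[simp] theorem putR_nat (a : RealArr) (i : ℕ) (r : ℝ) : (σ.putR a i r).nat = σ.nat := rfl

@[simp] theorem putR_natArr (a : RealArr) (i : ℕ) (r : ℝ) : (σ.putR a i r).natArr = σ.natArr := rfl

@[simp] theorem putR_real (a : RealArr) (i : ℕ) (r : ℝ) : (σ.putR a i r).real = σ.real := rfl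

@[simp] theorem putR_realArr (a b : RealArr) (i : ℕ) (r : ℝ) :
    (σ.putR a i r).realArr b = if b = a then Function.update (σ.realArr a) i r else σ.realArr b :=
  Function.update_apply ..

end Store

@[simp] theorem NExpr.eval_ofNat (σ : Store) (k : ℕ) : NExpr.eval σ (OfNat.ofNat k : NExpr) = k := rfl

@[simp] theorem NExpr.cost_ofNat (k : ℕ) : NExpr.cost (OfNat.ofNat k : NExpr) = 1 := rfl

attribute [simp] NExpr.eval NExpr.cost RExpr.eval RExpr.cost BExpr.Holds BExpr.cost
attribute [simp] runs_skip runs_set runs_put runs_setR runs_putR runs_seq runs_ite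
attribute [simp] Algorithm.block Algorithm.when Algorithm.inc Algorithm.dec Algorithm.hasActive

/-! ## The preference orders -/

namespace Network

section Order

variable {V E : Type*} (N : Network V E)

theorem ltOut_irrefl {e : E} (hv : N.Inner (N.tail e)) : ¬ N.ltOut (N.tail e) e e := by
  have := N.ltOut_order _ hv
  exact irrefl_of (fun a b : {a : E // N.tail a = N.tail e} => N.ltOut (N.tail e) a.1 b.1) ⟨e, rfl⟩

theorem ltOut_trans {v : V} (hv : N.Inner v) {a b d : E} (ha : N.tail a = v) (hb : N.tail b = v)
    (hd : N.tail d = v) (h₁ : N.ltOut v a b) (h₂ : N.ltOut v b d) : N.ltOut v a d := by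
  have := N.ltOut_order _ hv
  exact trans_of (fun e e' : {e : E // N.tail e = v} => N.ltOut v e.1 e'.1)
    (a := ⟨a, ha⟩) (b := ⟨b, hb⟩) (c := ⟨d, hd⟩) h₁ h₂

theorem ltOut_trichotomy {v : V} (hv : N.Inner v) {a b : E} (ha : N.tail a = v)
    (hb : N.tail b = v) : N.ltOut v a b ∨ a = b ∨ N.ltOut v b a := by
  have := N.ltOut_order _ hv
  simpa using trichotomous_of (fun e e' : {e : E // N.tail e = v} => N.ltOut v e.1 e'.1)
    ⟨a, ha⟩ ⟨b, hb⟩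

/-- The network with all edges reversed. -/
def reverse : Network V E where
  tail := N.head
  head := N.tail
  loopless e := (N.loopless e).symm
  simple e e' h h' := N.simple e e' h' h
  S := N.S
  T := N.T
  disjoint := N.disjoint
  c := N.c
  c_nonneg := N.c_nonneg
  ltIn := N.ltOut
  ltOut := N.ltIn
  ltIn_order := N.ltOut_order
  ltOut_order := N.ltIn_order

theorem ltIn_irrefl {e : E} (hv : N.Inner (N.head e)) : ¬ N.ltIn (N.head e) e e :=
  N.reverse.ltOut_irrefl hv

theorem ltIn_trans {v : V} (hv : N.Inner v) {a b d : E} (ha : N.head a = v) (hb : N.head b = v)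
    (hd : N.head d = v) (h₁ : N.ltIn v a b) (h₂ : N.ltIn v b d) : N.ltIn v a d :=
  N.reverse.ltOut_trans hv ha hb hd h₁ h₂

theorem ltIn_trichotomy {v : V} (hv : N.Inner v) {a b : E} (ha : N.head a = v)
    (hb : N.head b = v) : N.ltIn v a b ∨ a = b ∨ N.ltIn v b a :=
  N.reverse.ltOut_trichotomy hv ha hb

/-- Every nonempty set of edges leaving an inner vertex has a first edge. -/
theorem exists_first_out [Finite E] {v : V} (hv : N.Inner v) (P : E → Prop)
    (hP : ∀ e, P e → N.tail e = v) (hne : ∃ e, P e) :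
    ∃ e, P e ∧ ∀ e', P e' → e' ≠ e → N.ltOut v e e' := by
  have := N.ltOut_order _ hv
  have wf := Finite.wellFounded_of_trans_of_irrefl
    (fun e e' : {e : E // N.tail e = v} => N.ltOut v e.1 e'.1)
  obtain ⟨e, he⟩ := hne
  obtain ⟨a, ha, hmin⟩ := wf.has_min {x | P x.1} ⟨⟨e, hP e he⟩, he⟩
  refine ⟨a.1, ha, fun e' he' hne => ?_⟩
  rcases N.ltOut_trichotomy hv a.2 (hP e' he') with h | h | h
  · exact h
  · exact absurd h.symm hne
  · exact absurd h (hmin ⟨e', hP e' he'⟩ he')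

/-- Every nonempty set of edges leaving an inner vertex has a last edge. -/
theorem exists_last_out [Finite E] {v : V} (hv : N.Inner v) (P : E → Prop)
    (hP : ∀ e, P e → N.tail e = v) (hne : ∃ e, P e) :
    ∃ e, P e ∧ ∀ e', P e' → e' ≠ e → N.ltOut v e' e := by
  have := N.ltOut_order _ hv
  have wf := Finite.wellFounded_of_trans_of_irrefl
    (Function.swap fun e e' : {e : E // N.tail e = v} => N.ltOut v e.1 e'.1)
  obtain ⟨e, he⟩ := hne
  obtain ⟨a, ha, hmin⟩ := wf.has_min {x | P x.1} ⟨⟨e, hP e he⟩, he⟩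
  refine ⟨a.1, ha, fun e' he' hne => ?_⟩
  rcases N.ltOut_trichotomy hv a.2 (hP e' he') with h | h | h
  · exact absurd h (hmin ⟨e', hP e' he'⟩ he')
  · exact absurd h.symm hne
  · exact h

end Order

/-! ## Reading the input -/

namespace IsInput

variable {n m : ℕ} {N : Network (Fin n) (Fin m)} {σ : Store}

/-- `IsInput` describes the list pointers only under extremality conditions. Since there are
finitely many edges in a strict linear order, one of these conditions always applies. -/
theorem nextOut_cases (h : N.IsInput σ) {e : Fin m} (hv : N.Inner (N.tail e)) :
    (σ.natArr .nextOut e = m ∧ ∀ e', N.tail e' = N.tail e → ¬ N.ltOut (N.tail e) e e') ∨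
      ∃ e' : Fin m, σ.natArr .nextOut e = e' ∧ N.tail e' = N.tail e ∧ N.ltOut (N.tail e) e e' ∧
        ∀ e'', N.tail e'' = N.tail e → N.ltOut (N.tail e) e e'' → e'' ≠ e' →
          N.ltOut (N.tail e) e' e'' := by
  by_cases hne : ∃ e', N.tail e' = N.tail e ∧ N.ltOut (N.tail e) e e'
  · obtain ⟨e', ⟨h₁, h₂⟩, h₃⟩ := N.exists_first_out hv _ (fun _ h => h.1) hne
    exact .inr ⟨e', h.nextOut_edge e e' hv h₁ h₂ fun e'' a b => h₃ e'' ⟨a, b⟩, h₁, h₂,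
      fun e'' a b => h₃ e'' ⟨a, b⟩⟩
  · push Not at hne
    exact .inl ⟨h.nextOut_none e hv hne, hne⟩

theorem firstOut_cases (h : N.IsInput σ) {v : Fin n} (hv : N.Inner v) :
    (σ.natArr .firstOut v = m ∧ ∀ e, N.tail e ≠ v) ∨
      ∃ e : Fin m, σ.natArr .firstOut v = e ∧ N.tail e = v ∧
        ∀ e', N.tail e' = v → e' ≠ e → N.ltOut v e e' := by
  by_cases hne : ∃ e, N.tail e = v
  · obtain ⟨e, rfl, h₃⟩ := N.exists_first_out hv _ (fun _ h => h) hne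
    exact .inr ⟨e, h.firstOut_edge e hv h₃, rfl, h₃⟩
  · push Not at hne
    exact .inl ⟨h.firstOut_none v hv hne, hne⟩

/-- The end of the list is irrelevant here: balancing moves left only at positive excess, and then
some earlier edge carries flow. -/
theorem prevIn_edge_of_lt (h : N.IsInput σ) {e : Fin m} (hv : N.Inner (N.head e))
    (hne : ∃ e', N.head e' = N.head e ∧ N.ltIn (N.head e) e' e) :
    ∃ e' : Fin m, σ.natArr .prevIn e = e' ∧ N.head e' = N.head e ∧ N.ltIn (N.head e) e' e ∧
        ∀ e'', N.head e'' = N.head e → N.ltIn (N.head e) e'' e → e'' ≠ e' →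
          N.ltIn (N.head e) e'' e' := by
  obtain ⟨e', ⟨h₁, h₂⟩, h₃⟩ := N.reverse.exists_last_out hv _ (fun _ h => h.1) hne
  exact ⟨e', h.prevIn_edge e e' hv h₁ h₂ fun e'' a b => h₃ e'' ⟨a, b⟩, h₁, h₂,
    fun e'' a b => h₃ e'' ⟨a, b⟩⟩

theorem lastIn_edge_of_ne (h : N.IsInput σ) {v : Fin n} (hv : N.Inner v)
    (hne : ∃ e, N.head e = v) :
    ∃ e : Fin m, σ.natArr .lastIn v = e ∧ N.head e = v ∧
        ∀ e', N.head e' = v → e' ≠ e → N.ltIn v e' e := by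
  obtain ⟨e, h₁, h₃⟩ := N.reverse.exists_last_out hv _ (fun _ h => h) hne
  obtain rfl : N.head e = v := h₁
  exact ⟨e, h.lastIn_edge e hv h₃, rfl, h₃⟩

theorem kind_eq_zero (h : N.IsInput σ) {v : Fin n} : σ.natArr .kind v = 0 ↔ N.Inner v := by
  refine ⟨fun h0 hv => ?_, h.kind_inner v⟩
  rcases hv with hv | hv
  · simp [h.kind_source v hv] at h0
  · simp [h.kind_sink v hv] at h0

theorem kind_eq_one (h : N.IsInput σ) {v : Fin n} : σ.natArr .kind v = 1 ↔ v ∈ N.S := by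
  refine ⟨fun h1 => by_contra fun hv => ?_, h.kind_source v⟩
  by_cases hT : v ∈ N.T
  · simp [h.kind_sink v hT] at h1
  · simp [h.kind_inner v (by simp [Inner, hv, hT])] at h1

/-- Being an input depends only on the part of the memory that holds the input. -/
theorem congr {σ' : Store} (h : N.IsInput σ) (hn : σ'.nat .n = σ.nat .n) (hm : σ'.nat .m = σ.nat .m)
    (hk : σ'.natArr .kind = σ.natArr .kind) (ht : σ'.natArr .tail = σ.natArr .tail)
    (hh : σ'.natArr .head = σ.natArr .head) (hfo : σ'.natArr .firstOut = σ.natArr .firstOut)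
    (hno : σ'.natArr .nextOut = σ.natArr .nextOut) (hli : σ'.natArr .lastIn = σ.natArr .lastIn)
    (hpi : σ'.natArr .prevIn = σ.natArr .prevIn) (hc : σ'.realArr .c = σ.realArr .c) :
    N.IsInput σ' where
  n_eq := hn ▸ h.n_eq
  m_eq := hm ▸ h.m_eq
  kind_inner := hk ▸ h.kind_inner
  kind_source := hk ▸ h.kind_source
  kind_sink := hk ▸ h.kind_sink
  tail_eq := ht ▸ h.tail_eq
  head_eq := hh ▸ h.head_eq
  c_eq := hc ▸ h.c_eq
  firstOut_edge := hfo ▸ h.firstOut_edge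
  firstOut_none := hfo ▸ h.firstOut_none
  nextOut_edge := hno ▸ h.nextOut_edge
  nextOut_none := hno ▸ h.nextOut_none
  lastIn_edge := hli ▸ h.lastIn_edge
  lastIn_none := hli ▸ h.lastIn_none
  prevIn_edge := hpi ▸ h.prevIn_edge
  prevIn_none := hpi ▸ h.prevIn_none

end IsInput

end Network

/-! ## States of the algorithm -/

/-- The part of the memory that describes the state of the algorithm. -/
@[ext] structure State (n m : ℕ) where
  f : Fin m → ℝ
  ex : Fin n → ℝ
  act : Fin n → ℕ
  crit : Fin n → ℕ
  closed : Fin m → ℕ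

/-- Indices become elements of `Fin`, but the pointers `act` and `crit` remain natural numbers,
because the value `m` means "no edge". -/
def view (n m : ℕ) (σ : Store) : State n m where
  f e := σ.realArr .f e
  ex v := σ.realArr .ex v
  act v := σ.natArr .act v
  crit v := σ.natArr .crit v
  closed e := σ.natArr .closed e

namespace State

variable {n m : ℕ} (N : Network (Fin n) (Fin m)) (s : State n m)

/-- Blocked edges cannot be active. -/
def Blocked (e : Fin m) : Prop := s.closed e = 1 ∨ s.f e = N.c e

/-- Invariants of the algorithm that do not involve the excesses. -/
structure Sound : Prop where
  f_nonneg : ∀ e, 0 ≤ s.f e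
  f_le : ∀ e, s.f e ≤ N.c e
  -- Needed only for integrality.
  f_mem : ∀ e, s.f e ∈ AddSubgroup.closure (Set.range N.c)
  source : ∀ e, N.tail e ∈ N.S → s.closed e ≠ 1 → s.f e = N.c e
  act_terminal : ∀ v, ¬ N.Inner v → s.act v = m
  -- That the active edge itself is unblocked is kept apart as `Sharp`, since it fails while the
  -- pointer is being advanced.
  act_or : ∀ v, s.act v = m ∨ ∃ e : Fin m, s.act v = e ∧ N.tail e = v
  act_none : ∀ e, N.Inner (N.tail e) → s.act (N.tail e) = m → s.Blocked N e
  act_before : ∀ e a : Fin m, N.Inner (N.tail e) → s.act (N.tail e) = a →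
    N.ltOut (N.tail e) e a → s.Blocked N e
  act_after : ∀ e a : Fin m, N.Inner (N.tail e) → s.act (N.tail e) = a →
    N.ltOut (N.tail e) a e → s.f e = 0
  crit_or : ∀ v, s.crit v = m ∨
    ∃ e : Fin m, s.crit v = e ∧ N.head e = v ∧ N.Inner v ∧ s.act v = m
  crit_none : ∀ e, s.crit (N.head e) = m → s.closed e ≠ 1
  closed_iff : ∀ e a : Fin m, s.crit (N.head e) = a →
    (s.closed e = 1 ↔ e = a ∨ N.ltIn (N.head e) a e)
  crit_after : ∀ e a : Fin m, s.crit (N.head e) = a → N.ltIn (N.head e) a e → s.f e = 0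

/-- The active edge of `v`, if any, is neither closed nor saturated. -/
def Sharp (v : Fin n) : Prop := ∀ e : Fin m, s.act v = e → ¬ s.Blocked N e

/-- The excesses are those of the preflow `f`. -/
structure Balanced : Prop where
  ex_eq : ∀ v, s.ex v = N.excess s.f v
  ex_nonneg : ∀ v, N.Inner v → 0 ≤ s.ex v

/-- The invariants that hold between pushing and balancing steps. -/
structure Valid : Prop where
  sound : s.Sound N
  sharp : ∀ v, s.Sharp N v
  balanced : s.Balanced N

/-- The active edge of the tail of `e` has not yet passed `e`. -/
def Unpassed (e : Fin m) : Prop :=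
  ∃ a : Fin m, s.act (N.tail e) = a ∧ (a = e ∨ N.ltOut (N.tail e) a e)

/-- The number of changes that may still take place. -/
noncomputable def potential : ℕ :=
  {e | s.Unpassed N e}.ncard + {e | ¬ s.Blocked N e}.ncard + {e | ¬ s.closed e = 1}.ncard +
    {e | ¬ (s.closed e = 1 ∧ s.f e = 0)}.ncard

theorem potential_le_four_mul : s.potential N ≤ 4 * m := by
  have h (A : Set (Fin m)) : A.ncard ≤ m := by
    simpa using Set.ncard_le_ncard (Set.subset_univ A)
  unfold potential
  linarith [h {e | s.Unpassed N e}, h {e | ¬ s.Blocked N e}, h {e | ¬ s.closed e = 1},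
    h {e | ¬ (s.closed e = 1 ∧ s.f e = 0)}]

variable {N s} {s' : State n m}

/-- No change is undone on the way from `s` to `s'`. -/
structure Progress (N : Network (Fin n) (Fin m)) (s s' : State n m) : Prop where
  unpassed : ∀ e, s'.Unpassed N e → s.Unpassed N e
  blocked : ∀ e, s.Blocked N e → s'.Blocked N e
  closed : ∀ e, s.closed e = 1 → s'.closed e = 1
  free : ∀ e, s.closed e = 1 → s.f e = 0 → s'.f e = 0

/-- A change took place on the way from `s` to `s'`. -/
def Change (N : Network (Fin n) (Fin m)) (s s' : State n m) : Prop :=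
  ∃ e, (s.Unpassed N e ∧ ¬ s'.Unpassed N e) ∨ (¬ s.Blocked N e ∧ s'.Blocked N e) ∨
      (¬ s.closed e = 1 ∧ s'.closed e = 1) ∨ (s.f e ≠ 0 ∧ s'.closed e = 1 ∧ s'.f e = 0)

theorem Progress.refl : Progress N s s := ⟨fun _ => id, fun _ => id, fun _ => id, fun _ _ => id⟩

theorem Progress.potential_le (h : Progress N s s') : s'.potential N ≤ s.potential N :=
  add_le_add (add_le_add (add_le_add (Set.ncard_le_ncard h.unpassed)
    (Set.ncard_le_ncard fun e => mt (h.blocked e))) (Set.ncard_le_ncard fun e => mt (h.closed e)))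
    (Set.ncard_le_ncard fun e => mt fun h' => ⟨h.closed e h'.1, h.free e h'.1 h'.2⟩)

/-- All four sets counted by the potential can only shrink, and the edge of the change leaves one of
them. -/
theorem Progress.potential_lt (h : Progress N s s') (hc : Change N s s') :
    s'.potential N < s.potential N := by
  obtain ⟨e, he⟩ := hc
  have lt {P Q : Fin m → Prop} (hPQ : ∀ e, Q e → P e) (hP : P e) (hQ : ¬ Q e) :
      {e | Q e}.ncard < {e | P e}.ncard :=
    Set.ncard_lt_ncard ⟨hPQ, fun hs => hQ (hs hP)⟩
  have h₁ := h.unpassed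
  have h₂ := fun e => mt (h.blocked e)
  have h₃ := fun e => mt (h.closed e)
  have h₄ : ∀ e, ¬ (s'.closed e = 1 ∧ s'.f e = 0) → ¬ (s.closed e = 1 ∧ s.f e = 0) :=
    fun e => mt fun h' => ⟨h.closed e h'.1, h.free e h'.1 h'.2⟩
  have l₁ := Set.ncard_le_ncard h₁
  have l₂ := Set.ncard_le_ncard h₂
  have l₃ := Set.ncard_le_ncard h₃
  have l₄ := Set.ncard_le_ncard h₄
  unfold potential
  rcases he with he | he | he | he
  · exact add_lt_add_of_lt_of_le (add_lt_add_of_lt_of_le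
      (add_lt_add_of_lt_of_le (lt h₁ he.1 he.2) l₂) l₃) l₄
  · exact add_lt_add_of_lt_of_le (add_lt_add_of_lt_of_le
      (add_lt_add_of_le_of_lt l₁ (lt h₂ he.1 (not_not.2 he.2))) l₃) l₄
  · exact add_lt_add_of_lt_of_le (add_lt_add_of_le_of_lt
      (add_le_add l₁ l₂) (lt h₃ he.1 (not_not.2 he.2))) l₄
  · exact add_lt_add_of_le_of_lt (add_le_add (add_le_add l₁ l₂) l₃)
      (lt h₄ (fun h => he.1 h.2) (not_not.2 he.2))

end State

/-! ### The excess after a change of flow on one edge. -/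

open Function

theorem Network.excess_eq {n m : ℕ} (N : Network (Fin n) (Fin m)) (f : Fin m → ℝ) (v : Fin n) :
    N.excess f v = (∑ e, if N.head e = v then f e else 0) - ∑ e, if N.tail e = v then f e else 0 := by
  simp only [excess, Finset.sum_filter]
  congr!

theorem Network.excess_update {n m : ℕ} (N : Network (Fin n) (Fin m)) (f : Fin m → ℝ) (e : Fin m)
    (x : ℝ) (v : Fin n) :
    N.excess (update f e x) v = N.excess f v + (if N.head e = v then x - f e else 0) -
      if N.tail e = v then x - f e else 0 := by
  -- Inflow and outflow are treated at once: `g` will be the head map or the tail map.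
  have key (g : Fin m → Fin n) : (∑ a, if g a = v then update f e x a else 0) =
      (∑ a, if g a = v then f a else 0) + if g e = v then x - f e else 0 := by
    rw [← sub_eq_iff_eq_add', ← Finset.sum_sub_distrib, Finset.sum_eq_single e]
    · split_ifs <;> simp
    · intro a _ ha
      simp [ha]
    · simp
  rw [excess_eq, excess_eq, key, key]
  ring

namespace State

variable {n m : ℕ} {N : Network (Fin n) (Fin m)} {s s' : State n m}

/-! ### Elementary transitions -/

/-- Change the flow on one edge. -/
def setFlow (s : State n m) (e : Fin m) (x : ℝ) : State n m := { s with f := update s.f e x }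

/-- Change the excesses. -/
def setEx (s : State n m) (g : Fin n → ℝ) : State n m := { s with ex := g }

/-- Change the active edge of one vertex. -/
def setAct (s : State n m) (v : Fin n) (a : ℕ) : State n m := { s with act := update s.act v a }

/-- Make an edge critical and close it. -/
def close (s : State n m) (v : Fin n) (e : Fin m) : State n m :=
  { s with crit := update s.crit v e, closed := update s.closed e 1 }

theorem Progress.trans {s'' : State n m} (h : Progress N s s') (h' : Progress N s' s'') :
    Progress N s s'' where
  unpassed e he := h.unpassed e (h'.unpassed e he)
  blocked e he := h'.blocked e (h.blocked e he)
  closed e he := h'.closed e (h.closed e he)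
  free e hc he := h'.free e (h.closed e hc) (h.free e hc he)

theorem Progress.setEx (h : Progress N s s') (g : Fin n → ℝ) : Progress N s (s'.setEx g) :=
  ⟨h.unpassed, h.blocked, h.closed, h.free⟩

theorem Sound.setEx (h : s.Sound N) (g : Fin n → ℝ) : (s.setEx g).Sound N :=
  ⟨h.f_nonneg, h.f_le, h.f_mem, h.source, h.act_terminal, h.act_or, h.act_none, h.act_before,
    h.act_after, h.crit_or, h.crit_none, h.closed_iff, h.crit_after⟩

theorem Sound.inner_of_act (h : s.Sound N) {v : Fin n} {e : Fin m} (he : s.act v = e) :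
    N.Inner v := by
  by_contra hv
  have := h.act_terminal v hv
  omega

theorem Sound.tail_of_act (h : s.Sound N) {v : Fin n} {e : Fin m} (he : s.act v = e) :
    N.tail e = v := by
  rcases h.act_or v with h | ⟨a, ha, hv⟩
  · omega
  · obtain rfl : a = e := by omega
    exact hv

theorem Sound.of_crit (h : s.Sound N) {v : Fin n} {e : Fin m} (he : s.crit v = e) :
    N.head e = v ∧ N.Inner v ∧ s.act v = m ∧ s.closed e = 1 := by
  rcases h.crit_or v with h' | ⟨a, ha, rfl, hv⟩
  · omega
  · obtain rfl : a = e := by omega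
    exact ⟨rfl, hv.1, hv.2, (h.closed_iff a a he).2 (.inl rfl)⟩

/-- An unblocked active edge is not pinned by any invariant: blocked edges keep their flow, and the
edges required to be free lie after an active edge or after a critical edge, where the latter ones
are closed and so differ from `e`. -/
theorem Sound.setFlow_raise (h : s.Sound N) {v : Fin n} {e : Fin m} (he : s.act v = e)
    (hs : s.Sharp N v) {x : ℝ} (hx : s.f e ≤ x) (hxc : x ≤ N.c e)
    (hmem : x ∈ AddSubgroup.closure (Set.range N.c)) : (s.setFlow e x).Sound N := by
  obtain rfl := h.tail_of_act he
  have hin := h.inner_of_act he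
  have hb : ¬ s.Blocked N e := hs e he
  have hbl : ∀ a, s.Blocked N a → (s.setFlow e x).Blocked N a := by
    intro a ha
    have : a ≠ e := by rintro rfl; exact hb ha
    simpa [Blocked, setFlow, this] using ha
  refine ⟨?_, ?_, ?_, ?_, h.act_terminal, h.act_or, fun a h₁ h₂ => hbl a (h.act_none a h₁ h₂),
    fun a b h₁ h₂ h₃ => hbl a (h.act_before a b h₁ h₂ h₃), ?_, h.crit_or, h.crit_none,
    h.closed_iff, ?_⟩
  · intro a
    rcases eq_or_ne a e with rfl | ha
    · simpa [setFlow] using (h.f_nonneg a).trans hx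
    · simpa [setFlow, ha] using h.f_nonneg a
  · intro a
    rcases eq_or_ne a e with rfl | ha
    · simpa [setFlow] using hxc
    · simpa [setFlow, ha] using h.f_le a
  · intro a
    rcases eq_or_ne a e with rfl | ha
    · simpa [setFlow] using hmem
    · simpa [setFlow, ha] using h.f_mem a
  · intro a hS hc
    have ha : a ≠ e := by rintro rfl; exact hin (.inl hS)
    simpa [setFlow, ha] using h.source a hS hc
  · intro a b hv hab hlt
    have ha : a ≠ e := by
      rintro rfl
      obtain rfl : b = a := by have : (s.act _ = _) := hab; omega
      exact N.ltOut_irrefl hv hlt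
    simpa [setFlow, ha] using h.act_after a b hv hab hlt
  · intro a b hab hlt
    have ha : a ≠ e := by
      rintro rfl
      exact hb (.inl ((h.closed_iff a b hab).2 (.inr hlt)))
    simpa [setFlow, ha] using h.crit_after a b hab hlt

theorem Sharp.progress_raise {v : Fin n} {e : Fin m} (he : s.act v = e)
    (hs : s.Sharp N v) (x : ℝ) : Progress N s (s.setFlow e x) := by
  refine ⟨fun a => id, fun a ha => ?_, fun a => id, fun a hc hf => ?_⟩
  · have : a ≠ e := by rintro rfl; exact hs a he ha
    simpa [Blocked, setFlow, this] using ha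
  · have : a ≠ e := by rintro rfl; exact hs a he (.inl hc)
    simpa [setFlow, this] using hf

theorem Sharp.setFlow {u : Fin n} (hs : s.Sharp N u) {e : Fin m} (he : s.act u ≠ e) {x : ℝ} :
    (s.setFlow e x).Sharp N u := by
  intro a ha
  have : a ≠ e := by rintro rfl; exact he ha
  simpa [Blocked, State.setFlow, this] using hs a ha

theorem Sharp.setFlow_lt {u : Fin n} (hs : s.Sharp N u) {e : Fin m} (he : s.act u = e) {x : ℝ}
    (hx : x < N.c e) : (s.setFlow e x).Sharp N u := by
  intro a ha
  obtain rfl : a = e := by have : (s.act u = a) := ha; omega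
  simpa [Blocked, State.setFlow, hx.ne, not_or] using fun h => hs a he (.inl h)

/-- Lowering may end saturation, but the critical edge is closed and therefore remains blocked. If
some clause requires it to be free, its flow is already zero and the bounds force `x = 0`. -/
theorem Sound.setFlow_lower (h : s.Sound N) {v : Fin n} {e : Fin m} (he : s.crit v = e)
    {x : ℝ} (hx : 0 ≤ x) (hxf : x ≤ s.f e)
    (hmem : x ∈ AddSubgroup.closure (Set.range N.c)) : (s.setFlow e x).Sound N := by
  obtain ⟨rfl, hin, hact, hcl⟩ := h.of_crit he
  have hbl : ∀ a, s.Blocked N a → (s.setFlow e x).Blocked N a := by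
    intro a ha
    by_cases hae : a = e
    · subst hae; exact .inl hcl
    · simpa [Blocked, setFlow, hae] using ha
  refine ⟨?_, ?_, ?_, ?_, h.act_terminal, h.act_or, fun a h₁ h₂ => hbl a (h.act_none a h₁ h₂),
    fun a b h₁ h₂ h₃ => hbl a (h.act_before a b h₁ h₂ h₃), ?_, h.crit_or, h.crit_none,
    h.closed_iff, ?_⟩
  · intro a
    rcases eq_or_ne a e with rfl | ha
    · simpa [setFlow] using hx
    · simpa [setFlow, ha] using h.f_nonneg a
  · intro a
    rcases eq_or_ne a e with rfl | ha
    · simpa [setFlow] using hxf.trans (h.f_le a)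
    · simpa [setFlow, ha] using h.f_le a
  · intro a
    rcases eq_or_ne a e with rfl | ha
    · simpa [setFlow] using hmem
    · simpa [setFlow, ha] using h.f_mem a
  · intro a hS hc
    have ha : a ≠ e := by rintro rfl; exact hc hcl
    simpa [setFlow, ha] using h.source a hS hc
  · intro a b hv hab hlt
    have := h.act_after a b hv hab hlt
    rcases eq_or_ne a e with rfl | ha
    · simpa [setFlow] using le_antisymm (hxf.trans this.le) hx
    · simpa [setFlow, ha] using this
  · intro a b hab hlt
    have := h.crit_after a b hab hlt
    rcases eq_or_ne a e with rfl | ha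
    · simpa [setFlow] using le_antisymm (hxf.trans this.le) hx
    · simpa [setFlow, ha] using this

theorem Sound.progress_lower (h : s.Sound N) {v : Fin n} {e : Fin m} (he : s.crit v = e)
    {x : ℝ} (hx : 0 ≤ x) (hxf : x ≤ s.f e) : Progress N s (s.setFlow e x) := by
  obtain ⟨rfl, hin, hact, hcl⟩ := h.of_crit he
  refine ⟨fun a => id, fun a ha => ?_, fun a => id, fun a hc hf => ?_⟩
  · by_cases hae : a = e
    · subst hae; exact .inl hcl
    · simpa [Blocked, setFlow, hae] using ha
  · rcases eq_or_ne a e with rfl | ha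
    · simpa [setFlow] using le_antisymm (hxf.trans hf.le) hx
    · simpa [setFlow, ha] using hf

theorem Sharp.setAct {u v : Fin n} (hs : s.Sharp N u) (huv : u ≠ v) {a : ℕ} :
    (s.setAct v a).Sharp N u := by
  intro e he
  exact hs e (by simpa [State.setAct, huv] using he)

/-- Moving the active edge past a blocked edge. -/
theorem Sound.setAct_next (h : s.Sound N) {σ : Store} (hσ : N.IsInput σ) {v : Fin n} {e : Fin m}
    (he : s.act v = e) (hb : s.Blocked N e) :
    (s.setAct v (σ.natArr .nextOut e)).Sound N ∧
      Progress N s (s.setAct v (σ.natArr .nextOut e)) ∧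
        Change N s (s.setAct v (σ.natArr .nextOut e)) := by
  obtain rfl := h.tail_of_act he
  have hin := h.inner_of_act he
  set v := N.tail e with hv
  -- A vertex with an active edge has no critical edge, so moving the pointer cannot violate
  -- `crit_or`.
  have hcr : s.crit v = m := by
    rcases h.crit_or v with h' | ⟨a, -, -, -, h'⟩
    · exact h'
    · omega
  have hcrit : ∀ u, s.crit u = m ∨ ∃ a : Fin m, s.crit u = a ∧ N.head a = u ∧ N.Inner u ∧
      update s.act v (σ.natArr .nextOut e) u = m := by
    intro u
    rcases h.crit_or u with h' | ⟨a, h₁, h₂, h₃, h₄⟩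
    · exact .inl h'
    · have : u ≠ v := by rintro rfl; omega
      exact .inr ⟨a, h₁, h₂, h₃, by simpa [this] using h₄⟩
  have hbef : ∀ a, N.tail a = v → N.ltOut v a e ∨ a = e → s.Blocked N a := by
    rintro a ha (hlt | rfl)
    · exact h.act_before a e (ha ▸ hin) (ha ▸ he) (ha ▸ hlt)
    · exact hb
  have hunp : s.Unpassed N e := ⟨e, he, .inl rfl⟩
  have hother : ∀ u, u ≠ v → update s.act v (σ.natArr .nextOut e) u = s.act u := fun u hu => by
    simp [hu]
  rcases hσ.nextOut_cases hin with ⟨hn, hlast⟩ | ⟨e', hn, ht, hlt, hnext⟩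
  · rw [hn] at hcrit hother ⊢
    have hself : update s.act v m v = m := by simp
    refine ⟨⟨h.f_nonneg, h.f_le, h.f_mem, h.source, ?_, ?_, ?_, ?_, ?_, hcrit, h.crit_none,
      h.closed_iff, h.crit_after⟩, ⟨?_, fun a => id, fun a => id, fun a _ => id⟩,
      ⟨e, .inl ⟨hunp, ?_⟩⟩⟩
    · intro u hu
      have : u ≠ v := by rintro rfl; exact hu hin
      simpa [setAct, this] using h.act_terminal u hu
    · intro u
      by_cases hu : u = v
      · exact .inl (by simp [setAct, hu])
      · simpa [setAct, hu] using h.act_or u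
    · intro a ha hact
      by_cases hu : N.tail a = v
      · refine hbef a hu ?_
        rcases N.ltOut_trichotomy hin hu rfl with h' | h' | h'
        · exact .inl h'
        · exact .inr h'
        · exact absurd h' (hlast a hu)
      · exact h.act_none a ha (by simpa [setAct, hu] using hact)
    · intro a b ha hact hlt
      by_cases hu : N.tail a = v
      · simp [setAct, hu] at hact; omega
      · exact h.act_before a b ha (by simpa [setAct, hu] using hact) hlt
    · intro a b ha hact hlt
      by_cases hu : N.tail a = v
      · simp [setAct, hu] at hact; omega
      · exact h.act_after a b ha (by simpa [setAct, hu] using hact) hlt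
    · rintro a ⟨b, hact, hb⟩
      by_cases hu : N.tail a = v
      · simp [setAct, hu] at hact; omega
      · exact ⟨b, by simpa [setAct, hu] using hact, hb⟩
    · rintro ⟨b, hact, -⟩
      simp [setAct, ← hv] at hact; omega
  · rw [hn] at hcrit hother ⊢
    refine ⟨⟨h.f_nonneg, h.f_le, h.f_mem, h.source, ?_, ?_, ?_, ?_, ?_, hcrit, h.crit_none,
      h.closed_iff, h.crit_after⟩, ⟨?_, fun a => id, fun a => id, fun a _ => id⟩,
      ⟨e, .inl ⟨hunp, ?_⟩⟩⟩
    · intro u hu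
      have : u ≠ v := by rintro rfl; exact hu hin
      simpa [setAct, this] using h.act_terminal u hu
    · intro u
      by_cases hu : u = v
      · exact .inr ⟨e', by simp [setAct, hu], by rw [hu, ht]⟩
      · simpa [setAct, hu] using h.act_or u
    · intro a ha hact
      by_cases hu : N.tail a = v
      · simp [setAct, hu] at hact; omega
      · exact h.act_none a ha (by simpa [setAct, hu] using hact)
    · intro a b ha hact hlt'
      by_cases hu : N.tail a = v
      · obtain rfl : e' = b := by simpa [setAct, hu, Fin.val_inj] using hact
        rw [hu] at hlt'
        refine hbef a hu ?_
        rcases N.ltOut_trichotomy hin hu rfl with h' | h' | h'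
        · exact .inl h'
        · exact .inr h'
        -- No edge lies strictly between `e` and its immediate successor `e'`, so an edge before
        -- `e'` cannot be after `e`.
        · by_cases hae : a = e'
          · subst hae; exact absurd hlt' (hu ▸ N.ltOut_irrefl (hu.symm ▸ hin))
          · have hirr := N.ltOut_irrefl (e := e') (ht.symm ▸ hin)
            rw [ht] at hirr
            exact absurd (N.ltOut_trans hin ht hu ht (hnext a hu h' hae) hlt') hirr
      · exact h.act_before a b ha (by simpa [setAct, hu] using hact) hlt'
    · intro a b ha hact hlt'
      by_cases hu : N.tail a = v
      · obtain rfl : e' = b := by simpa [setAct, hu, Fin.val_inj] using hact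
        rw [hu] at hlt'
        exact h.act_after a e ha (hu ▸ he) (hu ▸ N.ltOut_trans hin rfl ht hu hlt hlt')
      · exact h.act_after a b ha (by simpa [setAct, hu] using hact) hlt'
    · rintro a ⟨b, hact, hb⟩
      by_cases hu : N.tail a = v
      · obtain rfl : e' = b := by simpa [setAct, hu, Fin.val_inj] using hact
        refine ⟨e, hu ▸ he, .inr ?_⟩
        rw [hu] at hb ⊢
        rcases hb with rfl | hb
        · exact hlt
        · exact N.ltOut_trans hin rfl ht hu hlt hb
      · exact ⟨b, by simpa [setAct, hu] using hact, hb⟩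
    · rintro ⟨b, hact, hb⟩
      obtain rfl : e' = b := by simpa [setAct, ← hv, Fin.val_inj] using hact
      rcases hb with rfl | hb
      · exact N.ltOut_irrefl hin hlt
      · exact N.ltOut_irrefl hin (N.ltOut_trans hin rfl ht rfl hlt hb)

/-- Closing the last unclosed edge of `v`, once the later edges are free. -/
theorem Sound.close (h : s.Sound N) {e : Fin m} (hin : N.Inner (N.head e))
    (hact : s.act (N.head e) = m) (hc : s.closed e ≠ 1)
    (hlater : ∀ a, N.head a = N.head e → (N.ltIn (N.head e) e a ↔ s.closed a = 1))
    (hfree : ∀ a, N.head a = N.head e → s.closed a = 1 → s.f a = 0) :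
    (s.close (N.head e) e).Sound N ∧ Progress N s (s.close (N.head e) e) ∧
      Change N s (s.close (N.head e) e) := by
  have hbl : ∀ a, s.Blocked N a → (s.close (N.head e) e).Blocked N a := by
    intro a ha
    by_cases hae : a = e
    · exact .inl (by simp [State.close, hae])
    · simpa [Blocked, State.close, hae] using ha
  have hcl : ∀ a, s.closed a = 1 → (s.close (N.head e) e).closed a = 1 := by
    intro a ha
    by_cases hae : a = e
    · simp [State.close, hae]
    · simpa [State.close, hae] using ha
  refine ⟨⟨h.f_nonneg, h.f_le, h.f_mem, fun a hS ha => h.source a hS (mt (hcl a) ha),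
    h.act_terminal, h.act_or, fun a h₁ h₂ => hbl a (h.act_none a h₁ h₂),
    fun a b h₁ h₂ h₃ => hbl a (h.act_before a b h₁ h₂ h₃), h.act_after, ?_, ?_, ?_, ?_⟩,
    ⟨fun a => id, hbl, hcl, fun a _ => id⟩,
    ⟨e, .inr (.inr (.inl ⟨hc, by simp [State.close]⟩))⟩⟩
  · intro v
    by_cases hv : v = N.head e
    · exact .inr ⟨e, by simp [State.close, hv], hv.symm, hv ▸ hin, hv ▸ hact⟩
    · simpa [State.close, hv] using h.crit_or v
  · intro a ha
    by_cases hv : N.head a = N.head e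
    · simp [State.close, hv] at ha; omega
    · have hae : a ≠ e := by rintro rfl; exact hv rfl
      simpa [State.close, hae] using h.crit_none a (by simpa [State.close, hv] using ha)
  · intro a b ha
    by_cases hv : N.head a = N.head e
    · obtain rfl : e = b := by simpa [State.close, hv, Fin.val_inj] using ha
      by_cases hae : a = e
      · simp [State.close, hae]
      · simpa [State.close, hae, hv] using (hlater a hv).symm
    · have hae : a ≠ e := by rintro rfl; exact hv rfl
      simpa [State.close, hae] using h.closed_iff a b (by simpa [State.close, hv] using ha)
  · intro a b ha hlt
    by_cases hv : N.head a = N.head e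
    · obtain rfl : e = b := by simpa [State.close, hv, Fin.val_inj] using ha
      exact hfree a hv ((hlater a hv).1 (hv ▸ hlt))
    · exact h.crit_after a b (by simpa [State.close, hv] using ha) hlt

theorem Sharp.close {u : Fin n} (hs : s.Sharp N u) {e : Fin m} (he : s.act u ≠ e) {v : Fin n} :
    (s.close v e).Sharp N u := by
  intro a ha
  have : a ≠ e := by rintro rfl; exact he ha
  simpa [Blocked, State.close, this] using hs a ha

/-! ### Moving excess -/

/-- The excesses after `δ` units have been moved from `v` to `w`. -/
noncomputable def moveEx (g : Fin n → ℝ) (v w : Fin n) (δ : ℝ) : Fin n → ℝ :=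
  update (update g v (g v - δ)) w (g w + δ)

theorem excess_raise (s : State n m) (e : Fin m) (δ : ℝ) (u : Fin n) :
    N.excess (s.setFlow e (s.f e + δ)).f u = N.excess s.f u +
      (if u = N.head e then δ else 0) - if u = N.tail e then δ else 0 := by
  simp [setFlow, N.excess_update, eq_comm]

theorem excess_lower (s : State n m) (e : Fin m) (δ : ℝ) (u : Fin n) :
    N.excess (s.setFlow e (s.f e - δ)).f u = N.excess s.f u +
      (if u = N.tail e then δ else 0) - if u = N.head e then δ else 0 := by
  simp only [setFlow, N.excess_update, eq_comm]
  split_ifs <;> ring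

/-- Nonnegativity is at risk only at `v`, where the bound on `δ` protects it. As `v ≠ w`, the two
updates in `moveEx` do not interfere. -/
theorem Balanced.move (h : s.Balanced N) {v w : Fin n} (hvw : v ≠ w) {δ : ℝ} (h0 : 0 ≤ δ)
    (hδ : δ ≤ s.ex v)
    (hf : ∀ u, N.excess s'.f u = N.excess s.f u + (if u = w then δ else 0) -
      if u = v then δ else 0) (hex : s'.ex = moveEx s.ex v w δ) : s'.Balanced N := by
  have key : ∀ u, s'.ex u = s.ex u + (if u = w then δ else 0) - if u = v then δ else 0 := by
    intro u
    rw [hex]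
    unfold moveEx
    by_cases hw : u = w
    · subst hw; simp [hvw.symm]
    · by_cases hv : u = v
      · subst hv; simp [hw]
      · simp [hv, hw]
  refine ⟨fun u => by rw [key, hf, h.ex_eq], fun u hu => ?_⟩
  have := h.ex_nonneg u hu
  rw [key]
  split_ifs with h₁ h₂ h₂
  · linarith
  · linarith
  · subst h₂; linarith
  · linarith

/-- The head of the active edge or the tail of the critical edge of `v`. -/
def Next (N : Network (Fin n) (Fin m)) (s : State n m) (v w : Fin n) : Prop :=
  (∃ e : Fin m, s.act v = e ∧ w = N.head e) ∨
    s.act v = m ∧ ∃ e : Fin m, s.crit v = e ∧ 0 < s.f e ∧ w = N.tail e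

/-- The critical edge counts only when there is no active edge. Unique successors are what makes the
traced paths merge into trees or close up into a cycle. -/
theorem Next.unique {v w w' : Fin n} (h : Next N s v w) (h' : Next N s v w') : w = w' := by
  rcases h with ⟨e, he, rfl⟩ | ⟨h₀, e, he, -, rfl⟩ <;>
    rcases h' with ⟨e', he', rfl⟩ | ⟨h₀', e', he', -, rfl⟩
  · obtain rfl : e = e' := by omega
    rfl
  · omega
  · omega
  · obtain rfl : e = e' := by omega
    rfl

/-- The excess of `v` moved on without any change of active and critical edges. -/
structure Quiet (N : Network (Fin n) (Fin m)) (s s' : State n m) (v : Fin n) : Prop where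
  next : ∀ u w, Next N s u w → Next N s' u w
  moved : ∃ w, Next N s' v w ∧ s'.ex = moveEx s.ex v w (s.ex v)

/-- At an inner vertex with positive excess, some entering edge is not free. -/
theorem Valid.exists_inflow (h : s.Valid N) {v : Fin n} (hv : 0 < s.ex v) :
    ∃ e, N.head e = v ∧ 0 < s.f e := by
  by_contra! hne
  rw [h.balanced.ex_eq] at hv
  rw [N.excess_eq] at hv
  have h₁ : (∑ e, if N.head e = v then s.f e else 0) ≤ 0 :=
    Finset.sum_nonpos fun e _ => by split_ifs with he; exacts [hne e he, le_rfl]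
  have h₂ : 0 ≤ ∑ e, if N.tail e = v then s.f e else 0 :=
    Finset.sum_nonneg fun e _ => by split_ifs; exacts [h.sound.f_nonneg e, le_rfl]
  linarith

/-! ### Stability of the final flow. -/

/-- When no inner vertex has positive excess, the flow is stable. -/
theorem Valid.isStableFlow (h : s.Valid N) (hP : N.CondP)
    (hex : ∀ v, N.Inner v → s.ex v ≤ 0) : N.IsStableFlow s.f := by
  have hflow : ∀ v, N.Inner v → N.excess s.f v = 0 := fun v hv => by
    rw [← h.balanced.ex_eq]
    exact le_antisymm (hex v hv) (h.balanced.ex_nonneg v hv)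
  refine ⟨⟨⟨fun e => ⟨h.sound.f_nonneg e, h.sound.f_le e⟩, fun v hS => ?_⟩, hflow⟩, ?_⟩
  · by_cases hv : N.Inner v
    · exact (hflow v hv).ge
    -- A vertex that is neither a source nor inner is a sink; by (P) it has no outflow.
    · have hT : v ∈ N.T := by
        by_contra hT
        exact hv fun hST => hST.elim hS hT
      have h₂ : (∑ e, if N.tail e = v then s.f e else 0) = 0 :=
        Finset.sum_eq_zero fun e _ => if_neg fun he : N.tail e = v => hP.2 e (he ▸ hT)
      rw [N.excess_eq, h₂, sub_zero]
      exact Finset.sum_nonneg fun e _ => by split_ifs; exacts [h.sound.f_nonneg e, le_rfl]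
  intro k P hpath hunsat
  have hclosed_inner : ∀ e, s.closed e = 1 → ∃ a : Fin m, s.crit (N.head e) = a ∧
      N.Inner (N.head e) ∧ s.act (N.head e) = m := by
    intro e he
    rcases h.sound.crit_or (N.head e) with h' | ⟨a, ha, -, h₁, h₂⟩
    · exact absurd he (h.sound.crit_none e h')
    · exact ⟨a, ha, h₁, h₂⟩
  by_cases h0 : s.closed (P 0) = 1
  · right
    -- Closedness travels forward: the head of a closed edge has no active edge, so the next edge is
    -- blocked, and being unsaturated it must be closed.
    have hall : ∀ i, s.closed (P i) = 1 := by
      intro i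
      induction i using Fin.induction with
      | zero => exact h0
      | succ i ih =>
        obtain ⟨a, -, h₁, h₂⟩ := hclosed_inner _ ih
        rw [hpath i] at h₁ h₂
        exact (h.sound.act_none _ h₁ h₂).resolve_right (hunsat _).ne
    have hl := hall (Fin.last k)
    obtain ⟨a, ha, hin, -⟩ := hclosed_inner _ hl
    refine ⟨hin, fun e he hlt => ?_⟩
    rw [← he] at ha hlt hin
    -- The last edge is the critical edge or later, so edges after it are after the critical edge
    -- and hence free.
    have hale := (h.sound.closed_iff (P (Fin.last k)) a (he ▸ ha)).1 hl
    refine h.sound.crit_after e a ha ?_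
    have hat : N.head a = N.head e := (h.sound.of_crit ha).1
    rcases hale with h' | h'
    · exact h' ▸ hlt
    · exact N.ltIn_trans hin hat he.symm rfl (he ▸ h') hlt
  · left
    have hin : N.Inner (N.tail (P 0)) := by
      rintro (hS | hT)
      · exact (hunsat 0).ne (h.sound.source _ hS h0)
      · exact hP.2 _ hT
    -- An unblocked edge forces an active edge at its tail that does not come after it.
    have hnb : ¬ s.Blocked N (P 0) := not_or.2 ⟨h0, (hunsat 0).ne⟩
    refine ⟨hin, fun e he hlt => ?_⟩
    rcases h.sound.act_or (N.tail (P 0)) with h' | ⟨a, ha, hat⟩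
    · exact absurd (h.sound.act_none _ hin h') hnb
    · refine h.sound.act_after e a (he ▸ hin) (he ▸ ha) ?_
      rw [he]
      rcases N.ltOut_trichotomy hin hat rfl with h' | h' | h'
      · exact N.ltOut_trans hin hat rfl he h' hlt
      · exact h' ▸ hlt
      · exact absurd (h.sound.act_before _ a hin ha h') hnb

end State

open State

variable {n m : ℕ} {N : Network (Fin n) (Fin m)} {σ : Store}

/-! ## Pushing and balancing -/

@[simp] theorem view_set (x : NatVar) (k : ℕ) : view n m (σ.set x k) = view n m σ := rfl

@[simp] theorem view_setR (x : RealVar) (r : ℝ) : view n m (σ.setR x r) = view n m σ := rfl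

@[simp] theorem view_put_act (v : Fin n) (a : ℕ) :
    view n m (σ.put .act v a) = (view n m σ).setAct v a := by
  ext u <;> simp [view, setAct, update_apply, Fin.val_inj]

@[simp] theorem view_put_crit_closed (v : Fin n) (e : Fin m) :
    view n m ((σ.put .crit v e).put .closed e 1) = (view n m σ).close v e := by
  ext u <;> simp [view, State.close, update_apply, Fin.val_inj]

@[simp] theorem view_putR_f (e : Fin m) (x : ℝ) :
    view n m (σ.putR .f e x) = (view n m σ).setFlow e x := by
  ext u <;> simp [view, setFlow, update_apply, Fin.val_inj]

@[simp] theorem view_putR_ex (v : Fin n) (x : ℝ) :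
    view n m (σ.putR .ex v x) = (view n m σ).setEx (update (view n m σ).ex v x) := by
  ext u <;> simp [view, setEx, update_apply, Fin.val_inj]

theorem Network.IsInput.put (h : N.IsInput σ) {a : NatArr}
    (ha : a ≠ .kind ∧ a ≠ .tail ∧ a ≠ .head ∧ a ≠ .firstOut ∧ a ≠ .nextOut ∧ a ≠ .lastIn ∧
      a ≠ .prevIn) (i k : ℕ) : N.IsInput (σ.put a i k) := by
  obtain ⟨h₁, h₂, h₃, h₄, h₅, h₆, h₇⟩ := ha
  apply h.congr <;> simp [h₁.symm, h₂.symm, h₃.symm, h₄.symm, h₅.symm, h₆.symm, h₇.symm]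

theorem Network.IsInput.set (h : N.IsInput σ) {x : NatVar} (hx : x ≠ .n ∧ x ≠ .m) (k : ℕ) :
    N.IsInput (σ.set x k) := by
  apply h.congr <;> simp [hx.1.symm, hx.2.symm]

theorem Network.IsInput.putR (h : N.IsInput σ) {a : RealArr} (ha : a ≠ .c) (i : ℕ) (r : ℝ) :
    N.IsInput (σ.putR a i r) := by
  apply h.congr <;> simp [ha.symm]

/-- Each pass moves the pointer past a blocked edge, and this event pays 200 units; the extra 50
cover the final test. Naming the final memory explicitly records that nothing but one cell changed.
-/
theorem advance_runs (hσ : N.IsInput σ) {x : NatVar} {v : Fin n} (hx : σ.nat x = v)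
    (hs : (view n m σ).Sound N) :
    Runs (Algorithm.advance x) σ fun σ' t => ∃ a, σ' = σ.put .act v a ∧
      ((view n m σ).setAct v a).Sound N ∧ ((view n m σ).setAct v a).Sharp N v ∧
      Progress N (view n m σ) ((view n m σ).setAct v a) ∧
      t + 200 * ((view n m σ).setAct v a).potential N ≤ 200 * (view n m σ).potential N + 50 := by
  refine (runs_loop (fun τ => ∃ a, τ = σ.put .act v a ∧ ((view n m σ).setAct v a).Sound N ∧
      Progress N (view n m σ) ((view n m σ).setAct v a))
    (fun τ => 200 * (view n m τ).potential N) ?_ ?_).mono ?_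
  · rintro _ ⟨a, rfl, ha, hp⟩ hb
    simp [hx, hσ.m_eq] at hb ⊢
    have hor := ha.act_or v
    simp only [setAct, update_self] at hor
    obtain ⟨e, rfl, -⟩ := hor.resolve_left hb.1
    have hbl : ((view n m σ).setAct v e).Blocked N e := by
      simpa [Blocked, setAct, view, hσ.c_eq] using hb.2
    obtain ⟨h₁, h₂, h₃⟩ := ha.setAct_next hσ (v := v) (e := e) (by simp [setAct]) hbl
    have : ((view n m σ).setAct v e).setAct v (σ.natArr .nextOut e) =
      (view n m σ).setAct v (σ.natArr .nextOut e) := by simp [setAct]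
    rw [this] at h₁ h₂ h₃ ⊢
    refine ⟨⟨_, ?_, h₁, hp.trans h₂⟩, ?_⟩
    · simp [Store.put]
    · have := h₂.potential_lt h₃
      omega
  · refine ⟨σ.natArr .act v, ?_, ?_⟩
    · simp [Store.put]
    · have : (view n m σ).setAct v (σ.natArr .act v) = view n m σ := by
        ext <;> simp [setAct, view]
      rw [this]
      exact ⟨hs, .refl⟩
  · rintro _ t ⟨⟨a, rfl, ha, hp⟩, hb, ht⟩
    refine ⟨a, rfl, ha, ?_, hp, ?_⟩
    · rintro e he
      obtain rfl : a = e := by simpa [setAct] using he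
      simp [hx, hσ.m_eq, e.2.ne] at hb
      simpa [Blocked, setAct, view, hσ.c_eq] using hb
    · simp at ht
      omega

/-- What pushing and balancing leave unchanged. -/
structure Frame (σ σ' : Store) : Prop where
  nat : ∀ x, x ≠ .e → x ≠ .u → x ≠ .changed → σ'.nat x = σ.nat x
  natArr : ∀ a, a ≠ .act → a ≠ .crit → a ≠ .closed → σ'.natArr a = σ.natArr a
  c : σ'.realArr .c = σ.realArr .c

theorem Frame.isInput {σ' : Store} (h : Frame σ σ') (hσ : N.IsInput σ) : N.IsInput σ' := by
  apply hσ.congr <;> simp [h.nat, h.natArr, h.c]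

theorem Frame.trans {σ' σ'' : Store} (h : Frame σ σ') (h' : Frame σ' σ'') : Frame σ σ'' :=
  ⟨fun x h₁ h₂ h₃ => (h'.nat x h₁ h₂ h₃).trans (h.nat x h₁ h₂ h₃),
    fun a h₁ h₂ h₃ => (h'.natArr a h₁ h₂ h₃).trans (h.natArr a h₁ h₂ h₃), h'.c.trans h.c⟩

theorem Frame.refl : Frame σ σ := ⟨fun _ _ _ _ => rfl, fun _ _ _ _ => rfl, rfl⟩

/-! ### Transfers of excess along one edge. -/

namespace State

variable {s s' : State n m}

/-- The state after `δ` units have been pushed through `e`. -/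
noncomputable def raise (N : Network (Fin n) (Fin m)) (s : State n m) (e : Fin m) (δ : ℝ) :
    State n m :=
  (s.setFlow e (s.f e + δ)).setEx (moveEx s.ex (N.tail e) (N.head e) δ)

/-- The state after `δ` units have been sent back through `e`. -/
noncomputable def lower (N : Network (Fin n) (Fin m)) (s : State n m) (e : Fin m) (δ : ℝ) :
    State n m :=
  (s.setFlow e (s.f e - δ)).setEx (moveEx s.ex (N.head e) (N.tail e) δ)

theorem Sharp.setEx {v : Fin n} (h : s.Sharp N v) (g : Fin n → ℝ) : (s.setEx g).Sharp N v := h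

theorem Balanced.setAct (h : s.Balanced N) (v : Fin n) (a : ℕ) : (s.setAct v a).Balanced N :=
  ⟨h.ex_eq, h.ex_nonneg⟩

theorem Balanced.close (h : s.Balanced N) (v : Fin n) (e : Fin m) : (s.close v e).Balanced N :=
  ⟨h.ex_eq, h.ex_nonneg⟩

/-- Excesses matter for integrality because they enter the minima that determine the amounts moved.
-/
theorem Valid.ex_mem (h : s.Valid N) (v : Fin n) :
    s.ex v ∈ AddSubgroup.closure (Set.range N.c) := by
  rw [h.balanced.ex_eq]
  exact sub_mem (sum_mem fun e _ => h.sound.f_mem e) (sum_mem fun e _ => h.sound.f_mem e)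

theorem capacity_mem (N : Network (Fin n) (Fin m)) (e : Fin m) :
    N.c e ∈ AddSubgroup.closure (Set.range N.c) :=
  AddSubgroup.subset_closure ⟨e, rfl⟩

theorem min_mem {A : AddSubgroup ℝ} {a b : ℝ} (ha : a ∈ A) (hb : b ∈ A) : min a b ∈ A := by
  rcases min_choice a b with h | h <;> rw [h] <;> assumption

theorem Valid.balanced_raise (h : s.Valid N) {e : Fin m} {δ : ℝ} (h0 : 0 ≤ δ)
    (hδ : δ ≤ s.ex (N.tail e)) : (s.raise N e δ).Balanced N :=
  h.balanced.move (N.loopless e) h0 hδ (s.excess_raise e δ) rfl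

theorem Valid.balanced_lower (h : s.Valid N) {e : Fin m} {δ : ℝ} (h0 : 0 ≤ δ)
    (hδ : δ ≤ s.ex (N.head e)) : (s.lower N e δ).Balanced N :=
  h.balanced.move (N.loopless e).symm h0 hδ (s.excess_lower e δ) rfl

theorem quiet_raise {e : Fin m} (he : s.act (N.tail e) = e) (h0 : 0 ≤ s.ex (N.tail e)) :
    Quiet N s (s.raise N e (s.ex (N.tail e))) (N.tail e) := by
  refine ⟨fun u w hn => ?_, N.head e, .inl ⟨e, he, rfl⟩, rfl⟩
  rcases hn with h | ⟨hu, a, ha, hf, rfl⟩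
  · exact .inl h
  · refine .inr ⟨hu, a, ha, ?_, rfl⟩
    rcases eq_or_ne a e with rfl | hae
    · simpa [raise, setEx, setFlow] using by positivity
    · simpa [raise, setEx, setFlow, hae] using hf

/-- The strict inequality keeps positive flow on the critical edge, as `Next` demands. -/
theorem quiet_lower {e : Fin m} (hact : s.act (N.head e) = m) (he : s.crit (N.head e) = e)
    (hlt : s.ex (N.head e) < s.f e) :
    Quiet N s (s.lower N e (s.ex (N.head e))) (N.head e) := by
  refine ⟨fun u w hn => ?_, N.tail e, .inr ⟨hact, e, he, ?_, rfl⟩, rfl⟩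
  · rcases hn with h | ⟨hu, a, ha, hf, rfl⟩
    · exact .inl h
    · refine .inr ⟨hu, a, ha, ?_, rfl⟩
      rcases eq_or_ne a e with rfl | hae
      · simpa [lower, setEx, setFlow] using hlt
      · simpa [lower, setEx, setFlow, hae] using hf
  · simpa [lower, setEx, setFlow] using hlt

end State

theorem State.Valid.of_advance {s : State n m} {v : Fin n} {a : ℕ} (h : (s.setAct v a).Sound N)
    (hv : (s.setAct v a).Sharp N v) (hs : ∀ u, u ≠ v → s.Sharp N u) (hb : s.Balanced N) :
    (s.setAct v a).Valid N := by
  refine ⟨h, fun u => ?_, hb.setAct v a⟩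
  by_cases hu : u = v
  · exact hu ▸ hv
  · exact (hs u hu).setAct hu

/-- The effect of processing the vertex `v`: a change took place, or all of its excess moved to the
next vertex. -/
structure Processed (N : Network (Fin n) (Fin m)) (σ σ' : Store) (v : Fin n) : Prop where
  frame : Frame σ σ'
  valid : (view n m σ').Valid N
  potential_le : (view n m σ').potential N ≤ (view n m σ).potential N
  outcome : (σ'.nat .changed = 1 ∧ (view n m σ').potential N < (view n m σ).potential N) ∨
    (σ'.nat .changed = 0 ∧ (view n m σ').ex v = 0 ∧ Quiet N (view n m σ) (view n m σ') v)

/-- The state in the course of processing `v`. -/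
structure Processing (N : Network (Fin n) (Fin m)) (σ σ' : Store) (v : Fin n) : Prop where
  frame : Frame σ σ'
  valid : (view n m σ').Valid N
  potential_le : (view n m σ').potential N ≤ (view n m σ).potential N
  outcome : (σ'.nat .changed = 1 ∧ (view n m σ').potential N < (view n m σ).potential N) ∨
    (σ'.nat .changed = 0 ∧ view n m σ' = view n m σ) ∨
    (σ'.nat .changed = 0 ∧ (view n m σ').ex v = 0 ∧ Quiet N (view n m σ) (view n m σ') v)

/-- A pass that saturates the active edge is paid by this event. Any other pass exhausts the excess
and ends the loop; it is paid by the 100 units that the measure holds while the excess is positive.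
-/
theorem push_runs (hσ : N.IsInput σ) (hs : (view n m σ).Valid N) {v : Fin n}
    (hv : σ.nat .v = v) (hex : 0 < (view n m σ).ex v) (hact : (view n m σ).act v ≠ m)
    (hch : σ.nat .changed = 0) :
    Runs (Algorithm.push .v) σ fun σ' t => Processed N σ σ' v ∧
      t + 200 * (view n m σ').potential N ≤ 200 * (view n m σ).potential N + 120 := by
  refine (runs_loop (fun τ => Processing N σ τ v)
    (fun τ => 200 * (view n m τ).potential N + if 0 < (view n m τ).ex v then 100 else 0)
    ?_ ⟨.refl, hs, le_rfl, .inr (.inl ⟨hch, rfl⟩)⟩).mono ?_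
  · rintro τ hτ hb
    have hin := hτ.frame.isInput hσ
    have hvτ : τ.nat .v = v := (hτ.frame.nat _ (by simp) (by simp) (by simp)).trans hv
    simp [hvτ, hin.m_eq] at hb
    obtain ⟨hex', hne⟩ := hb
    obtain ⟨e, he, rfl⟩ := (hτ.valid.sound.act_or v).resolve_left hne
    have vf : τ.realArr .f e = (view n m τ).f e := rfl
    have vex : ∀ u : Fin n, τ.realArr .ex u = (view n m τ).ex u := fun _ => rfl
    have vact : τ.natArr .act (N.tail e) = e := he
    have hloop : (N.head e : ℕ) ≠ N.tail e := fun h => N.loopless e (Fin.val_injective h).symm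
    rw [vex] at hex'
    set δ := min ((view n m τ).ex (N.tail e)) (N.c e - (view n m τ).f e) with hδ
    have hδc : δ ≤ N.c e - (view n m τ).f e := min_le_right _ _
    have hδe : δ ≤ (view n m τ).ex (N.tail e) := min_le_left _ _
    have hδ0 : 0 ≤ δ := le_min hex'.le (sub_nonneg.2 (hτ.valid.sound.f_le e))
    have hmem : (view n m τ).f e + δ ∈ AddSubgroup.closure (Set.range N.c) :=
      add_mem (hτ.valid.sound.f_mem e) (min_mem (hτ.valid.ex_mem _)
        (sub_mem (capacity_mem N e) (hτ.valid.sound.f_mem e)))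
    have hsharp := hτ.valid.sharp (N.tail e)
    have hsound : ((view n m τ).raise N e δ).Sound N := (hτ.valid.sound.setFlow_raise he hsharp
      (by linarith) (by linarith) hmem).setEx _
    have hprog : Progress N (view n m τ) ((view n m τ).raise N e δ) :=
      (hsharp.progress_raise he _).setEx _
    have hbal := hτ.valid.balanced_raise hδ0 hδe
    have hsharp' : ∀ u, u ≠ N.tail e → ((view n m τ).raise N e δ).Sharp N u := fun u hu =>
      Sharp.setEx ((hτ.valid.sharp u).setFlow
        fun hu' => hu (hτ.valid.sound.tail_of_act hu').symm) _
    simp [hvτ, vact, vf, vex, hin.head_eq, hin.c_eq, hloop, hex', ← hδ, -view_putR_f, -view_putR_ex]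
    obtain ⟨τ₁, hτ₁⟩ : ∃ τ₁, τ₁ = (((((τ.set .e e).setR .delta δ).putR .f e
      ((view n m τ).f e + δ)).putR .ex (N.tail e) ((view n m τ).ex (N.tail e) - δ)).putR .ex
        (N.head e) ((view n m τ).ex (N.head e) + δ)) := ⟨_, rfl⟩
    rw [← hτ₁]
    have hview : view n m τ₁ = (view n m τ).raise N e δ := by
      rw [hτ₁]
      simp [raise, setEx, setFlow, moveEx]
    have hfr : Frame τ τ₁ := by
      constructor <;> simp +contextual [hτ₁]
    have hch₁ : τ₁.nat .changed = τ.nat .changed := by simp [hτ₁]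
    rw [hview]
    clear_value δ
    refine ⟨fun hsat => ?_, fun hns => ?_⟩
    · have hsat' : Change N (view n m τ) ((view n m τ).raise N e δ) := by
        refine ⟨e, .inr (.inl ⟨hsharp e he, .inr ?_⟩)⟩
        simpa [raise, setEx, setFlow] using hsat
      have hlt := hprog.potential_lt hsat'
      have hfr' : Frame τ (τ₁.set .changed 1) := hfr.trans (by constructor <;> simp +contextual)
      refine (advance_runs (hfr'.isInput hin) (v := N.tail e) ?_ (by simpa [hview])).mono ?_
      · simpa [hvτ] using hfr'.nat .v (by simp) (by simp) (by simp)
      · rintro _ t ⟨a, rfl, h₁, h₂, h₃, h₄⟩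
        rw [view_set, hview] at h₁ h₂ h₃ h₄
        rw [view_put_act, view_set, hview]
        have hle := h₃.potential_le
        have hτle := hτ.potential_le
        refine ⟨⟨?_, ?_, ?_, .inl ⟨?_, ?_⟩⟩, ?_⟩
        · exact hτ.frame.trans (hfr'.trans (by constructor <;> simp +contextual))
        · rw [view_put_act, view_set, hview]
          exact Valid.of_advance h₁ h₂ hsharp' hbal
        · rw [view_put_act, view_set, hview]
          omega
        · simp
        · rw [view_put_act, view_set, hview]
          omega
        · split_ifs <;> omega
    -- Since the edge is not saturated, the minimum was the excess.
    · have hδex : δ = (view n m τ).ex (N.tail e) := by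
        rcases min_choice ((view n m τ).ex (N.tail e)) (N.c e - (view n m τ).f e) with h | h
        · rw [hδ, h]
        · rw [hδ, h] at hns
          exact absurd (by ring) hns
      have hv0 : ((view n m τ).raise N e δ).ex (N.tail e) = 0 := by
        simp [raise, setEx, moveEx, N.loopless, hδex]
      have hle := hprog.potential_le
      have hτle := hτ.potential_le
      refine ⟨⟨hτ.frame.trans hfr, ?_, ?_, ?_⟩, ?_⟩
      · rw [hview]
        refine ⟨hsound, fun u => ?_, hbal⟩
        by_cases hu : u = N.tail e
        · subst hu
          exact Sharp.setEx (hsharp.setFlow_lt he (lt_of_le_of_ne (by linarith) hns)) _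
        · exact hsharp' u hu
      · rw [hview]
        omega
      · rw [hview, hch₁]
        -- If nothing happened before, the whole original excess has just moved at once, which makes
        -- the step quiet. The third case contradicts the positive excess at the start of the pass.
        rcases hτ.outcome with ⟨h, h'⟩ | ⟨h, h'⟩ | ⟨-, h, -⟩
        · exact .inl ⟨h, by omega⟩
        · refine .inr (.inr ⟨h, hv0, ?_⟩)
          rw [← h', hδex]
          exact quiet_raise he hex'.le
        · exact absurd h hex'.ne'
      · rw [hv0, if_neg (lt_irrefl _)]
        omega
  · rintro τ t ⟨hτ, hb, ht⟩
    refine ⟨⟨hτ.frame, hτ.valid, hτ.potential_le, ?_⟩, ?_⟩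
    · rcases hτ.outcome with h | ⟨-, h⟩ | h
      · exact .inl h
      · have hin := hτ.frame.isInput hσ
        have hvτ : τ.nat .v = v := (hτ.frame.nat _ (by simp) (by simp) (by simp)).trans hv
        rw [← h] at hex hact
        simp [hvτ, hin.m_eq] at hb
        exact absurd (hb hex) hact
      · exact .inr h
    · simp [hex] at ht
      omega

/-- The edge `e` is the last unclosed edge entering `v`, which has no active edge, and the closed
edges entering `v` are free. -/
structure State.Closable (N : Network (Fin n) (Fin m)) (s : State n m) (v : Fin n) (e : Fin m) :
    Prop where
  head_eq : N.head e = v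
  inner : N.Inner v
  act_eq : s.act v = m
  not_closed : s.closed e ≠ 1
  later : ∀ a, N.head a = v → (N.ltIn v e a ↔ s.closed a = 1)
  free : ∀ a, N.head a = v → s.closed a = 1 → s.f a = 0

/-- Positive excess provides an entering edge. Without a critical edge no entering edge is closed,
so the conditions on closed edges hold trivially for the last one. -/
theorem State.Valid.closable_last {s : State n m} (h : s.Valid N) (hσ : N.IsInput σ) {v : Fin n}
    (hv : N.Inner v) (hact : s.act v = m) (hex : 0 < s.ex v) (hcr : s.crit v = m) :
    ∃ e : Fin m, σ.natArr .lastIn v = e ∧ s.Closable N v e := by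
  obtain ⟨a, ha, -⟩ := h.exists_inflow hex
  obtain ⟨e, h₁, rfl, h₂⟩ := hσ.lastIn_edge_of_ne hv ⟨a, ha⟩
  have hno : ∀ b, N.head b = N.head e → s.closed b ≠ 1 := fun b hb =>
    h.sound.crit_none b (hb ▸ hcr)
  refine ⟨e, h₁, rfl, hv, hact, hno e rfl, fun b hb => ⟨fun hlt => ?_, fun hc => absurd hc (hno b hb)⟩,
    fun b hb hc => absurd hc (hno b hb)⟩
  by_cases hbe : b = e
  · exact absurd (hbe ▸ hlt) (N.ltIn_irrefl hv)
  · exact absurd (N.ltIn_trans hv rfl hb rfl hlt (h₂ b hb hbe)) (N.ltIn_irrefl hv)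

/-- The inflow behind the positive excess cannot sit on the critical edge or later, where all edges
are free. So an earlier edge exists, and the closest one is the next to be closed: balancing never
runs out of edges. -/
theorem State.Valid.closable_prev {s : State n m} (h : s.Valid N) (hσ : N.IsInput σ) {v : Fin n}
    (hex : 0 < s.ex v) {e : Fin m} (hcr : s.crit v = e) (hf : s.f e = 0) :
    ∃ e' : Fin m, σ.natArr .prevIn e = e' ∧ s.Closable N v e' := by
  obtain ⟨a, ha, hfa⟩ := h.exists_inflow hex
  obtain ⟨rfl, hv, hact, hc⟩ := h.sound.of_crit hcr
  have hirr := N.ltIn_irrefl hv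
  have hae : N.ltIn (N.head e) a e := by
    rcases N.ltIn_trichotomy hv ha rfl with h' | rfl | h'
    · exact h'
    · exact absurd hf hfa.ne'
    · exact absurd (h.sound.crit_after a e (ha ▸ hcr) (ha ▸ h')) hfa.ne'
  obtain ⟨e', h₁, h₂, h₃, h₄⟩ := hσ.prevIn_edge_of_lt hv ⟨a, ha, hae⟩
  have hcl : ∀ b, N.head b = N.head e → (s.closed b = 1 ↔ b = e ∨ N.ltIn (N.head e) e b) := by
    intro b hb
    rw [← hb]
    exact h.sound.closed_iff b e (hb ▸ hcr)
  refine ⟨e', h₁, h₂, hv, hact, fun hc' => ?_, fun b hb => ?_, fun b hb hb' => ?_⟩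
  · rcases (hcl e' h₂).1 hc' with rfl | h'
    · exact hirr h₃
    · exact hirr (N.ltIn_trans hv rfl h₂ rfl h' h₃)
  · rw [hcl b hb]
    constructor
    · intro hlt
      rcases N.ltIn_trichotomy hv hb rfl with h' | h' | h'
      · have hne : b ≠ e' := by
          rintro rfl
          rw [← hb] at hlt
          exact N.ltIn_irrefl (hb ▸ hv) hlt
        have := N.ltIn_trans hv hb h₂ hb (h₄ b hb h' hne) hlt
        rw [← hb] at this
        exact absurd this (N.ltIn_irrefl (hb ▸ hv))
      · exact .inl h'
      · exact .inr h'
    · rintro (rfl | h')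
      · exact h₃
      · exact N.ltIn_trans hv h₂ rfl hb h₃ h'
  · rcases (hcl b hb).1 hb' with rfl | h'
    · exact hf
    · exact h.sound.crit_after b e (hb ▸ hcr) (hb ▸ h')

/-- The start memory already has the new critical edge, not yet closed, which violates `closed_iff`;
hence the invariants refer to `σ`, and both writes form the single transition `State.close`. The
closing pays for itself and leaves 100 units for the caller. -/
theorem closeCritical_runs (hσ : N.IsInput σ) (hs : (view n m σ).Valid N) {v : Fin n}
    (hv : σ.nat .v = v) {e : Fin m} (he : (view n m σ).Closable N v e) :
    Runs (Algorithm.closeCritical .v) (σ.put .crit v e) fun σ' t => Frame σ σ' ∧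
      (view n m σ').Valid N ∧ (view n m σ').potential N < (view n m σ).potential N ∧
      t + 200 * (view n m σ').potential N + 100 ≤ 200 * (view n m σ).potential N ∧
      σ'.nat .changed = 1 ∧ (view n m σ').ex = (view n m σ).ex ∧ (view n m σ').crit v = e := by
  unfold Algorithm.closeCritical
  obtain ⟨h₁, h₂, h₃⟩ := hs.sound.close (e := e) (he.head_eq ▸ he.inner) (he.head_eq ▸ he.act_eq)
    he.not_closed (by simpa [he.head_eq] using he.later) (by simpa [he.head_eq] using he.free)
  rw [he.head_eq] at h₁ h₂ h₃
  have hlt := h₂.potential_lt h₃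
  have hbal := hs.balanced.close v e
  simp [hv, hσ.tail_eq, -view_set]
  obtain ⟨τ, hτ⟩ : ∃ τ, τ = (((((σ.put .crit v e).set .e e).put .closed e 1).set .changed 1).set
    .u (N.tail e)) := ⟨_, rfl⟩
  rw [← hτ]
  have hview : view n m τ = (view n m σ).close v e := by
    rw [← view_put_crit_closed, hτ]
    rfl
  have hfr : Frame σ τ := by constructor <;> simp +contextual [hτ]
  have hch : τ.nat .changed = 1 := by simp [hτ]
  have hcrit : ((view n m σ).close v e).crit v = e := by simp [State.close]
  have hsharp : ∀ u, (view n m σ).act u ≠ e → ((view n m σ).close v e).Sharp N u :=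
    fun u hu => (hs.sharp u).close hu
  constructor
  · intro hact
    refine (advance_runs (hfr.isInput hσ) (v := N.tail e) (by simp [hτ]) (by rwa [hview])).mono ?_
    rintro _ t ⟨a, rfl, h₄, h₅, h₆, h₇⟩
    rw [hview] at h₄ h₅ h₆ h₇
    rw [view_put_act, hview]
    have := h₆.potential_le
    refine ⟨hfr.trans (by constructor <;> simp +contextual), ?_, by omega, by omega, by simpa, rfl,
      hcrit⟩
    exact Valid.of_advance h₄ h₅
      (fun u hu => hsharp u fun hu' => hu (hs.sound.tail_of_act hu').symm) hbal
  · intro hact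
    rw [hview]
    refine ⟨hfr, ⟨h₁, fun u => hsharp u fun hu' => hact ?_, hbal⟩, hlt, by omega, rfl, hcrit⟩
    rw [hs.sound.tail_of_act hu']
    exact hu'

/-- The accounting is that of pushing: a pass closes an edge, frees the critical edge, or exhausts
the excess, and the last can happen only once. Progress is measured from `σ`, since an edge may have
been closed on the way to `τ₀`. -/
theorem balance_loop_runs {τ₀ : Store} {v : Fin n} (hσ : N.IsInput σ) (hv : σ.nat .v = v)
    (hτ₀ : Processing N σ τ₀ v) (hex : 0 < (view n m σ).ex v)
    (hcr : ∃ e : Fin m, (view n m τ₀).crit v = e) :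
    Runs (Algorithm.repeatWhile (.ltR .zero (.get .ex (.var .v)))
        [ .ite (.eqR (.get .f (.get .crit (.var .v))) .zero)
            (Algorithm.block [.put .crit (.var .v) (.get .prevIn (.get .crit (.var .v))),
              Algorithm.closeCritical .v])
            (Algorithm.block
              [ .set .e (.get .crit (.var .v)),
                .setR .delta (.min (.get .ex (.var .v)) (.get .f (.var .e))),
                Algorithm.dec .f (.var .e) (.var .delta),
                Algorithm.dec .ex (.var .v) (.var .delta),
                Algorithm.inc .ex (.get .tail (.var .e)) (.var .delta),
                Algorithm.when (.eqR (.get .f (.var .e)) .zero) [.set .changed 1] ]) ])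
      τ₀ fun σ' t => Processed N σ σ' v ∧
        t + 200 * (view n m σ').potential N ≤ 200 * (view n m τ₀).potential N + 110 := by
  refine (runs_loop (fun τ => Processing N σ τ v ∧ ∃ e : Fin m, (view n m τ).crit v = e)
    (fun τ => 200 * (view n m τ).potential N + if 0 < (view n m τ).ex v then 100 else 0)
    ?_ ⟨hτ₀, hcr⟩).mono ?_
  · rintro τ ⟨hτ, e, he⟩ hb
    have hin := hτ.frame.isInput hσ
    have hvτ : τ.nat .v = v := (hτ.frame.nat _ (by simp) (by simp) (by simp)).trans hv
    have hτle := hτ.potential_le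
    simp [hvτ] at hb
    have vf : τ.realArr .f e = (view n m τ).f e := rfl
    have vex : ∀ u : Fin n, τ.realArr .ex u = (view n m τ).ex u := fun _ => rfl
    have vcrit : τ.natArr .crit v = e := he
    rw [vex] at hb
    obtain ⟨rfl, hinn, hact, hcl⟩ := hτ.valid.sound.of_crit he
    have hloop : (N.tail e : ℕ) ≠ N.head e := fun h => N.loopless e (Fin.val_injective h)
    set δ := min ((view n m τ).ex (N.head e)) ((view n m τ).f e) with hδ
    simp [hvτ, vcrit, vf, vex, hin.tail_eq, hloop, hb, ← hδ, -view_putR_f, -view_putR_ex]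
    refine ⟨fun hf => ?_, fun hf => ?_⟩
    · obtain ⟨e', hprev, hcls⟩ := hτ.valid.closable_prev hin hb he hf
      rw [hprev]
      refine (closeCritical_runs hin hτ.valid hvτ hcls).mono ?_
      rintro σ' t ⟨h₁, h₂, h₃, h₄, h₅, h₆, h₇⟩
      refine ⟨⟨⟨hτ.frame.trans h₁, h₂, by omega, .inl ⟨h₅, by omega⟩⟩, e', h₇⟩, ?_⟩
      rw [h₆, if_pos hb]
      omega
    · have hδf : δ ≤ (view n m τ).f e := min_le_right _ _
      have hδe : δ ≤ (view n m τ).ex (N.head e) := min_le_left _ _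
      have hδ0 : 0 ≤ δ := le_min hb.le (hτ.valid.sound.f_nonneg e)
      have hmem : (view n m τ).f e - δ ∈ AddSubgroup.closure (Set.range N.c) :=
        sub_mem (hτ.valid.sound.f_mem e) (min_mem (hτ.valid.ex_mem _) (hτ.valid.sound.f_mem e))
      have hsound : ((view n m τ).lower N e δ).Sound N := (hτ.valid.sound.setFlow_lower he
        (by linarith) (by linarith) hmem).setEx _
      have hprog : Progress N (view n m τ) ((view n m τ).lower N e δ) :=
        (hτ.valid.sound.progress_lower he (by linarith) (by linarith)).setEx _
      have hbal := hτ.valid.balanced_lower hδ0 hδe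
      have hvalid : ((view n m τ).lower N e δ).Valid N := by
        refine ⟨hsound, fun u => Sharp.setEx ((hτ.valid.sharp u).setFlow fun hu => ?_) _, hbal⟩
        exact hτ.valid.sharp u e hu (.inl hcl)
      obtain ⟨τ₁, hτ₁⟩ : ∃ τ₁, τ₁ = (((((τ.set .e e).setR .delta δ).putR .f e
        ((view n m τ).f e - δ)).putR .ex (N.head e) ((view n m τ).ex (N.head e) - δ)).putR .ex
          (N.tail e) ((view n m τ).ex (N.tail e) + δ)) := ⟨_, rfl⟩
      rw [← hτ₁]
      have hview : view n m τ₁ = (view n m τ).lower N e δ := by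
        rw [hτ₁]
        simp [lower, setEx, setFlow, moveEx]
      have hfr : Frame τ τ₁ := by
        constructor <;> simp +contextual [hτ₁]
      have hch₁ : τ₁.nat .changed = τ.nat .changed := by simp [hτ₁]
      have hle := hprog.potential_le
      rw [hview]
      clear_value δ
      refine ⟨fun hsat => ?_, fun hns => ?_⟩
      · have hsat' : Change N (view n m τ) ((view n m τ).lower N e δ) := by
          refine ⟨e, .inr (.inr (.inr ⟨hf, hcl, ?_⟩))⟩
          simpa [lower, setEx, setFlow] using hsat
        have hlt := hprog.potential_lt hsat'
        refine ⟨⟨⟨hτ.frame.trans (hfr.trans (by constructor <;> simp +contextual)), ?_, ?_,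
          .inl ⟨?_, ?_⟩⟩, e, ?_⟩, ?_⟩
        · rwa [view_set, hview]
        · rw [view_set, hview]
          omega
        · simp
        · rw [view_set, hview]
          omega
        · exact he
        · split_ifs <;> omega
      · have hδex : δ = (view n m τ).ex (N.head e) := by
          rcases min_choice ((view n m τ).ex (N.head e)) ((view n m τ).f e) with h | h
          · rw [hδ, h]
          · rw [hδ, h] at hns
            exact absurd (by ring) hns
        have hv0 : ((view n m τ).lower N e δ).ex (N.head e) = 0 := by
          simp [lower, setEx, moveEx, (N.loopless e).symm, hδex]
        refine ⟨⟨⟨hτ.frame.trans hfr, ?_, ?_, ?_⟩, e, ?_⟩, ?_⟩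
        · rwa [hview]
        · rw [hview]
          omega
        · rw [hview, hch₁]
          rcases hτ.outcome with ⟨h, h'⟩ | ⟨h, h'⟩ | ⟨-, h, -⟩
          · exact .inl ⟨h, by omega⟩
          · refine .inr (.inr ⟨h, hv0, ?_⟩)
            rw [← h', hδex]
            -- Equality would have made the critical edge free.
            refine quiet_lower hact he (lt_of_le_of_ne (hδex ▸ hδf) fun h => hns ?_)
            rw [hδex, h, sub_self]
          · exact absurd h hb.ne'
        · exact he
        · rw [hv0, if_neg (lt_irrefl _)]
          omega
  · rintro τ t ⟨⟨hτ, -⟩, hb, ht⟩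
    refine ⟨⟨hτ.frame, hτ.valid, hτ.potential_le, ?_⟩, ?_⟩
    · rcases hτ.outcome with h | ⟨-, h⟩ | h
      · exact .inl h
      · have hvτ : τ.nat .v = v := (hτ.frame.nat _ (by simp) (by simp) (by simp)).trans hv
        rw [← h] at hex
        simp [hvτ] at hb
        exact absurd hex hb.not_gt
      · exact .inr h
    · simp at ht
      split_ifs at ht <;> omega

theorem balance_runs (hσ : N.IsInput σ) (hs : (view n m σ).Valid N) {v : Fin n}
    (hv : σ.nat .v = v) (hin : N.Inner v) (hex : 0 < (view n m σ).ex v)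
    (hact : (view n m σ).act v = m) (hch : σ.nat .changed = 0) :
    Runs (Algorithm.balance .v) σ fun σ' t => Processed N σ σ' v ∧
      t + 200 * (view n m σ').potential N ≤ 200 * (view n m σ).potential N + 130 := by
  unfold Algorithm.balance
  have vcrit : σ.natArr .crit v = (view n m σ).crit v := rfl
  rw [Algorithm.block, runs_seq]
  simp only [Algorithm.when, Algorithm.block, runs_ite, runs_seq, runs_put, runs_skip, NExpr.eval,
    BExpr.Holds, hv, hσ.m_eq, vcrit]
  refine ⟨fun hcr => ?_, fun hcr => ?_⟩
  · obtain ⟨e, he, hcls⟩ := hs.closable_last hσ hin hact hex hcr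
    rw [he]
    refine (closeCritical_runs hσ hs hv hcls).mono ?_
    rintro σ' t ⟨h₁, h₂, h₃, h₄, h₅, h₆, h₇⟩
    refine (balance_loop_runs hσ hv ⟨h₁, h₂, h₃.le, .inl ⟨h₅, h₃⟩⟩ hex ⟨e, h₇⟩).mono ?_
    rintro σ'' t' ⟨h₈, h₉⟩
    refine ⟨h₈, ?_⟩
    simp
    omega
  · obtain ⟨e, he, -⟩ := (hs.sound.crit_or v).resolve_left hcr
    refine (balance_loop_runs hσ hv ⟨.refl, hs, le_rfl, .inr (.inl ⟨hch, rfl⟩)⟩ hex ⟨e, he⟩).mono ?_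
    rintro σ'' t' ⟨h₈, h₉⟩
    refine ⟨h₈, ?_⟩
    simp
    omega

/-- Processing an inner vertex with positive excess. -/
theorem process_runs (hσ : N.IsInput σ) (hs : (view n m σ).Valid N) {v : Fin n}
    (hv : σ.nat .v = v) (hin : N.Inner v) (hex : 0 < (view n m σ).ex v)
    (hch : σ.nat .changed = 0) :
    Runs (Algorithm.process .v) σ fun σ' t => Processed N σ σ' v ∧
      t + 200 * (view n m σ').potential N ≤ 200 * (view n m σ).potential N + 150 := by
  have vact : σ.natArr .act v = (view n m σ).act v := rfl
  simp only [Algorithm.process, runs_ite, Algorithm.hasActive, BExpr.Holds, NExpr.eval, hv,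
    hσ.m_eq, vact, not_not]
  refine ⟨fun h => (push_runs hσ hs hv hex h hch).mono ?_,
    fun h => (balance_runs hσ hs hv hin hex h hch).mono ?_⟩ <;>
  · rintro σ' t ⟨h₁, h₂⟩
    refine ⟨h₁, ?_⟩
    simp
    omega

/-! ## Rotating a cycle -/

/-- The excess of `v` can move to `w`, in an amount of at most `r`. -/
def State.Step (N : Network (Fin n) (Fin m)) (s : State n m) (v w : Fin n) (r : ℝ) : Prop :=
  (∃ e : Fin m, s.act v = e ∧ w = N.head e ∧ r = N.c e - s.f e) ∨
    s.act v = m ∧ ∃ e : Fin m, s.crit v = e ∧ w = N.tail e ∧ r = s.f e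

/-- Positivity comes from sharpness on an active edge and from `Next` itself on a critical edge; it
makes the rotated amount positive. -/
theorem State.Next.step {s : State n m} {v w : Fin n} (h : Next N s v w) (hs : s.Sound N)
    (hv : s.Sharp N v) :
    ∃ r, s.Step N v w r ∧ 0 < r ∧ r ∈ AddSubgroup.closure (Set.range N.c) := by
  rcases h with ⟨e, he, rfl⟩ | ⟨h₀, e, he, hf, rfl⟩
  · exact ⟨_, .inl ⟨e, he, rfl, rfl⟩,
      sub_pos.2 (lt_of_le_of_ne (hs.f_le e) fun h => hv e he (.inr h)),
      sub_mem (capacity_mem N e) (hs.f_mem e)⟩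
  · exact ⟨_, .inr ⟨h₀, e, he, rfl, rfl⟩, hf, hs.f_mem e⟩

/-- What the rotation of a cycle leaves unchanged. -/
structure RotateFrame (σ σ' : Store) : Prop where
  nat : ∀ x, x ≠ .i → x ≠ .v → x ≠ .e → x ≠ .changed → σ'.nat x = σ.nat x
  natArr : ∀ a, a ≠ .act → σ'.natArr a = σ.natArr a
  c : σ'.realArr .c = σ.realArr .c

theorem RotateFrame.isInput {σ' : Store} (h : RotateFrame σ σ') (hσ : N.IsInput σ) :
    N.IsInput σ' := by
  apply hσ.congr <;> simp [h.nat, h.natArr, h.c]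

theorem RotateFrame.trans {σ' σ'' : Store} (h : RotateFrame σ σ') (h' : RotateFrame σ' σ'') :
    RotateFrame σ σ'' :=
  ⟨fun x h₁ h₂ h₃ h₄ => (h'.nat x h₁ h₂ h₃ h₄).trans (h.nat x h₁ h₂ h₃ h₄),
    fun a h₁ => (h'.natArr a h₁).trans (h.natArr a h₁), h'.c.trans h.c⟩

theorem RotateFrame.refl : RotateFrame σ σ := ⟨fun _ _ _ _ _ => rfl, fun _ _ => rfl, rfl⟩

/-- The state `s'` arises from `s` by moving `δ` units from `v` to `w`, without updating the
excesses. -/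
structure State.Shifted (N : Network (Fin n) (Fin m)) (s s' : State n m) (v w : Fin n) (δ r : ℝ) :
    Prop where
  sound : s'.Sound N
  sharp : ∀ u, s'.Sharp N u
  progress : Progress N s s'
  change : δ = r → s'.potential N < s.potential N
  ex_eq : s'.ex = s.ex
  excess : ∀ u, N.excess s'.f u = N.excess s.f u + (if u = w then δ else 0) -
    if u = v then δ else 0
  step : ∀ u, u ≠ v → ∀ w r, s.Step N u w r → s'.Step N u w r

/-- Stored excesses stay untouched, since the changes cancel around the cycle. Residuals of other
vertices persist because their edges differ from this one: active edges have distinct tails,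
critical edges have distinct heads, and critical edges are closed while active ones are not. -/
theorem shift_runs (hσ : N.IsInput σ) (hs : (view n m σ).Sound N)
    (hsh : ∀ u, (view n m σ).Sharp N u) {v w : Fin n} {r δ : ℝ} (hv : σ.nat .v = v)
    (hstep : (view n m σ).Step N v w r) (hδ : σ.real .delta = δ) (h0 : 0 < δ) (hδr : δ ≤ r)
    (hmem : δ ∈ AddSubgroup.closure (Set.range N.c)) :
    Runs (Algorithm.shift .v) σ fun σ' t => RotateFrame σ σ' ∧ σ'.real = σ.real ∧
      σ'.nat .v = v ∧ σ'.nat .i = σ.nat .i ∧ (view n m σ).Shifted N (view n m σ') v w δ r ∧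
      t + 200 * (view n m σ').potential N ≤ 200 * (view n m σ).potential N + 100 := by
  unfold Algorithm.shift
  rcases hstep with ⟨e, he, rfl, rfl⟩ | ⟨h₀, e, he, rfl, rfl⟩
  · obtain rfl := hs.tail_of_act he
    have vf : σ.realArr .f e = (view n m σ).f e := rfl
    have vact : σ.natArr .act (N.tail e) = e := he
    have hsound := hs.setFlow_raise he (hsh _) (x := (view n m σ).f e + δ) (by linarith)
      (by linarith) (add_mem (hs.f_mem e) hmem)
    have hprog := (hsh _).progress_raise he ((view n m σ).f e + δ)
    have hsharp : ∀ u, u ≠ N.tail e → ((view n m σ).setFlow e ((view n m σ).f e + δ)).Sharp N u :=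
      fun u hu => (hsh u).setFlow fun hu' => hu (hs.tail_of_act hu').symm
    have hstep : ∀ u, u ≠ N.tail e → ∀ w r, (view n m σ).Step N u w r →
        ((view n m σ).setFlow e ((view n m σ).f e + δ)).Step N u w r := by
      rintro u hu w r (⟨a, ha, rfl, rfl⟩ | ⟨h₀, a, ha, rfl, rfl⟩)
      · have hae : a ≠ e := by rintro rfl; exact hu (hs.tail_of_act ha).symm
        exact .inl ⟨a, ha, rfl, by simp [setFlow, hae]⟩
      · have hae : a ≠ e := by
          rintro rfl
          exact hsh _ a he (.inl (hs.of_crit ha).2.2.2)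
        exact .inr ⟨h₀, a, ha, rfl, by simp [setFlow, hae]⟩
    have hexc := (view n m σ).excess_raise (N := N) e δ
    have hle := hprog.potential_le
    simp [hv, vact, hσ.m_eq, e.2.ne, vf, hσ.c_eq, hδ, -view_putR_f, -view_set]
    obtain ⟨τ, hτ⟩ : ∃ τ, τ = (σ.set .e e).putR .f e ((view n m σ).f e + δ) := ⟨_, rfl⟩
    rw [← hτ]
    have hview : view n m τ = (view n m σ).setFlow e ((view n m σ).f e + δ) := by simp [hτ]
    have hfr : RotateFrame σ τ := by constructor <;> simp +contextual [hτ]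
    have hτr : τ.real = σ.real := by simp [hτ]
    have hτv : τ.nat .v = N.tail e := by simp [hτ, hv]
    have hτi : τ.nat .i = σ.nat .i := by simp [hτ]
    refine ⟨fun hsat => ?_, fun hns => ?_⟩
    · have hlt := hprog.potential_lt ⟨e, .inr (.inl ⟨hsh _ e he, .inr (by simpa [setFlow])⟩)⟩
      refine (advance_runs (hfr.isInput hσ) (v := N.tail e) hτv (by rwa [hview])).mono ?_
      rintro _ t ⟨a, rfl, h₁, h₂, h₃, h₄⟩
      rw [hview] at h₁ h₂ h₃ h₄
      have hle' := h₃.potential_le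
      refine ⟨hfr.trans (by constructor <;> simp +contextual), hτr, by simpa using hτv, hτi, ?_, ?_⟩
      · rw [view_put_act, hview]
        refine ⟨h₁, fun u => ?_, hprog.trans h₃, fun _ => by omega, rfl, hexc, ?_⟩
        · by_cases hu : u = N.tail e
          · exact hu ▸ h₂
          · exact (hsharp u hu).setAct hu
        · rintro u hu w r h
          rcases hstep u hu w r h with ⟨a, ha, h⟩ | ⟨h₀, h⟩
          · exact .inl ⟨a, by simpa [setAct, hu] using ha, h⟩
          · exact .inr ⟨by simpa [setAct, hu] using h₀, h⟩
      · rw [view_put_act, hview]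
        omega
    · rw [hview]
      refine ⟨hfr, ⟨hsound, fun u => ?_, hprog, fun h => absurd ?_ hns, rfl, hexc,
        hstep⟩, by omega⟩
      · by_cases hu : u = N.tail e
        · exact hu ▸ (hsh _).setFlow_lt he (lt_of_le_of_ne (by linarith) hns)
        · exact hsharp u hu
      · rw [h]
        ring
  · obtain ⟨rfl, hinn, hact, hcl⟩ := hs.of_crit he
    have vf : σ.realArr .f e = (view n m σ).f e := rfl
    have vact : σ.natArr .act (N.head e) = m := h₀
    have vcrit : σ.natArr .crit (N.head e) = e := he
    have hsound := hs.setFlow_lower he (x := (view n m σ).f e - δ) (by linarith)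
      (by linarith) (sub_mem (hs.f_mem e) hmem)
    have hprog := hs.progress_lower he (x := (view n m σ).f e - δ) (by linarith) (by linarith)
    have hexc := (view n m σ).excess_lower (N := N) e δ
    have hle := hprog.potential_le
    simp [hv, vact, vcrit, hσ.m_eq, vf, hδ]
    refine ⟨by constructor <;> simp +contextual, ⟨hsound, fun u => ?_, hprog, fun h => ?_, rfl, hexc,
      ?_⟩, by omega⟩
    · exact (hsh u).setFlow fun hu => hsh u e hu (.inl hcl)
    · refine hprog.potential_lt ⟨e, .inr (.inr (.inr ⟨(h ▸ h0).ne', hcl, ?_⟩))⟩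
      simp [setFlow, h]
    · rintro u hu w r (⟨a, ha, rfl, rfl⟩ | ⟨h₀, a, ha, rfl, rfl⟩)
      · have hae : a ≠ e := by rintro rfl; exact hsh u a ha (.inl hcl)
        exact .inl ⟨a, ha, rfl, by simp [setFlow, hae]⟩
      · have hae : a ≠ e := by rintro rfl; exact hu (hs.of_crit ha).1.symm
        exact .inr ⟨h₀, a, ha, rfl, by simp [setFlow, hae]⟩

theorem lowerDelta_runs (hσ : N.IsInput σ) {v w : Fin n} {r : ℝ} (hv : σ.nat .v = v)
    (hstep : (view n m σ).Step N v w r) :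
    Runs (Algorithm.lowerDelta .v) σ fun σ' t => σ' = σ.setR .delta (min (σ.real .delta) r) ∧
      t ≤ 30 := by
  unfold Algorithm.lowerDelta
  rcases hstep with ⟨e, he, rfl, rfl⟩ | ⟨h₀, e, he, rfl, rfl⟩
  · have vact : σ.natArr .act v = e := he
    simp [hv, vact, hσ.m_eq, e.2.ne, hσ.c_eq, view]
  · have vact : σ.natArr .act v = m := h₀
    have vcrit : σ.natArr .crit v = e := he
    simp [hv, vact, vcrit, hσ.m_eq, view]

/-! ### The path as a stack. -/

/-- The cells of `a` below `l.length` hold the entries of `l`, from the last to the first. -/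
def StackAt (a : ℕ → ℕ) : List (Fin n) → Prop
  | [] => True
  | v :: l => a l.length = v ∧ StackAt a l

theorem StackAt.append_right {a : ℕ → ℕ} {l l' : List (Fin n)} (h : StackAt a (l ++ l')) :
    StackAt a l' := by
  induction l with
  | nil => exact h
  | cons v l ih => exact ih h.2

theorem StackAt.update {a : ℕ → ℕ} {l : List (Fin n)} (h : StackAt a l) {k : ℕ}
    (hk : l.length ≤ k) (x : ℕ) : StackAt (update a k x) l := by
  induction l with
  | nil => trivial
  | cons v l ih =>
    have : l.length < k := by simpa using hk
    exact ⟨by simpa [this.ne] using h.1, ih h.2 this.le⟩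

theorem List.IsChain.exists_rel_of_mem {α : Type*} {R : α → α → Prop} {x : α} {l : List α}
    (h : (x :: l).IsChain R) {u : α} (hu : u ∈ l) : ∃ a, R a u := by
  induction l generalizing x with
  | nil => simp at hu
  | cons y l ih =>
    rw [List.isChain_cons_cons] at h
    rcases List.mem_cons.1 hu with rfl | hu
    · exact ⟨x, h.1⟩
    · exact ih h.2 hu

theorem List.IsChain.rel_of_eq_append {α : Type*} {R : α → α → Prop} {x : α} {l a b : List α}
    {u v : α} (h : (x :: l).IsChain R) (hl : l = a ++ u :: v :: b) : R u v := by
  subst hl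
  have : List.IsChain R (u :: v :: b) := h.suffix ⟨x :: a, by simp⟩
  exact (List.isChain_cons_cons.1 this).1

/-- The loop of `rotate` that determines the amount `delta`. -/
theorem lowerDelta_loop_runs (hσ : N.IsInput σ) {w cur : Fin n} {C done rest tl : List (Fin n)}
    {nx : Fin n → Fin n} {ρ : Fin n → ℝ} (hst : StackAt (σ.natArr .path) (C ++ tl))
    (hlast : ∀ a : List (Fin n), ∀ u b, C = a ++ u :: b → (u = w ↔ b = []))
    (hstep : ∀ u ∈ C, (view n m σ).Step N u (nx u) (ρ u)) (hw : σ.nat .w = w)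
    (hC : C = done ++ cur :: rest) (hv : σ.nat .v = cur) (hi : σ.nat .i = (rest ++ tl).length)
    (hle : ∀ u ∈ done ++ [cur], σ.real .delta ≤ ρ u)
    (hex : ∃ u ∈ done ++ [cur], ρ u = σ.real .delta) :
    Runs (Algorithm.repeatWhile (.not (.eqN (.var .v) (.var .w)))
        [.set .i (.pred (.var .i)), .set .v (.get .path (.var .i)), Algorithm.lowerDelta .v]) σ
      fun σ' t => RotateFrame σ σ' ∧ view n m σ' = view n m σ ∧ t ≤ 50 * σ.nat .i + 50 ∧
        (∀ u ∈ C, σ'.real .delta ≤ ρ u) ∧ ∃ u ∈ C, ρ u = σ'.real .delta := by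
  -- The cycle splits into visited vertices, the current one and the rest. The register `delta`
  -- holds the least residual seen so far, together with a vertex attaining it; `hlast` says that
  -- `w` is exactly the bottom of the cycle.
  refine (runs_loop (fun τ => RotateFrame σ τ ∧ view n m τ = view n m σ ∧
      ∃ (done : List (Fin n)) (cur : Fin n) (rest : List (Fin n)), C = done ++ cur :: rest ∧
        τ.nat .v = cur ∧ τ.nat .i = (rest ++ tl).length ∧
        (∀ u ∈ done ++ [cur], τ.real .delta ≤ ρ u) ∧ ∃ u ∈ done ++ [cur], ρ u = τ.real .delta)
    (fun τ => 50 * τ.nat .i) ?_ ⟨.refl, rfl, done, cur, rest, hC, hv, hi, hle, hex⟩).mono ?_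
  · rintro τ ⟨hfr, hview, done, cur, rest, rfl, hv, hi, hle, hex⟩ hb
    have hin := hfr.isInput hσ
    have hwτ : τ.nat .w = w := (hfr.nat _ (by simp) (by simp) (by simp) (by simp)).trans hw
    have hpath : τ.natArr .path = σ.natArr .path := hfr.natArr _ (by simp)
    simp [hv, hwτ, Fin.val_inj] at hb
    obtain _ | ⟨cur', rest⟩ := rest
    · exact absurd ((hlast done cur [] rfl).2 rfl) hb
    have hcell : τ.natArr .path (rest ++ tl).length = cur' := by
      rw [hpath]
      have : StackAt (σ.natArr .path) ((done ++ [cur]) ++ (cur' :: (rest ++ tl))) := by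
        simpa using hst
      exact this.append_right.1
    have hi' : τ.nat .i - 1 = (rest ++ tl).length := by simp [hi]
    obtain ⟨τ₁, hτ₁⟩ : ∃ τ₁, τ₁ = (τ.set .i (rest ++ tl).length).set .v cur' := ⟨_, rfl⟩
    have hst' : (view n m τ₁).Step N cur' (nx cur') (ρ cur') := by
      rw [hτ₁, view_set, view_set, hview]
      exact hstep cur' (by simp)
    have hfr₁ : RotateFrame σ τ₁ := hfr.trans (by constructor <;> simp +contextual [hτ₁])
    simp only [Algorithm.block, runs_seq, runs_set, NExpr.eval, hi', Store.set_nat, Store.set_natArr,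
      if_true, hcell, ← hτ₁]
    refine (lowerDelta_runs (hfr₁.isInput hσ) (by simp [hτ₁]) hst').mono ?_
    rintro _ t ⟨rfl, ht⟩
    have hδ : τ₁.real .delta = τ.real .delta := by simp [hτ₁]
    refine ⟨⟨hfr₁.trans (by constructor <;> simp), ?_, done ++ [cur], cur', rest, by simp, ?_, ?_,
      ?_, ?_⟩, ?_⟩
    · rw [view_setR, hτ₁, view_set, view_set, hview]
    · simp [hτ₁]
    · simp [hτ₁]
    · intro u hu
      rw [Store.setR_real, hδ]
      rcases List.mem_append.1 hu with hu | hu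
      · exact (min_le_left _ _).trans (hle u hu)
      · rw [List.mem_singleton.1 hu]
        exact min_le_right _ _
    · rw [Store.setR_real, hδ]
      rcases min_choice (τ.real .delta) (ρ cur') with h | h
      · obtain ⟨u, hu, hu'⟩ := hex
        exact ⟨u, List.mem_append_left _ hu, by rw [h, hu']⟩
      · exact ⟨cur', by simp, h.symm⟩
    · simp [hτ₁, hi]
      omega
  · rintro τ t ⟨⟨hfr, hview, done, cur, rest, hC, hv, hi, hle, hex⟩, hb, ht⟩
    have hwτ : τ.nat .w = w := (hfr.nat _ (by simp) (by simp) (by simp) (by simp)).trans hw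
    simp [hv, hwτ, Fin.val_inj] at hb
    obtain rfl := (hlast done cur rest hC).1 hb
    subst hC
    refine ⟨hfr, hview, ?_, hle, hex⟩
    simp at ht
    omega

/-- The loop of `rotate` that changes the flow. -/
theorem shift_loop_runs (hσ : N.IsInput σ) {s : State n m} {w cur : Fin n}
    {C done rest tl : List (Fin n)} {nx : Fin n → Fin n} {ρ : Fin n → ℝ} {δ : ℝ}
    (hst : StackAt (σ.natArr .path) (C ++ tl))
    (hlast : ∀ a : List (Fin n), ∀ u b, C = a ++ u :: b → (u = w ↔ b = []))
    (hnx : ∀ a : List (Fin n), ∀ u v b, C = a ++ u :: v :: b → nx v = u) (hnd : C.Nodup)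
    (h0 : 0 < δ) (hδr : ∀ u ∈ C, δ ≤ ρ u) (hmem : δ ∈ AddSubgroup.closure (Set.range N.c))
    (hw : σ.nat .w = w) (hC : C = done ++ cur :: rest) (hv : σ.nat .v = cur)
    (hi : σ.nat .i = (rest ++ tl).length) (hδ : σ.real .delta = δ)
    (hsound : (view n m σ).Sound N) (hsharp : ∀ u, (view n m σ).Sharp N u)
    (hprog : Progress N s (view n m σ)) (hex : (view n m σ).ex = s.ex)
    (hexc : ∀ u, N.excess (view n m σ).f u = N.excess s.f u + (if u = w then δ else 0) -
      if u = cur then δ else 0)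
    (hstep : ∀ u ∈ rest, (view n m σ).Step N u (nx u) (ρ u))
    (hpot : (view n m σ).potential N < s.potential N ∨ ∃ u ∈ rest, ρ u = δ) :
    Runs (Algorithm.repeatWhile (.not (.eqN (.var .v) (.var .w)))
        [.set .i (.pred (.var .i)), .set .v (.get .path (.var .i)), Algorithm.shift .v]) σ
      fun σ' t => RotateFrame σ σ' ∧ (view n m σ').Sound N ∧ (∀ u, (view n m σ').Sharp N u) ∧
        (view n m σ').ex = s.ex ∧ (∀ u, N.excess (view n m σ').f u = N.excess s.f u) ∧
        (view n m σ').potential N < s.potential N ∧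
        t + 200 * (view n m σ').potential N ≤
          200 * (view n m σ).potential N + 150 * σ.nat .i + 50 := by
  -- The shifts telescope: so far `δ` units have moved in total from the current vertex to `w`,
  -- which is nothing once the current vertex is `w`. Either an event has occurred, or a vertex with
  -- residual `δ` is still to come.
  refine (runs_loop (fun τ => RotateFrame σ τ ∧ τ.real .delta = δ ∧ (view n m τ).Sound N ∧
      (∀ u, (view n m τ).Sharp N u) ∧ Progress N s (view n m τ) ∧ (view n m τ).ex = s.ex ∧
      ∃ (done : List (Fin n)) (cur : Fin n) (rest : List (Fin n)), C = done ++ cur :: rest ∧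
        τ.nat .v = cur ∧ τ.nat .i = (rest ++ tl).length ∧
        (∀ u, N.excess (view n m τ).f u = N.excess s.f u + (if u = w then δ else 0) -
          if u = cur then δ else 0) ∧
        (∀ u ∈ rest, (view n m τ).Step N u (nx u) (ρ u)) ∧
        ((view n m τ).potential N < s.potential N ∨ ∃ u ∈ rest, ρ u = δ))
    (fun τ => 200 * (view n m τ).potential N + 150 * τ.nat .i) ?_
    ⟨.refl, hδ, hsound, hsharp, hprog, hex, done, cur, rest, hC, hv, hi, hexc, hstep, hpot⟩).mono ?_
  · rintro τ ⟨hfr, hδ, hsound, hsharp, hprog, hex, done, cur, rest, rfl, hv, hi, hexc, hstep, hpot⟩ hb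
    have hin := hfr.isInput hσ
    have hwτ : τ.nat .w = w := (hfr.nat _ (by simp) (by simp) (by simp) (by simp)).trans hw
    have hpath : τ.natArr .path = σ.natArr .path := hfr.natArr _ (by simp)
    simp [hv, hwτ, Fin.val_inj] at hb
    obtain _ | ⟨cur', rest⟩ := rest
    · exact absurd ((hlast done cur [] rfl).2 rfl) hb
    have hcell : τ.natArr .path (rest ++ tl).length = cur' := by
      rw [hpath]
      have : StackAt (σ.natArr .path) ((done ++ [cur]) ++ (cur' :: (rest ++ tl))) := by
        simpa using hst
      exact this.append_right.1
    have hi' : τ.nat .i - 1 = (rest ++ tl).length := by simp [hi]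
    obtain ⟨τ₁, hτ₁⟩ : ∃ τ₁, τ₁ = (τ.set .i (rest ++ tl).length).set .v cur' := ⟨_, rfl⟩
    have hview : view n m τ₁ = view n m τ := by simp [hτ₁]
    have hst' : (view n m τ₁).Step N cur' (nx cur') (ρ cur') := by
      rw [hview]
      exact hstep cur' (by simp)
    rw [hnx done cur cur' rest rfl] at hst'
    have hfr₁ : RotateFrame σ τ₁ := hfr.trans (by constructor <;> simp +contextual [hτ₁])
    simp only [Algorithm.block, runs_seq, runs_set, NExpr.eval, hi', Store.set_nat, Store.set_natArr,
      if_true, hcell, ← hτ₁]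
    refine (shift_runs (hfr₁.isInput hσ) (by rwa [hview]) (by rwa [hview]) (by simp [hτ₁]) hst'
      (by simpa [hτ₁] using hδ) h0 (hδr cur' (by simp)) hmem).mono ?_
    rintro τ₂ t ⟨hfr₂, h₁, h₂, h₃, h₄, h₅⟩
    rw [hview] at h₄ h₅
    have hle := h₄.progress.potential_le
    refine ⟨⟨hfr₁.trans hfr₂, ?_, h₄.sound, h₄.sharp, hprog.trans h₄.progress, h₄.ex_eq.trans hex,
      done ++ [cur], cur', rest, by simp, h₂, ?_, ?_, ?_, ?_⟩, ?_⟩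
    · rw [h₁]
      simpa [hτ₁] using hδ
    · rw [h₃]
      simp [hτ₁]
    · intro u
      rw [h₄.excess, hexc]
      ring
    · intro u hu
      refine h₄.step u ?_ _ _ (hstep u (by simp [hu]))
      rintro rfl
      simp [List.nodup_append, hu] at hnd
    · rcases hpot with h | ⟨u, hu, h⟩
      · exact .inl (by omega)
      · rcases List.mem_cons.1 hu with rfl | hu
        · exact .inl ((h₄.change h.symm).trans_le hprog.potential_le)
        · exact .inr ⟨u, hu, h⟩
    · rw [h₃]
      simp [hτ₁, hi]
      omega
  · rintro τ t ⟨⟨hfr, hδ, hsound, hsharp, hprog, hex, done, cur, rest, hC, hv, hi, hexc, hstep, hpot⟩,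
      hb, ht⟩
    have hwτ : τ.nat .w = w := (hfr.nat _ (by simp) (by simp) (by simp) (by simp)).trans hw
    simp [hv, hwτ, Fin.val_inj] at hb
    obtain rfl := (hlast done cur rest hC).1 hb
    subst hb
    refine ⟨hfr, hsound, hsharp, hex, fun u => by rw [hexc]; ring, by simpa using hpot, ?_⟩
    simp at ht
    omega

/-- The cycle consists of the stack entries from the top down to `w`, and the successor of the top
is `w`. The amount equals some residual on the cycle, so an edge gets saturated or free there. -/
theorem rotate_runs (hσ : N.IsInput σ) (hs : (view n m σ).Valid N) {w : Fin n}
    (hw : σ.nat .w = w) {l : List (Fin n)} (hst : StackAt (σ.natArr .path) l)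
    (hlen : σ.nat .pathLen = l.length) (hnd : l.Nodup) (hwl : w ∈ l)
    (hchain : (w :: l).IsChain fun a b => Next N (view n m σ) b a) :
    Runs Algorithm.rotate σ fun σ' t => RotateFrame σ σ' ∧ (view n m σ').Valid N ∧
      σ'.nat .changed = 1 ∧ (view n m σ').potential N < (view n m σ).potential N ∧
      t + 200 * (view n m σ').potential N ≤
        200 * (view n m σ).potential N + 200 * l.length + 300 := by
  obtain ⟨seg, tl, rfl⟩ := List.append_of_mem hwl
  obtain ⟨C, hC⟩ : ∃ C, C = seg ++ [w] := ⟨_, rfl⟩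
  have hl : seg ++ w :: tl = C ++ tl := by simp [hC]
  rw [hl] at hst hlen hnd hchain ⊢
  have hndC : C.Nodup := (List.nodup_append.1 hnd).1
  have hchainC : (w :: C).IsChain fun a b => Next N (view n m σ) b a :=
    hchain.prefix ⟨tl, by simp⟩
  have hlast : ∀ a : List (Fin n), ∀ u b, C = a ++ u :: b → (u = w ↔ b = []) := by
    intro a u b hab
    constructor
    · rintro rfl
      rcases List.eq_nil_or_concat b with rfl | ⟨b, x, rfl⟩
      · rfl
      · have h : (a ++ u :: b) ++ [x] = seg ++ [u] := by simpa [hC] using hab.symm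
        obtain rfl : x = u := by simpa using (List.append_inj' h rfl).2
        simp [hab, List.nodup_append] at hndC
    · rintro rfl
      have := hab.symm.trans hC
      simpa using (List.append_inj' this rfl).2
  have hdata : ∀ u, ∃ a r, u ∈ C → Next N (view n m σ) u a ∧ (view n m σ).Step N u a r ∧ 0 < r ∧
      r ∈ AddSubgroup.closure (Set.range N.c) := by
    intro u
    by_cases hu : u ∈ C
    · obtain ⟨a, ha⟩ := List.IsChain.exists_rel_of_mem hchainC hu
      obtain ⟨r, hr⟩ := ha.step hs.sound (hs.sharp u)
      exact ⟨a, r, fun _ => ⟨ha, hr⟩⟩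
    · exact ⟨u, 0, fun h => absurd h hu⟩
  choose nx ρ hdata using hdata
  have hnx : ∀ a : List (Fin n), ∀ u v b, C = a ++ u :: v :: b → nx v = u := fun a u v b h =>
    (hdata v (by simp [h])).1.unique (List.IsChain.rel_of_eq_append (R := fun a b => Next N (view n m σ) b a) hchainC h)
  obtain ⟨top, rest, htop⟩ : ∃ top rest, C = top :: rest :=
    List.exists_cons_of_ne_nil (by simp [hC])
  have hnxtop : nx top = w := by
    rw [htop, List.isChain_cons_cons] at hchainC
    exact (hdata top (by simp [htop])).1.unique hchainC.1
  have hcell : σ.natArr .path (rest ++ tl).length = top := by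
    rw [htop] at hst
    exact hst.1
  have hlen' : σ.nat .pathLen - 1 = (rest ++ tl).length := by simp [hlen, htop]
  have hacttop := hdata top (by simp [htop])
  obtain ⟨τ₁, hτ₁⟩ : ∃ τ₁, τ₁ = ((σ.set .i (rest ++ tl).length).set .v top).setR .delta (ρ top) :=
    ⟨_, rfl⟩
  have hfr₁ : RotateFrame σ τ₁ := by constructor <;> simp +contextual [hτ₁]
  have hview₁ : view n m τ₁ = view n m σ := by simp [hτ₁]
  have hi₁ : τ₁.nat .i = (rest ++ tl).length := by simp [hτ₁]
  -- Both branches that initialize `delta` reach the same memory `τ₁`, so the remaining commands are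
  -- analysed once, with `t₀` for the time already spent.
  have htail : ∀ (τ : Store) (t₀ : ℕ), τ = τ₁ → t₀ ≤ 40 → Runs (Algorithm.block
      [ Algorithm.repeatWhile (.not (.eqN (.var .v) (.var .w)))
          [.set .i (.pred (.var .i)), .set .v (.get .path (.var .i)), Algorithm.lowerDelta .v],
        .set .i (.pred (.var .pathLen)), .set .v (.get .path (.var .i)), Algorithm.shift .v,
        Algorithm.repeatWhile (.not (.eqN (.var .v) (.var .w)))
          [.set .i (.pred (.var .i)), .set .v (.get .path (.var .i)), Algorithm.shift .v],
        .set .changed 1 ]) τ fun σ' t => RotateFrame σ σ' ∧ (view n m σ').Valid N ∧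
      σ'.nat .changed = 1 ∧ (view n m σ').potential N < (view n m σ).potential N ∧
      t₀ + t + 200 * (view n m σ').potential N ≤
        200 * (view n m σ).potential N + 200 * (C ++ tl).length + 300 := by
    rintro τ t₀ rfl ht₀
    simp only [Algorithm.block, runs_seq, runs_set]
    refine (lowerDelta_loop_runs (hfr₁.isInput hσ) (done := []) (nx := nx) (ρ := ρ) (C := C)
      (tl := tl) (by rwa [hfr₁.natArr _ (by simp)]) hlast ?_ (by simp [hτ₁, hw]) htop
      (by simp [hτ₁]) hi₁ (by simp [hτ₁]) (by simp [hτ₁])).mono ?_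
    · intro u hu
      rw [hview₁]
      exact (hdata u hu).2.1
    rintro τ₂ t₁ ⟨hfr₂, hview₂, ht₁, hle, u₀, hu₀, hδ⟩
    have hfr₂' := hfr₁.trans hfr₂
    rw [hview₁] at hview₂
    have hpl : τ₂.nat .pathLen - 1 = (rest ++ tl).length := by
      rw [hfr₂'.nat _ (by simp) (by simp) (by simp) (by simp), hlen']
    obtain ⟨τ₃, hτ₃⟩ : ∃ τ₃, τ₃ = (τ₂.set .i (rest ++ tl).length).set .v top := ⟨_, rfl⟩
    have hfr₃ : RotateFrame σ τ₃ := hfr₂'.trans (by constructor <;> simp +contextual [hτ₃])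
    have hview₃ : view n m τ₃ = view n m σ := by simp [hτ₃, hview₂]
    have hcell₂ : τ₂.natArr .path (rest ++ tl).length = top := by
      rw [hfr₂'.natArr _ (by simp), hcell]
    have hmem := (hdata u₀ hu₀).2.2.2
    have hpos := (hdata u₀ hu₀).2.2.1
    have hst' := hacttop.2.1
    rw [hδ] at hmem hpos
    rw [hnxtop] at hst'
    simp only [NExpr.eval, hpl, Store.set_nat, Store.set_natArr, if_true, hcell₂, ← hτ₃]
    refine (shift_runs (hfr₃.isInput hσ) (by rw [hview₃]; exact hs.sound)
      (by rw [hview₃]; exact hs.sharp) (v := top) (w := w) (r := ρ top) (δ := τ₂.real .delta)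
      (by simp [hτ₃]) (by rwa [hview₃]) (by simp [hτ₃]) hpos
      (hle top (by simp [htop])) hmem).mono ?_
    rintro τ₄ t₂ ⟨hfr₄, h₁, h₂, h₃, h₄, h₅⟩
    have hfr₄' := hfr₃.trans hfr₄
    rw [hview₃] at h₄ h₅
    have hi₄ : τ₄.nat .i = (rest ++ tl).length := by simp [h₃, hτ₃]
    refine (shift_loop_runs (hfr₄'.isInput hσ) (s := view n m σ) (nx := nx) (ρ := ρ) (done := [])
      (by rwa [hfr₄'.natArr _ (by simp)]) hlast hnx hndC hpos hle hmem
      (by rw [hfr₄'.nat _ (by simp) (by simp) (by simp) (by simp), hw]) htop h₂ hi₄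
      (by rw [h₁]; simp [hτ₃]) h₄.sound h₄.sharp h₄.progress h₄.ex_eq h₄.excess ?_ ?_).mono ?_
    · intro u hu
      refine h₄.step u ?_ _ _ (hdata u (by simp [htop, hu])).2.1
      rintro rfl
      simp [htop, hu] at hndC
    · rw [htop] at hu₀
      rcases List.mem_cons.1 hu₀ with rfl | hu₀
      · exact .inl (h₄.change hδ.symm)
      · exact .inr ⟨u₀, hu₀, hδ⟩
    rintro τ₅ t₃ ⟨hfr₅, k₁, k₂, k₃, k₄, k₅, k₆⟩
    refine ⟨hfr₄'.trans (hfr₅.trans (by constructor <;> simp +contextual)), ⟨k₁, k₂, ?_, ?_⟩, by simp,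
      k₅, ?_⟩
    · intro u
      rw [view_set, k₃, k₄, hs.balanced.ex_eq]
    · intro u hu
      rw [view_set, k₃]
      exact hs.balanced.ex_nonneg u hu
    · rw [hi₁] at ht₁
      rw [hi₄] at k₆
      have : (C ++ tl).length = (rest ++ tl).length + 1 := by simp [htop]
      simp
      simp at this k₆ ht₁
      omega
  unfold Algorithm.rotate
  rw [Algorithm.block, runs_seq, runs_set, Algorithm.block, runs_seq, runs_set, Algorithm.block,
    runs_seq, runs_ite]
  simp only [NExpr.eval, hlen', Store.set_nat, Store.set_natArr, if_true, hcell, runs_setR,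
    Algorithm.hasActive, BExpr.Holds, hσ.m_eq, reduceCtorEq, if_false]
  rcases hacttop.2.1 with ⟨e, he, -, hr⟩ | ⟨h₀, e, he, -, hr⟩
  · have vact : σ.natArr .act top = e := he
    refine ⟨fun _ => ?_, fun h => absurd (by rw [vact]; exact e.2.ne) h⟩
    refine (htail _ 30 ?_ (by omega)).mono ?_
    · rw [hτ₁, hr]
      simp [vact, hσ.c_eq, view]
    · rintro σ' t ⟨k₁, k₂, k₃, k₄, k₅⟩
      refine ⟨k₁, k₂, k₃, k₄, ?_⟩
      simp at k₅ ⊢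
      omega
  · have vact : σ.natArr .act top = m := h₀
    have vcrit : σ.natArr .crit top = e := he
    refine ⟨fun h => absurd vact h, fun _ => ?_⟩
    refine (htail _ 30 ?_ (by omega)).mono ?_
    · rw [hτ₁, hr]
      simp [vcrit, view]
    · rintro σ' t ⟨k₁, k₂, k₃, k₄, k₅⟩
      refine ⟨k₁, k₂, k₃, k₄, ?_⟩
      simp at k₅ ⊢
      omega

/-! ## Tracing paths -/

/-- The number of vertices that do not lie on a traced path. -/
noncomputable def unmarked (n : ℕ) (σ : Store) : ℕ := {u : Fin n | σ.natArr .mark u = 0}.ncard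

theorem unmarked_lt {σ' : Store} {v : Fin n} {k : ℕ} (hk : k ≠ 0) (hv : σ.natArr .mark v = 0)
    (h : σ'.natArr .mark = update (σ.natArr .mark) v k) : unmarked n σ' < unmarked n σ := by
  refine Set.ncard_lt_ncard ⟨fun u hu => ?_, fun hs => ?_⟩
  · have hu' : σ'.natArr .mark u = 0 := hu
    by_cases huv : u = v
    · subst huv
      exact hv
    · simpa [h, Fin.val_inj, huv] using hu'
  · have : σ'.natArr .mark v = 0 := hs hv
    rw [h] at this
    simp [hk] at this

theorem unmarked_update_le {σ' : Store} {v : Fin n} {k : ℕ} (hk : k ≠ 0)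
    (h : σ'.natArr .mark = update (σ.natArr .mark) v k) : unmarked n σ' ≤ unmarked n σ := by
  refine Set.ncard_le_ncard fun u hu => ?_
  have hu' : σ'.natArr .mark u = 0 := hu
  by_cases huv : u = v
  · subst huv
    rw [h] at hu'
    simp [hk] at hu'
  · simpa [h, Fin.val_inj, huv] using hu'

theorem unmarked_congr {σ' : Store} (h : σ'.natArr .mark = σ.natArr .mark) :
    unmarked n σ' = unmarked n σ := by
  unfold unmarked
  rw [h]

/-- The list runs through trees rooted at terminals, in topological order. -/
def State.Topological (N : Network (Fin n) (Fin m)) (s : State n m) : List (Fin n) → Prop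
  | [] => True
  | v :: l => (∃ w, Next N s v w ∧ (¬ N.Inner w ∨ w ∈ l)) ∧ Topological N s l

theorem State.Topological.mono {s s' : State n m} (h : ∀ u w, Next N s u w → Next N s' u w)
    {l : List (Fin n)} (hl : s.Topological N l) : s'.Topological N l := by
  induction l with
  | nil => trivial
  | cons v l ih =>
    obtain ⟨⟨w, hw, hw'⟩, hl⟩ := hl
    exact ⟨⟨w, h _ _ hw, hw'⟩, ih hl⟩

/-- The memory in the course of tracing paths: `l` is the current path, and `o` lists the earlier
ones. Inner vertices with positive excess have a number of at least `k`, or they belong to `o` or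
`X`. -/
structure Forest (N : Network (Fin n) (Fin m)) (σ : Store) (k : ℕ) (l o : List (Fin n))
    (X : Set (Fin n)) : Prop where
  unchanged : σ.nat .changed = 0
  ord : StackAt (σ.natArr .ord) o
  ordLen : σ.nat .ordLen = o.length
  mark_zero : ∀ u : Fin n, σ.natArr .mark u = 0 ∨ u ∈ l ∨ u ∈ o
  mark_one : ∀ u : Fin n, σ.natArr .mark u = 1 ↔ u ∈ l
  mark_two : ∀ u : Fin n, σ.natArr .mark u = 2 ↔ u ∈ o
  inner_path : ∀ u ∈ l, N.Inner u
  inner_ord : ∀ u ∈ o, N.Inner u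
  topological : (view n m σ).Topological N o
  positive : ∀ u, N.Inner u → 0 < (view n m σ).ex u → k ≤ u ∨ u ∈ o ∨ u ∈ X

/-- The current path `l`, followed by the vertex `w`. -/
structure TracedPath (N : Network (Fin n) (Fin m)) (σ : Store) (l : List (Fin n)) (w : Fin n) :
    Prop where
  path : StackAt (σ.natArr .path) l
  pathLen : σ.nat .pathLen = l.length
  chain : (w :: l).IsChain fun a b => Next N (view n m σ) b a
  nodup : l.Nodup

/-- Both branches take 10 units, so the conditional acts as a single assignment. -/
theorem nextVertex_runs {Q : Store → ℕ → Prop} :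
    Runs (.ite (Algorithm.hasActive .v) (.set .w (.get .head (.get .act (.var .v))))
      (.set .w (.get .tail (.get .crit (.var .v))))) σ Q ↔
    Q (σ.set .w (if σ.natArr .act (σ.nat .v) = σ.nat .m then
        σ.natArr .tail (σ.natArr .crit (σ.nat .v)) else
        σ.natArr .head (σ.natArr .act (σ.nat .v)))) 10 := by
  simp
  split_ifs with h <;> simp [h]

theorem State.Next.eval (hσ : N.IsInput σ) {v w : Fin n} (hv : σ.nat .v = v)
    (h : Next N (view n m σ) v w) :
    (if σ.natArr .act (σ.nat .v) = σ.nat .m then σ.natArr .tail (σ.natArr .crit (σ.nat .v)) else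
      σ.natArr .head (σ.natArr .act (σ.nat .v))) = w := by
  rw [hv, hσ.m_eq]
  rcases h with ⟨e, he, rfl⟩ | ⟨h₀, e, he, -, rfl⟩
  · have vact : σ.natArr .act v = e := he
    simp [vact, e.2.ne, hσ.head_eq]
  · have vact : σ.natArr .act v = m := h₀
    have vcrit : σ.natArr .crit v = e := he
    simp [vact, vcrit, hσ.tail_eq]

theorem Forest.set {k : ℕ} {l o : List (Fin n)} {X : Set (Fin n)} (h : Forest N σ k l o X)
    {x : NatVar} (hx : x ≠ .changed ∧ x ≠ .ordLen) (a : ℕ) : Forest N (σ.set x a) k l o X :=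
  ⟨by simpa [hx.1.symm] using h.unchanged, h.ord, by simpa [hx.2.symm] using h.ordLen, h.mark_zero,
    h.mark_one, h.mark_two, h.inner_path, h.inner_ord, h.topological, h.positive⟩

theorem TracedPath.set {l : List (Fin n)} {w : Fin n} (h : TracedPath N σ l w)
    {x : NatVar} (hx : x ≠ .pathLen) (a : ℕ) : TracedPath N (σ.set x a) l w :=
  ⟨h.path, by simpa [hx.symm] using h.pathLen, h.chain, h.nodup⟩

/-- The state of the memory when tracing a path is over. -/
def TraceEnd (N : Network (Fin n) (Fin m)) (σ σ' : Store) (k : ℕ) : Prop :=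
  (σ'.nat .changed = 1 ∧ (view n m σ').potential N < (view n m σ).potential N) ∨
    ∃ l o w, Forest N σ' k l o {w} ∧ TracedPath N σ' l w ∧ (¬ N.Inner w ∨ w ∈ o)

/-- The loop of `tracePath`. -/
theorem trace_loop_runs (hσ : N.IsInput σ) (hs : (view n m σ).Valid N) {v : Fin n}
    (hv : σ.nat .v = v) (hin : N.Inner v) (hex : 0 < (view n m σ).ex v)
    (hmark : σ.natArr .mark v = 0) (hlen : σ.nat .pathLen = 0) (hgo : σ.nat .go = 1) {k : ℕ}
    {o : List (Fin n)} (hf : Forest N σ k [] o {v}) :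
    Runs (Algorithm.repeatWhile (.eqN (.var .go) 1)
        [ .put .mark (.var .v) 1,
          .put .path (.var .pathLen) (.var .v),
          .set .pathLen (.succ (.var .pathLen)),
          Algorithm.process .v,
          .ite (Algorithm.hasActive .v) (.set .w (.get .head (.get .act (.var .v))))
            (.set .w (.get .tail (.get .crit (.var .v)))),
          .ite (.or (.eqN (.var .changed) 1) (.or (.not (.eqN (.get .kind (.var .w)) 0))
              (.eqN (.get .mark (.var .w)) 2)))
            (.set .go 0)
            (.ite (.eqN (.get .mark (.var .w)) 1)
              (Algorithm.block [.set .go 0, Algorithm.rotate])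
              (.set .v (.var .w))) ]) σ
      fun σ' t => N.IsInput σ' ∧ (view n m σ').Valid N ∧
        (view n m σ').potential N ≤ (view n m σ).potential N ∧
        σ'.nat .start = σ.nat .start ∧ σ'.nat .ordLen = σ.nat .ordLen ∧ TraceEnd N σ σ' k ∧
        t + 200 * (view n m σ').potential N + 2000 * unmarked n σ' + 300 * σ'.nat .pathLen ≤
          200 * (view n m σ).potential N + 2000 * unmarked n σ + 10 := by
  refine (runs_loop (fun τ => N.IsInput τ ∧ (view n m τ).Valid N ∧
      (view n m τ).potential N ≤ (view n m σ).potential N ∧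
      τ.nat .start = σ.nat .start ∧ τ.nat .ordLen = σ.nat .ordLen ∧
      (τ.nat .go = 1 → ∃ l o v, Forest N τ k l o {v} ∧ TracedPath N τ l v ∧ τ.nat .v = v ∧
        τ.natArr .mark v = 0 ∧ N.Inner v ∧ 0 < (view n m τ).ex v) ∧
      (τ.nat .go ≠ 1 → TraceEnd N σ τ k))
    -- Marking a vertex releases 2000 units, of which 600 are stored with its path entry. When
    -- tracing stops, half of these pay for a possible rotation, and 300 per entry remain for
    -- joining the path to the earlier ones.
    (fun τ => 200 * (view n m τ).potential N + 2000 * unmarked n τ +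
      if τ.nat .go = 1 then 600 * τ.nat .pathLen else 300 * τ.nat .pathLen) ?_
    ⟨hσ, hs, le_rfl, rfl, rfl, fun _ => ⟨[], o, v, hf, ⟨trivial, by simp [hlen], by simp, by simp⟩,
      hv, hmark, hin, hex⟩, fun h => absurd hgo h⟩).mono ?_
  · rintro τ ⟨hin, hs, hle, hstart, hord, hgo, -⟩ hb
    have hgo1 : τ.nat .go = 1 := by simpa using hb
    obtain ⟨l, o, v, hf, hp, hv, hmark, hinner, hex⟩ := hgo hgo1
    obtain ⟨τ₁, hτ₁⟩ : ∃ τ₁, τ₁ = ((τ.put .mark v 1).put .path l.length v).set .pathLen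
      (l.length + 1) := ⟨_, rfl⟩
    have hview₁ : view n m τ₁ = view n m τ := by rw [hτ₁]; rfl
    have hin₁ : N.IsInput τ₁ := by
      rw [hτ₁]
      exact ((hin.put (by simp) _ _).put (by simp) _ _).set (by simp) _
    have hmark₁ : τ₁.natArr .mark = update (τ.natArr .mark) v 1 := by simp [hτ₁]
    have hvl : v ∉ l := fun h => by simp [(hf.mark_one v).2 h] at hmark
    have hvo : v ∉ o := fun h => by simp [(hf.mark_two v).2 h] at hmark
    simp only [Algorithm.block, runs_seq, runs_put, runs_set, NExpr.eval, hv, Store.put_nat,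
      hp.pathLen, ← hτ₁]
    refine (process_runs hin₁ (by rwa [hview₁]) (v := v) (by simp [hτ₁, hv]) hinner
      (by rwa [hview₁]) (by simpa [hτ₁] using hf.unchanged)).mono ?_
    rintro τ₂ t ⟨⟨hfr, hval, hpot, hout⟩, ht⟩
    rw [hview₁] at hpot hout ht
    rw [nextVertex_runs]
    have hin₂ := hfr.isInput hin₁
    have hun : unmarked n τ₂ < unmarked n τ := by
      rw [unmarked_congr (hfr.natArr _ (by simp) (by simp) (by simp))]
      exact unmarked_lt one_ne_zero hmark hmark₁
    have hlen₂ : τ₂.nat .pathLen = l.length + 1 := by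
      rw [hfr.nat _ (by simp) (by simp) (by simp), hτ₁]
      simp
    have hstart₂ : τ₂.nat .start = σ.nat .start := by
      rw [hfr.nat _ (by simp) (by simp) (by simp), ← hstart, hτ₁]
      simp
    have hord₂ : τ₂.nat .ordLen = σ.nat .ordLen := by
      rw [hfr.nat _ (by simp) (by simp) (by simp), ← hord, hτ₁]
      simp
    have hgo₂ : τ₂.nat .go = 1 := by
      rw [hfr.nat _ (by simp) (by simp) (by simp), ← hgo1, hτ₁]
      simp
    have hv₂ : τ₂.nat .v = v := by
      rw [hfr.nat _ (by simp) (by simp) (by simp), ← hv, hτ₁]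
      simp
    rcases hout with ⟨hch, hlt⟩ | ⟨hch, hv0, hq⟩
    -- A change ends the tracing whatever `w` is.
    · rw [runs_ite]
      refine ⟨fun _ => ?_, fun h => absurd (by simp [hch]) h⟩
      rw [runs_set]
      refine ⟨⟨(hin₂.set (by simp) _).set (by simp) _, hval, by simpa using hpot.trans hle,
        by simpa using hstart₂, by simpa using hord₂, by simp, fun _ => .inl ⟨by simpa using hch,
          by simpa using hlt.trans_le hle⟩⟩, ?_⟩
      have := unmarked_congr (n := n) (σ := τ₂) (σ' := (τ₂.set .w (if τ₂.natArr .act (τ₂.nat .v) =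
        τ₂.nat .m then τ₂.natArr .tail (τ₂.natArr .crit (τ₂.nat .v)) else
        τ₂.natArr .head (τ₂.natArr .act (τ₂.nat .v)))).set .go 0) rfl
      simp [hgo1, hlen₂] at this ⊢
      rw [this]
      omega
    · obtain ⟨w, hw, hexw⟩ := hq.moved
      rw [hw.eval hin₂ hv₂]
      obtain ⟨τ₃, hτ₃⟩ : ∃ τ₃, τ₃ = τ₂.set .w w := ⟨_, rfl⟩
      have hview₃ : view n m τ₃ = view n m τ₂ := by rw [hτ₃]; rfl
      have hin₃ : N.IsInput τ₃ := hτ₃ ▸ hin₂.set (by simp) _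
      have hmark₃ : τ₃.natArr .mark = update (τ.natArr .mark) v 1 := by
        rw [hτ₃, Store.set_natArr, hfr.natArr _ (by simp) (by simp) (by simp), hmark₁]
      have hmarkv : ∀ u : Fin n, u ≠ v → τ₃.natArr .mark u = τ.natArr .mark u := fun u hu => by
        simp [hmark₃, Fin.val_inj, hu]
      have hmarkv' : τ₃.natArr .mark v = 1 := by simp [hmark₃]
      have hord₃ : τ₃.natArr .ord = τ.natArr .ord := by
        rw [hτ₃, Store.set_natArr, hfr.natArr _ (by simp) (by simp) (by simp), hτ₁]
        simp
      have hpath₃ : τ₃.natArr .path = update (τ.natArr .path) l.length v := by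
        rw [hτ₃, Store.set_natArr, hfr.natArr _ (by simp) (by simp) (by simp), hτ₁]
        simp
      have hun₃ : unmarked n τ₃ = unmarked n τ₂ := by rw [hτ₃]; rfl
      have hnat₃ : ∀ x, x ≠ .w → τ₃.nat x = τ₂.nat x := fun x hx => by simp [hτ₃, hx]
      -- The excess of `v` has moved to `w` entirely, so the exceptional vertex is now `w`.
      have hf₃ : Forest N τ₃ k (v :: l) o {w} := by
        refine ⟨by rw [hnat₃ _ (by simp), hch], hord₃ ▸ hf.ord,
          by rw [hnat₃ _ (by simp), hord₂, ← hord, hf.ordLen], fun u => ?_, fun u => ?_, fun u => ?_,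
          fun u hu => ?_, hf.inner_ord, ?_, fun u hu hpos => ?_⟩
        · by_cases huv : u = v
          · simp [huv]
          · rw [hmarkv u huv]
            simpa [huv] using hf.mark_zero u
        · by_cases huv : u = v
          · simp [huv, hmarkv']
          · rw [hmarkv u huv]
            simpa [huv] using hf.mark_one u
        · by_cases huv : u = v
          · simp [huv, hmarkv', hvo]
          · rw [hmarkv u huv]
            exact hf.mark_two u
        · rcases List.mem_cons.1 hu with rfl | hu
          · exact hinner
          · exact hf.inner_path u hu
        · rw [hview₃]
          exact hf.topological.mono hq.next
        · rw [hview₃] at hpos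
          by_cases huv : u = v
          · subst huv
            exact absurd hv0 hpos.ne'
          · by_cases huw : u = w
            · exact .inr (.inr huw)
            · have := hf.positive u hu (by simpa [hexw, moveEx, huv, huw] using hpos)
              simpa [huv, huw] using this
      have hp₃ : TracedPath N τ₃ (v :: l) w := by
        refine ⟨?_, ?_, ?_, List.nodup_cons.2 ⟨hvl, hp.nodup⟩⟩
        · rw [hpath₃]
          exact ⟨by simp, hp.path.update le_rfl _⟩
        · rw [hnat₃ _ (by simp), hlen₂]
          rfl
        · rw [hview₃, List.isChain_cons_cons]
          exact ⟨hw, hp.chain.imp fun a b h => hq.next _ _ h⟩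
      rw [← hτ₃, runs_ite]
      have hw₃ : τ₃.nat .w = w := by simp [hτ₃]
      have hkind := hin₃.kind_eq_zero (v := w)
      have hval₃ : (view n m τ₃).Valid N := by rwa [hview₃]
      rw [← hview₃] at hpot ht
      have hlen₃ : τ₃.nat .pathLen = l.length + 1 := hp₃.pathLen
      rw [← hun₃] at hun
      simp only [BExpr.Holds, NExpr.eval, hw₃, hf₃.unchanged, hkind, hf₃.mark_two, hf₃.mark_one,
        zero_ne_one, false_or, runs_set, runs_ite]
      refine ⟨fun hend => ?_, fun hcont => ⟨fun hcyc => ?_, fun hnew => ?_⟩⟩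
      · refine ⟨⟨hin₃.set (by simp) _, hval₃, hpot.trans hle,
          by simp [hnat₃, hstart₂], by simp [hnat₃, hord₂], by simp,
          fun _ => .inr ⟨_, _, _, hf₃.set (by simp) _, hp₃.set (by simp) _, hend⟩⟩, ?_⟩
        have hu : unmarked n (τ₃.set .go 0) = unmarked n τ₃ := rfl
        simp [hgo1, hlen₃, hu] at ht ⊢
        omega
      · simp only [runs_seq, runs_set]
        have hp₄ := hp₃.set (x := .go) (by simp) 0
        refine (rotate_runs (hin₃.set (x := .go) (by simp) 0) hval₃ (w := w) (by simp [hw₃])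
          hp₄.path hp₄.pathLen hp₄.nodup hcyc hp₄.chain).mono ?_
        rintro τ₅ t₅ ⟨k₁, k₂, k₃, k₄, k₅⟩
        have hu : unmarked n τ₅ = unmarked n τ₃ := unmarked_congr (k₁.natArr _ (by simp))
        have hn : ∀ x, x ≠ .i → x ≠ .v → x ≠ .e → x ≠ .changed → x ≠ .go → x ≠ .w →
            τ₅.nat x = τ₂.nat x := fun x h₁ h₂ h₃ h₄ h₅ h₆ => by
          rw [k₁.nat x h₁ h₂ h₃ h₄]
          simp [h₅, hnat₃ x h₆]
        have hgo₅ : τ₅.nat .go = 0 := by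
          rw [k₁.nat _ (by simp) (by simp) (by simp) (by simp)]
          simp
        rw [view_set] at k₄ k₅
        refine ⟨⟨k₁.isInput (hin₃.set (by simp) _), k₂, by omega,
          by rw [hn _ (by simp) (by simp) (by simp) (by simp) (by simp) (by simp), hstart₂],
          by rw [hn _ (by simp) (by simp) (by simp) (by simp) (by simp) (by simp), hord₂],
          by simp [hgo₅], fun _ => .inl ⟨k₃, by omega⟩⟩, ?_⟩
        rw [hu, hgo₅, hn .pathLen (by simp) (by simp) (by simp) (by simp) (by simp) (by simp), hlen₂]
        simp [hgo1] at ht k₅ ⊢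
        omega
      · rw [not_or, not_not] at hcont
        have hmarkw : τ₃.natArr .mark w = 0 := by
          rcases hf₃.mark_zero w with h | h | h
          · exact h
          · exact absurd h hnew
          · exact absurd h hcont.2
        have hwv : w ≠ v := fun h => hnew (by simp [h])
        refine ⟨⟨hin₃.set (by simp) _, hval₃, hpot.trans hle,
          by simp [hnat₃, hstart₂], by simp [hnat₃, hord₂], fun _ => ⟨v :: l, o, w,
            hf₃.set (by simp) _, hp₃.set (by simp) _, by simp, hmarkw, hcont.1, ?_⟩,
          fun h => absurd (by simp [hnat₃, hgo₂]) h⟩, ?_⟩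
        -- The new vertex had nonnegative excess and received the positive excess of `v`.
        · rw [view_set, hview₃, hexw]
          have := hs.balanced.ex_nonneg w hcont.1
          simp [moveEx]
          linarith
        · have hu : unmarked n (τ₃.set .v w) = unmarked n τ₃ := rfl
          simp [hgo1, hlen₃, hu, hnat₃, hgo₂] at ht ⊢
          omega
  · rintro τ t ⟨⟨hin, hs, hle, hstart, hord, -, hgo⟩, hb, ht⟩
    have hgo0 : τ.nat .go ≠ 1 := by simpa using hb
    refine ⟨hin, hs, hle, hstart, hord, hgo hgo0, ?_⟩
    simp [hgo0, hlen] at ht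
    omega

/-- The loop of `tracePath` that appends the current path to the earlier ones. -/
theorem join_loop_runs (hσ : N.IsInput σ) {k : ℕ} {l o : List (Fin n)} {w : Fin n}
    (hf : Forest N σ k l o {w}) (hp : TracedPath N σ l w) (hw : ¬ N.Inner w ∨ w ∈ o) :
    Runs (Algorithm.repeatWhile (.ltN 0 (.var .pathLen))
        [ .set .pathLen (.pred (.var .pathLen)),
          .put .mark (.get .path (.var .pathLen)) 2,
          .put .ord (.var .ordLen) (.get .path (.var .pathLen)),
          .set .ordLen (.succ (.var .ordLen)) ]) σ
      fun σ' t => N.IsInput σ' ∧ view n m σ' = view n m σ ∧ σ'.nat .start = σ.nat .start ∧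
        (∃ o', Forest N σ' k [] o' ∅) ∧
        t + 250 * σ'.nat .ordLen + 2000 * unmarked n σ' ≤
          250 * σ.nat .ordLen + 2000 * unmarked n σ + 300 * σ.nat .pathLen + 10 := by
  -- The successor `w` of the top is a terminal or already listed in `o`, so putting the top in
  -- front of `o` keeps the order topological; the popped vertex then takes the role of `w`. Of the
  -- 300 units of a path entry, 250 pass to its entry in `ord`.
  refine (runs_loop (fun τ => N.IsInput τ ∧ view n m τ = view n m σ ∧
      τ.nat .start = σ.nat .start ∧
      ∃ l o w, Forest N τ k l o {w} ∧ TracedPath N τ l w ∧ (¬ N.Inner w ∨ w ∈ o))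
    (fun τ => 250 * τ.nat .ordLen + 2000 * unmarked n τ + 300 * τ.nat .pathLen) ?_
    ⟨hσ, rfl, rfl, l, o, w, hf, hp, hw⟩).mono ?_
  · rintro τ ⟨hin, hview, hstart, l, o, w, hf, hp, hw⟩ hb
    obtain _ | ⟨v, l⟩ := l
    · simp [hp.pathLen] at hb
    have hlen : τ.nat .pathLen - 1 = l.length := by simp [hp.pathLen]
    have hcell : τ.natArr .path l.length = v := hp.path.1
    obtain ⟨τ₁, hτ₁⟩ : ∃ τ₁, τ₁ = (((τ.set .pathLen l.length).put .mark v 2).put .ord o.length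
      v).set .ordLen (o.length + 1) := ⟨_, rfl⟩
    have hgoal : Runs (Algorithm.block [ .set .pathLen (.pred (.var .pathLen)),
          .put .mark (.get .path (.var .pathLen)) 2,
          .put .ord (.var .ordLen) (.get .path (.var .pathLen)),
          .set .ordLen (.succ (.var .ordLen)) ]) τ fun σ' t => τ₁ = σ' ∧ t ≤ 25 := by
      simp [hτ₁, hlen, hcell, hf.ordLen]
    refine hgoal.mono ?_
    rintro _ t ⟨rfl, ht⟩
    have hview₁ : view n m τ₁ = view n m τ := by rw [hτ₁]; rfl
    have hin₁ : N.IsInput τ₁ := by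
      rw [hτ₁]
      exact (((hin.set (by simp) _).put (by simp) _ _).put (by simp) _ _).set (by simp) _
    have hmark₁ : τ₁.natArr .mark = update (τ.natArr .mark) v 2 := by simp [hτ₁]
    have hmarkv : ∀ u : Fin n, u ≠ v → τ₁.natArr .mark u = τ.natArr .mark u := fun u hu => by
      simp [hmark₁, Fin.val_inj, hu]
    have hmarkv' : τ₁.natArr .mark v = 2 := by simp [hmark₁]
    have hord₁ : τ₁.natArr .ord = update (τ.natArr .ord) o.length v := by simp [hτ₁]
    have hnd := List.nodup_cons.1 hp.nodup
    have hch := List.isChain_cons_cons.1 hp.chain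
    refine ⟨⟨hin₁, hview₁.trans hview, ?_, l, v :: o, v, ?_, ?_, .inr (by simp)⟩, ?_⟩
    · rw [← hstart, hτ₁]
      simp
    · refine ⟨by simpa [hτ₁] using hf.unchanged, ?_, by simp [hτ₁], fun u => ?_, fun u => ?_,
        fun u => ?_, fun u hu => hf.inner_path u (List.mem_cons_of_mem _ hu), fun u hu => ?_, ?_,
        fun u hu hpos => ?_⟩
      · rw [hord₁]
        exact ⟨by simp, hf.ord.update le_rfl _⟩
      · by_cases huv : u = v
        · simp [huv]
        · rw [hmarkv u huv]
          simpa [huv] using hf.mark_zero u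
      · by_cases huv : u = v
        · simp [huv, hmarkv', hnd.1]
        · rw [hmarkv u huv]
          simpa [huv] using hf.mark_one u
      · by_cases huv : u = v
        · simp [huv, hmarkv']
        · rw [hmarkv u huv]
          simpa [huv] using hf.mark_two u
      · rcases List.mem_cons.1 hu with rfl | hu
        · exact hf.inner_path u (by simp)
        · exact hf.inner_ord u hu
      · rw [hview₁]
        exact ⟨⟨w, hch.1, hw⟩, hf.topological⟩
      · rw [hview₁] at hpos
        rcases hf.positive u hu hpos with h | h | h
        · exact .inl h
        · exact .inr (.inl (List.mem_cons_of_mem _ h))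
        · obtain rfl : u = w := h
          exact .inr (.inl (List.mem_cons_of_mem _ (hw.resolve_left (not_not.2 hu))))
    · refine ⟨?_, by simp [hτ₁], ?_, hnd.2⟩
      · have : τ₁.natArr .path = τ.natArr .path := by simp [hτ₁]
        rw [this]
        exact hp.path.2
      · rw [hview₁]
        exact hch.2
    · have hu := unmarked_update_le (n := n) two_ne_zero hmark₁
      have h₁ : τ₁.nat .ordLen = o.length + 1 := by simp [hτ₁]
      have h₂ : τ₁.nat .pathLen = l.length := by simp [hτ₁]
      rw [h₁, h₂, hf.ordLen, hp.pathLen]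
      simp
      omega
  · rintro τ t ⟨⟨hin, hview, hstart, l, o, w, hf, hp, hw⟩, hb, ht⟩
    obtain rfl : l = [] := by simpa [hp.pathLen] using hb
    refine ⟨hin, hview, hstart, ⟨o, { hf with positive := fun u hu hpos => ?_ }⟩, ?_⟩
    · rcases hf.positive u hu hpos with h | h | h
      · exact .inl h
      · exact .inr (.inl h)
      · obtain rfl : u = w := h
        exact .inr (.inl (hw.resolve_left (not_not.2 hu)))
    · simp [hp.pathLen] at ht
      omega

theorem tracePath_runs (hσ : N.IsInput σ) (hs : (view n m σ).Valid N) {v : Fin n}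
    (hv : σ.nat .start = v) (hin : N.Inner v) (hex : 0 < (view n m σ).ex v)
    (hmark : σ.natArr .mark v = 0) {o : List (Fin n)} (hf : Forest N σ v [] o ∅) :
    Runs Algorithm.tracePath σ
      fun σ' t => N.IsInput σ' ∧ (view n m σ').Valid N ∧
        (view n m σ').potential N ≤ (view n m σ).potential N ∧ σ'.nat .start = σ.nat .start ∧
        ((σ'.nat .changed = 1 ∧ (view n m σ').potential N < (view n m σ).potential N) ∨
          ∃ o', Forest N σ' (v + 1) [] o' ∅) ∧
        t + 200 * (view n m σ').potential N + 2000 * unmarked n σ' + 250 * σ'.nat .ordLen ≤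
          200 * (view n m σ).potential N + 2000 * unmarked n σ + 250 * σ.nat .ordLen + 50 := by
  unfold Algorithm.tracePath
  obtain ⟨τ, hτ⟩ : ∃ τ, τ = ((σ.set .v v).set .pathLen 0).set .go 1 := ⟨_, rfl⟩
  have hview : view n m τ = view n m σ := by rw [hτ]; rfl
  have hun : unmarked n τ = unmarked n σ := by rw [hτ]; rfl
  have hord : τ.nat .ordLen = σ.nat .ordLen := by simp [hτ]
  have hstart : τ.nat .start = σ.nat .start := by simp [hτ]
  have hinτ : N.IsInput τ := by
    rw [hτ]
    exact ((hσ.set (by simp) _).set (by simp) _).set (by simp) _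
  -- The scan bound moves past `v`, which becomes the exceptional vertex.
  have hfτ : Forest N σ (v + 1) [] o {v} := by
    refine { hf with positive := fun u hu hpos => ?_ }
    rcases hf.positive u hu hpos with h | h | h
    · rcases h.eq_or_lt with h | h
      · exact .inr (.inr (Fin.val_injective h.symm))
      · exact .inl h
    · exact .inr (.inl h)
    · exact h.elim
  rw [Algorithm.block, runs_seq, runs_set, Algorithm.block, runs_seq, runs_set, Algorithm.block,
    runs_seq, runs_set, Algorithm.block, runs_seq]
  simp only [NExpr.eval, hv, ← hτ]
  refine (trace_loop_runs hinτ (by rwa [hview]) (v := v) (by simp [hτ]) hin (by rwa [hview])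
    (by simpa [hτ] using hmark) (by simp [hτ]) (by simp [hτ]) (k := v + 1) (o := o) ?_).mono ?_
  · rw [hτ]
    exact ((hfτ.set (by simp) _).set (by simp) _).set (by simp) _
  rintro τ₁ t₁ ⟨h₁, h₂, h₃, h₄, h₅, h₆, h₇⟩
  rw [hview] at h₃ h₇
  rw [Algorithm.block, Algorithm.when, runs_ite]
  rcases h₆ with ⟨hc, hlt⟩ | ⟨l, o', w, hf₁, hp₁, hw⟩
  · refine ⟨fun h => absurd h (by simp [hc]), fun _ => ?_⟩
    rw [runs_skip]
    refine ⟨h₁, h₂, h₃, h₄.trans (hstart.trans hv), .inl ⟨hc, by rwa [hview] at hlt⟩, ?_⟩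
    rw [h₅, hord]
    simp
    omega
  · refine ⟨fun _ => ?_, fun h => absurd hf₁.unchanged (by simpa using h)⟩
    rw [Algorithm.block]
    refine (join_loop_runs h₁ hf₁ hp₁ hw).mono ?_
    rintro τ₂ t₂ ⟨k₁, k₂, k₃, k₄, k₅⟩
    rw [k₂]
    refine ⟨k₁, h₂, h₃, k₃.trans (h₄.trans (hstart.trans hv)), .inr k₄, ?_⟩
    rw [h₅, hord] at k₅
    simp
    omega

/-! ### Assembling a big iteration. -/

/-- The part of a big iteration that traces paths. -/
theorem scan_loop_runs (hσ : N.IsInput σ) (hs : (view n m σ).Valid N) (hstart : σ.nat .start = 0)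
    (hf : Forest N σ 0 [] [] ∅) :
    Runs (Algorithm.repeatWhile (.and (.eqN (.var .changed) 0) (.ltN (.var .start) (.var .n)))
        [ Algorithm.when (.and (.eqN (.get .kind (.var .start)) 0)
            (.and (.eqN (.get .mark (.var .start)) 0) (.ltR .zero (.get .ex (.var .start)))))
            [Algorithm.tracePath],
          .set .start (.succ (.var .start)) ]) σ
      fun σ' t => N.IsInput σ' ∧ (view n m σ').Valid N ∧
        (view n m σ').potential N ≤ (view n m σ).potential N ∧
        ((σ'.nat .changed = 1 ∧ (view n m σ').potential N < (view n m σ).potential N) ∨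
          ∃ o, Forest N σ' n [] o ∅) ∧
        t + 200 * (view n m σ').potential N + 250 * σ'.nat .ordLen ≤
          200 * (view n m σ).potential N + 2200 * n + 20 := by
  -- One scan suffices: as long as nothing changes, excess moves only along traced paths, so a
  -- vertex left behind by the scan can have positive excess only if it belongs to `o`. Passing a
  -- number is paid by the last term of the measure.
  refine (runs_loop (fun τ => N.IsInput τ ∧ (view n m τ).Valid N ∧
      (view n m τ).potential N ≤ (view n m σ).potential N ∧ τ.nat .start ≤ n ∧
      ((τ.nat .changed = 1 ∧ (view n m τ).potential N < (view n m σ).potential N) ∨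
        ∃ o, Forest N τ (τ.nat .start) [] o ∅))
    (fun τ => 200 * (view n m τ).potential N + 2000 * unmarked n τ + 250 * τ.nat .ordLen +
      200 * (n - τ.nat .start)) ?_ ⟨hσ, hs, le_rfl, by simp [hstart], .inr ⟨[], by rwa [hstart]⟩⟩).mono
      ?_
  · rintro τ ⟨hin, hval, hle, -, hor⟩ hb
    simp [hin.n_eq] at hb
    obtain ⟨o, hf⟩ := hor.resolve_left (by simp [hb.1])
    obtain ⟨v, hv⟩ : ∃ v : Fin n, τ.nat .start = v := ⟨⟨_, hb.2⟩, rfl⟩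
    have hvn := v.2
    have hkind := hin.kind_eq_zero (v := v)
    have vex : τ.realArr .ex v = (view n m τ).ex v := rfl
    rw [hv] at hf
    simp only [Algorithm.block, Algorithm.when, runs_seq, runs_ite, runs_skip, runs_set, NExpr.eval,
      BExpr.Holds, RExpr.eval, hv, hkind, vex]
    refine ⟨fun hcond => (tracePath_runs hin hval hv hcond.1 hcond.2.2 hcond.2.1 hf).mono ?_,
      fun hcond => ?_⟩
    · rintro τ₁ t ⟨h₁, h₂, h₃, h₄, h₅, h₆⟩
      have hu : ∀ a, unmarked n (τ₁.set .start a) = unmarked n τ₁ := fun _ => rfl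
      refine ⟨⟨h₁.set (by simp) _, h₂, h₃.trans hle, ?_, ?_⟩, ?_⟩
      · simp [h₄, hv]
      · rcases h₅ with ⟨hc, hlt⟩ | ⟨o', hf'⟩
        · exact .inl ⟨by simpa using hc, hlt.trans_le hle⟩
        · refine .inr ⟨o', ?_⟩
          have := hf'.set (x := .start) (by simp) (τ₁.nat .start + 1)
          simpa [h₄, hv] using this
      · simp [h₄, hv, hu]
        omega
    · have hu : unmarked n (τ.set .start (v + 1)) = unmarked n τ := rfl
      refine ⟨⟨hin.set (by simp) _, hval, hle, by simp, .inr ⟨o, ?_⟩⟩, ?_⟩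
      · have hf' := hf.set (x := .start) (by simp) (v + 1)
        refine { hf' with positive := fun u hu hpos => ?_ }
        rcases hf'.positive u hu hpos with h | h | h
        · rcases h.eq_or_lt with h | h
          · obtain rfl : v = u := Fin.val_injective h
            rcases hf.mark_zero v with h' | h' | h'
            · exact absurd ⟨hu, h', hpos⟩ hcond
            · simp at h'
            · exact .inr (.inl h')
          · exact .inl (by simpa using h)
        · exact .inr (.inl h)
        · exact h.elim
      · simp [hu]
        omega
  · rintro τ t ⟨⟨hin, hval, hle, hsn, hor⟩, hb, ht⟩
    refine ⟨hin, hval, hle, ?_, ?_⟩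
    · rcases hor with h | ⟨o, hf⟩
      · exact .inl h
      · simp [hf.unchanged, hin.n_eq] at hb
        obtain h : τ.nat .start = n := le_antisymm hsn hb
        exact .inr ⟨o, h ▸ hf⟩
    · have : unmarked n σ ≤ n := by
        unfold unmarked
        simpa using Set.ncard_le_ncard (Set.subset_univ {u : Fin n | σ.natArr .mark u = 0})
      simp [hf.ordLen, hstart] at ht
      omega

/-- The part of a big iteration that moves the excesses towards the roots. -/
theorem tree_loop_runs (hσ : N.IsInput σ) (hs : (view n m σ).Valid N)
    (hf : σ.nat .changed = 1 ∨ ∃ o, Forest N σ n [] o ∅) :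
    Runs (Algorithm.repeatWhile (.and (.eqN (.var .changed) 0) (.ltN 0 (.var .ordLen)))
        [ .set .ordLen (.pred (.var .ordLen)),
          .set .v (.get .ord (.var .ordLen)),
          Algorithm.when (.ltR .zero (.get .ex (.var .v))) [Algorithm.process .v] ]) σ
      fun σ' t => N.IsInput σ' ∧ (view n m σ').Valid N ∧
        (view n m σ').potential N ≤ (view n m σ).potential N ∧
        ((σ'.nat .changed = 1 ∧ (σ.nat .changed = 1 ∨
            (view n m σ').potential N < (view n m σ).potential N)) ∨
          (σ'.nat .changed = 0 ∧ ∀ u, N.Inner u → (view n m σ').ex u ≤ 0)) ∧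
        t + 200 * (view n m σ').potential N ≤
          200 * (view n m σ).potential N + 250 * σ.nat .ordLen + 20 := by
  refine (runs_loop (fun τ => N.IsInput τ ∧ (view n m τ).Valid N ∧
      (view n m τ).potential N ≤ (view n m σ).potential N ∧
      ((τ.nat .changed = 1 ∧ (σ.nat .changed = 1 ∨
        (view n m τ).potential N < (view n m σ).potential N)) ∨
        (τ.nat .changed = 0 ∧ ∃ o : List (Fin n), StackAt (τ.natArr .ord) o ∧
          τ.nat .ordLen = o.length ∧ (view n m τ).Topological N o ∧ (∀ u ∈ o, N.Inner u) ∧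
          ∀ u, N.Inner u → 0 < (view n m τ).ex u → u ∈ o)))
    (fun τ => 200 * (view n m τ).potential N + 250 * τ.nat .ordLen) ?_ ⟨hσ, hs, le_rfl, ?_⟩).mono ?_
  · rintro τ ⟨hin, hval, hle, hor⟩ hb
    simp at hb
    obtain ⟨-, o, hst, hlen, htop, hinner, hpos⟩ := hor.resolve_left (by simp [hb.1])
    obtain _ | ⟨v, o⟩ := o
    · simp [hlen] at hb
    obtain ⟨⟨w, hw, hwo⟩, htop⟩ := htop
    have hlen' : τ.nat .ordLen - 1 = o.length := by simp [hlen]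
    obtain ⟨τ₁, hτ₁⟩ : ∃ τ₁, τ₁ = (τ.set .ordLen o.length).set .v v := ⟨_, rfl⟩
    have hview₁ : view n m τ₁ = view n m τ := by rw [hτ₁]; rfl
    have hin₁ : N.IsInput τ₁ := hτ₁ ▸ (hin.set (by simp) _).set (by simp) _
    have hord₁ : τ₁.natArr .ord = τ.natArr .ord := by simp [hτ₁]
    have hlen₁ : τ₁.nat .ordLen = o.length := by simp [hτ₁]
    have hch₁ : τ₁.nat .changed = 0 := by simp [hτ₁, hb.1]
    have hv₁ : τ₁.nat .v = v := by simp [hτ₁]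
    have vex : τ₁.realArr .ex v = (view n m τ).ex v := by rw [← hview₁]; rfl
    simp only [Algorithm.block, Algorithm.when, runs_seq, runs_set, NExpr.eval, hlen', Store.set_nat,
      Store.set_natArr, if_true, hst.1, ← hτ₁]
    simp only [runs_ite, NExpr.eval, BExpr.Holds, RExpr.eval, hv₁, vex, runs_skip]
    refine ⟨fun hex => (process_runs hin₁ (by rwa [hview₁]) hv₁ (hinner v (by simp))
      (by rwa [hview₁]) hch₁).mono ?_, fun hex => ?_⟩
    · rintro τ₂ t ⟨⟨hfr, hval₂, hpot, hout⟩, ht⟩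
      rw [hview₁] at hpot hout ht
      have hlen₂ : τ₂.nat .ordLen = o.length := by
        rw [hfr.nat _ (by simp) (by simp) (by simp), hlen₁]
      refine ⟨⟨hfr.isInput hin₁, hval₂, hpot.trans hle, ?_⟩, ?_⟩
      · rcases hout with ⟨hc, hlt⟩ | ⟨hc, hv0, hq⟩
        · exact .inl ⟨hc, .inr (hlt.trans_le hle)⟩
        · refine .inr ⟨hc, o, ?_, hlen₂, htop.mono hq.next, fun u hu => hinner u (by simp [hu]),
            fun u hu hu' => ?_⟩
          · rw [hfr.natArr _ (by simp) (by simp) (by simp), hord₁]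
            exact hst.2
          · obtain ⟨w', hw', hexw⟩ := hq.moved
            -- The excess went to the successor recorded in the order, which is a terminal or a
            -- vertex still to be processed.
            obtain rfl := hw'.unique (hq.next _ _ hw)
            by_cases huv : u = v
            · subst huv
              exact absurd hv0 hu'.ne'
            · by_cases huw : u = w'
              · subst huw
                exact hwo.resolve_left (not_not.2 hu)
              · have := hpos u hu (by simpa [hexw, moveEx, huv, huw] using hu')
                simpa [huv] using this
      · rw [hlen₂, hlen]
        simp
        omega
    · refine ⟨⟨hin₁, by rwa [hview₁], by rwa [hview₁], .inr ⟨hch₁, o, ?_, hlen₁, ?_,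
        fun u hu => hinner u (by simp [hu]), fun u hu hu' => ?_⟩⟩, ?_⟩
      · rw [hord₁]
        exact hst.2
      · rwa [hview₁]
      · rw [hview₁] at hu'
        rcases List.mem_cons.1 (hpos u hu hu') with rfl | h
        · exact absurd hu' hex
        · exact h
      · rw [hview₁, hlen₁, hlen]
        simp
        omega
  · rcases hf with h | ⟨o, hf⟩
    · exact .inl ⟨h, .inl h⟩
    · refine .inr ⟨hf.unchanged, o, hf.ord, hf.ordLen, hf.topological, hf.inner_ord,
        fun u hu hpos => ?_⟩
      rcases hf.positive u hu hpos with h | h | h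
      -- The scan has passed all numbers below `n`.
      · exact absurd h (by simp)
      · exact h
      · exact h.elim
  · rintro τ t ⟨⟨hin, hval, hle, hor⟩, hb, ht⟩
    refine ⟨hin, hval, hle, ?_, ?_⟩
    · rcases hor with h | ⟨hc, o, hst, hlen, -, -, hpos⟩
      · exact .inl h
      · simp [hc, hlen] at hb
        subst hb
        exact .inr ⟨hc, fun u hu => not_lt.1 fun h => by simpa using hpos u hu h⟩
    · simp at ht
      omega

theorem clear_marks_runs (hσ : N.IsInput σ) (hch : σ.nat .changed = 0) (hord : σ.nat .ordLen = 0) :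
    Runs (Algorithm.forBelow .v .n [.put .mark (.var .v) 0]) σ fun σ' t => N.IsInput σ' ∧
      view n m σ' = view n m σ ∧ σ'.nat .changed = 0 ∧ σ'.nat .ordLen = 0 ∧
      (∀ u : Fin n, σ'.natArr .mark u = 0) ∧ t ≤ 20 * n + 20 := by
  rw [Algorithm.forBelow, Algorithm.block, runs_seq, runs_set, Algorithm.block]
  refine (runs_loop (fun τ => N.IsInput τ ∧ view n m τ = view n m σ ∧ τ.nat .changed = 0 ∧
      τ.nat .ordLen = 0 ∧ τ.nat .v ≤ n ∧ ∀ u : Fin n, (u : ℕ) < τ.nat .v → τ.natArr .mark u = 0)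
    (fun τ => 20 * (n - τ.nat .v)) ?_
    ⟨hσ.set (by simp) _, rfl, by simpa using hch, by simpa using hord, by simp, by simp⟩).mono ?_
  · rintro τ ⟨hin, hview, h₁, h₂, hv, hmark⟩ hb
    simp [hin.n_eq] at hb
    simp only [List.cons_append, List.nil_append, Algorithm.block, runs_seq, runs_put, runs_set]
    refine ⟨⟨(hin.put (by simp) _ _).set (by simp) _, ?_, by simpa using h₁, by simpa using h₂,
      by simpa using hb, fun u hu => ?_⟩, ?_⟩
    · rw [← hview]
      rfl
    · simp only [NExpr.eval, Store.set_nat, if_true, Store.put_nat] at hu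
      rcases (Nat.lt_succ_iff.1 hu).eq_or_lt with h | h
      · simp [h]
      · simpa [h.ne] using hmark u h
    · simp
      omega
  · rintro τ t ⟨⟨hin, hview, h₁, h₂, hv, hmark⟩, hb, ht⟩
    simp [hin.n_eq] at hb
    refine ⟨hin, hview, h₁, h₂, fun u => hmark u (u.2.trans_le hb), ?_⟩
    simp at ht ⊢
    omega

/-- With `changed` being 0 or 1, the inequality between the potentials says that an iteration
raising the flag consumes at least one unit; this is what bounds the number of iterations. -/
theorem bigIteration_runs (hσ : N.IsInput σ) (hs : (view n m σ).Valid N) :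
    Runs Algorithm.bigIteration σ fun σ' t => N.IsInput σ' ∧ (view n m σ').Valid N ∧
      (σ'.nat .changed = 1 ∨ (σ'.nat .changed = 0 ∧ ∀ u, N.Inner u → (view n m σ').ex u ≤ 0)) ∧
      (view n m σ').potential N + σ'.nat .changed ≤ (view n m σ).potential N ∧
      t + 200 * (view n m σ').potential N ≤
        200 * (view n m σ).potential N + 2300 * n + 100 := by
  unfold Algorithm.bigIteration
  rw [Algorithm.block, runs_seq, runs_set, Algorithm.block, runs_seq, runs_set, Algorithm.block,
    runs_seq]
  refine (clear_marks_runs ((hσ.set (by simp) _).set (by simp) _) (by simp) (by simp)).mono ?_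
  rintro τ t ⟨hin, hview, h₁, h₂, hmark, ht⟩
  rw [view_set, view_set] at hview
  rw [Algorithm.block, runs_seq, runs_set, Algorithm.block, runs_seq]
  obtain ⟨τ₁, hτ₁⟩ : ∃ τ₁, τ₁ = τ.set .start 0 := ⟨_, rfl⟩
  have hview₁ : view n m τ₁ = view n m σ := by rw [hτ₁, view_set, hview]
  change Runs _ (τ.set .start 0) _
  rw [← hτ₁]
  refine (scan_loop_runs (hτ₁ ▸ hin.set (by simp) _) (by rwa [hview₁]) (by simp [hτ₁]) ?_).mono ?_
  · refine ⟨by simpa [hτ₁] using h₁, trivial, by simpa [hτ₁] using h₂, ?_, ?_, ?_, by simp, by simp,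
      trivial, by simp⟩ <;> simp [hτ₁, hmark]
  rintro τ₂ t₂ ⟨k₁, k₂, k₃, k₄, k₅⟩
  rw [hview₁] at k₃ k₄ k₅
  rw [Algorithm.block]
  refine (tree_loop_runs k₁ k₂ (k₄.imp_left And.left)).mono ?_
  rintro τ₃ t₃ ⟨l₁, l₂, l₃, l₄, l₅⟩
  refine ⟨l₁, l₂, l₄.imp_left And.left, ?_, ?_⟩
  · rcases l₄ with ⟨hc, h | h⟩ | ⟨hc, -⟩
    · rcases k₄ with ⟨-, k₄⟩ | ⟨o, k₄⟩
      · omega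
      · have := k₄.unchanged
        omega
    · omega
    · omega
  · simp
    omega

/-! ## The initial preflow -/

/-- The initial preflow on the edges below `k`. -/
noncomputable def Network.startFlow (N : Network (Fin n) (Fin m)) (k : ℕ) : Fin m → ℝ := by
  classical exact fun a => if (a : ℕ) < k ∧ N.tail a ∈ N.S then N.c a else 0

theorem Network.startFlow_of_mem (N : Network (Fin n) (Fin m)) {k : ℕ} {a : Fin m} (ha : (a : ℕ) < k)
    (hS : N.tail a ∈ N.S) : N.startFlow k a = N.c a := by
  simp [startFlow, ha, hS]

theorem Network.startFlow_of_not_mem (N : Network (Fin n) (Fin m)) {k : ℕ} {a : Fin m}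
    (hS : N.tail a ∉ N.S) : N.startFlow k a = 0 := by
  simp [startFlow, hS]

theorem Network.startFlow_succ_of_mem (N : Network (Fin n) (Fin m)) {e : Fin m}
    (hS : N.tail e ∈ N.S) : N.startFlow (e + 1) = update (N.startFlow e) e (N.c e) := by
  ext a
  rcases eq_or_ne a e with rfl | ha
  · simp [startFlow, hS]
  · have : (a : ℕ) ≠ e := fun h => ha (Fin.val_injective h)
    have : (a : ℕ) < e + 1 ↔ (a : ℕ) < e := by omega
    rw [update_of_ne ha]
    unfold startFlow
    split_ifs <;> tauto

theorem Network.startFlow_succ_of_not_mem (N : Network (Fin n) (Fin m)) {e : Fin m}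
    (hS : N.tail e ∉ N.S) : N.startFlow (e + 1) = N.startFlow e := by
  ext a
  rcases eq_or_ne a e with rfl | ha
  · simp [startFlow, hS]
  · have : (a : ℕ) ≠ e := fun h => ha (Fin.val_injective h)
    have : (a : ℕ) < e + 1 ↔ (a : ℕ) < e := by omega
    unfold startFlow
    split_ifs <;> tauto

/-- The memory after the vertices below `k` have been initialized. -/
structure VerticesReady (N : Network (Fin n) (Fin m)) (σ : Store) (k : ℕ) : Prop where
  crit : ∀ u : Fin n, (u : ℕ) < k → σ.natArr .crit u = m
  act : ∀ u : Fin n, (u : ℕ) < k → N.Inner u → σ.natArr .act u = σ.natArr .firstOut u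
  act_terminal : ∀ u : Fin n, (u : ℕ) < k → ¬ N.Inner u → σ.natArr .act u = m

theorem init_vertices_runs (hσ : N.IsInput σ) :
    Runs (Algorithm.forBelow .v .n
        [ .put .crit (.var .v) (.var .m),
          .putR .ex (.var .v) .zero,
          .ite (.eqN (.get .kind (.var .v)) 0) (.put .act (.var .v) (.get .firstOut (.var .v)))
            (.put .act (.var .v) (.var .m)) ]) σ
      fun σ' t => N.IsInput σ' ∧ VerticesReady N σ' n ∧ (∀ u : Fin n, σ'.realArr .ex u = 0) ∧
        t ≤ 40 * n + 20 := by
  rw [Algorithm.forBelow, Algorithm.block, runs_seq, runs_set, Algorithm.block]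
  refine (runs_loop (fun τ => N.IsInput τ ∧ VerticesReady N τ (τ.nat .v) ∧
      (∀ u : Fin n, (u : ℕ) < τ.nat .v → τ.realArr .ex u = 0))
    (fun τ => 40 * (n - τ.nat .v)) ?_
    ⟨hσ.set (by simp) _, ⟨by simp, by simp, by simp⟩, by simp⟩).mono ?_
  · rintro τ ⟨hin, hr, hex⟩ hb
    simp [hin.n_eq] at hb
    obtain ⟨v, hv⟩ : ∃ v : Fin n, τ.nat .v = v := ⟨⟨_, hb⟩, rfl⟩
    have hvn := v.2
    have hkind := hin.kind_eq_zero (v := v)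
    rw [hv] at hr hex
    have hlt : ∀ u : Fin n, (u : ℕ) < v + 1 → u = v ∨ (u : ℕ) < v ∧ u ≠ v := fun u hu => by
      rcases (Nat.lt_succ_iff.1 hu).eq_or_lt with h | h
      · exact .inl (Fin.val_injective h)
      · exact .inr ⟨h, fun h' => by simp [h'] at h⟩
    simp [hv, hkind, hin.m_eq]
    refine ⟨fun hinner => ⟨⟨?_, ⟨fun u hu => ?_, fun u hu hu' => ?_, fun u hu hu' => ?_⟩,
      fun u hu => ?_⟩, ?_⟩, fun hinner => ⟨⟨?_, ⟨fun u hu => ?_, fun u hu hu' => ?_,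
      fun u hu hu' => ?_⟩, fun u hu => ?_⟩, ?_⟩⟩
    · exact (((hin.put (by simp) _ _).putR (by simp) _ _).put (by simp) _ _).set (by simp) _
    · rcases hlt u (by simpa using hu) with rfl | ⟨h, h'⟩
      · simp
      · simpa [Fin.val_inj, h'] using hr.crit u h
    · rcases hlt u (by simpa using hu) with rfl | ⟨h, h'⟩
      · simp
      · simpa [Fin.val_inj, h'] using hr.act u h hu'
    · rcases hlt u (by simpa using hu) with rfl | ⟨h, h'⟩
      · exact absurd hinner hu'
      · simpa [Fin.val_inj, h'] using hr.act_terminal u h hu'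
    · rcases hlt u (by simpa using hu) with rfl | ⟨h, h'⟩
      · simp
      · simpa [Fin.val_inj, h'] using hex u h
    · omega
    · exact (((hin.put (by simp) _ _).putR (by simp) _ _).put (by simp) _ _).set (by simp) _
    · rcases hlt u (by simpa using hu) with rfl | ⟨h, h'⟩
      · simp
      · simpa [Fin.val_inj, h'] using hr.crit u h
    · rcases hlt u (by simpa using hu) with rfl | ⟨h, h'⟩
      · exact absurd hu' hinner
      · simpa [Fin.val_inj, h'] using hr.act u h hu'
    · rcases hlt u (by simpa using hu) with rfl | ⟨h, h'⟩
      · simp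
      · simpa [Fin.val_inj, h'] using hr.act_terminal u h hu'
    · rcases hlt u (by simpa using hu) with rfl | ⟨h, h'⟩
      · simp
      · simpa [Fin.val_inj, h'] using hex u h
    · omega
  · rintro τ t ⟨⟨hin, hr, hex⟩, hb, ht⟩
    simp [hin.n_eq] at hb
    refine ⟨hin, ⟨fun u hu => hr.crit u (hu.trans_le hb), fun u hu => hr.act u (hu.trans_le hb),
      fun u hu => hr.act_terminal u (hu.trans_le hb)⟩, fun u => hex u (u.2.trans_le hb), ?_⟩
    simp at ht ⊢
    omega

/-- While `f` gets its final value edge by edge, the excesses are those of the flow truncated to the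
edges already visited; hence the parameter of `startFlow`. -/
theorem init_edges_runs (hσ : N.IsInput σ) (hv : VerticesReady N σ n)
    (hex : ∀ u : Fin n, σ.realArr .ex u = 0) :
    Runs (Algorithm.forBelow .e .m
        [ .put .closed (.var .e) 0,
          .ite (.eqN (.get .kind (.get .tail (.var .e))) 1)
            (Algorithm.block [.putR .f (.var .e) (.get .c (.var .e)),
              Algorithm.dec .ex (.get .tail (.var .e)) (.get .c (.var .e)),
              Algorithm.inc .ex (.get .head (.var .e)) (.get .c (.var .e))])
            (.putR .f (.var .e) .zero) ]) σ
      fun σ' t => N.IsInput σ' ∧ VerticesReady N σ' n ∧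
        (∀ a : Fin m, σ'.natArr .closed a = 0) ∧ (view n m σ').f = N.startFlow m ∧
        (∀ u : Fin n, σ'.realArr .ex u = N.excess (N.startFlow m) u) ∧ t ≤ 60 * m + 20 := by
  rw [Algorithm.forBelow, Algorithm.block, runs_seq, runs_set, Algorithm.block]
  refine (runs_loop (fun τ => N.IsInput τ ∧ VerticesReady N τ n ∧ τ.nat .e ≤ m ∧
      (∀ a : Fin m, (a : ℕ) < τ.nat .e → τ.natArr .closed a = 0) ∧
      (∀ a : Fin m, (a : ℕ) < τ.nat .e → τ.realArr .f a = N.startFlow m a) ∧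
      ∀ u : Fin n, τ.realArr .ex u = N.excess (N.startFlow (τ.nat .e)) u)
    (fun τ => 60 * (m - τ.nat .e)) ?_
    ⟨hσ.set (by simp) _, ⟨hv.crit, hv.act, hv.act_terminal⟩, by simp, by simp, by simp, ?_⟩).mono ?_
  · rintro τ ⟨hin, hr, -, hcl, hf, hex⟩ hb
    simp [hin.m_eq] at hb
    obtain ⟨e, he⟩ : ∃ e : Fin m, τ.nat .e = e := ⟨⟨_, hb⟩, rfl⟩
    have hem := e.2
    have hkind := hin.kind_eq_one (v := N.tail e)
    have hloop : (N.head e : ℕ) ≠ N.tail e := fun h => N.loopless e (Fin.val_injective h).symm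
    rw [he] at hcl hf hex
    have hlt : ∀ u : Fin m, (u : ℕ) < e + 1 → u = e ∨ (u : ℕ) < e ∧ u ≠ e := fun u hu => by
      rcases (Nat.lt_succ_iff.1 hu).eq_or_lt with h | h
      · exact .inl (Fin.val_injective h)
      · exact .inr ⟨h, fun h' => by simp [h'] at h⟩
    simp [he, hin.tail_eq, hkind, hin.head_eq, hin.c_eq, hloop]
    refine ⟨fun hS => ⟨⟨?_, ⟨hr.crit, hr.act, hr.act_terminal⟩, fun a ha => ?_, fun a ha => ?_,
      fun u => ?_⟩, ?_⟩, fun hS => ⟨⟨?_, ⟨hr.crit, hr.act, hr.act_terminal⟩, fun a ha => ?_,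
      fun a ha => ?_, fun u => ?_⟩, ?_⟩⟩
    · exact ((((hin.put (by simp) _ _).putR (by simp) _ _).putR (by simp) _ _).putR (by simp) _ _).set
        (by simp) _
    · rcases hlt a (by simpa using ha) with rfl | ⟨h, h'⟩
      · simp
      · simpa [Fin.val_inj, h'] using hcl a h
    · rcases hlt a (by simpa using ha) with rfl | ⟨h, h'⟩
      · simp [N.startFlow_of_mem hem hS]
      · simpa [Fin.val_inj, h'] using hf a h
    · have h0 : N.startFlow e e = 0 := by simp [Network.startFlow]
      rw [N.startFlow_succ_of_mem hS, N.excess_update, h0, hex, hex]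
      by_cases h₁ : u = N.head e
      · subst h₁
        simp [N.loopless e]
      · by_cases h₂ : u = N.tail e
        · subst h₂
          simp [(N.loopless e).symm, hloop.symm]
        · simp [Fin.val_inj, h₁, h₂, hex, Ne.symm h₁, Ne.symm h₂]
    · omega
    · exact ((hin.put (by simp) _ _).putR (by simp) _ _).set (by simp) _
    · rcases hlt a (by simpa using ha) with rfl | ⟨h, h'⟩
      · simp
      · simpa [Fin.val_inj, h'] using hcl a h
    · rcases hlt a (by simpa using ha) with rfl | ⟨h, h'⟩
      · simp [N.startFlow_of_not_mem hS]
      · simpa [Fin.val_inj, h'] using hf a h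
    · rw [N.startFlow_succ_of_not_mem hS]
      exact hex u
    · omega
  · intro u
    have : N.startFlow 0 = fun _ => 0 := by
      ext a
      simp [Network.startFlow]
    simp [hex, this, N.excess_eq]
  · rintro τ t ⟨⟨hin, hr, hle, hcl, hf, hex⟩, hb, ht⟩
    simp [hin.m_eq] at hb
    have hem : τ.nat .e = m := le_antisymm hle hb
    rw [hem] at hcl hf hex
    refine ⟨hin, hr, fun a => hcl a a.2, funext fun a => hf a a.2, hex, ?_⟩
    simp at ht ⊢
    omega

/-- The initial preflow satisfies the invariants, except that active edges may be saturated. -/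
theorem initial_sound (hσ : N.IsInput σ) (hv : VerticesReady N σ n)
    (hcl : ∀ a : Fin m, σ.natArr .closed a = 0) (hf : (view n m σ).f = N.startFlow m)
    (hex : ∀ u : Fin n, σ.realArr .ex u = N.excess (N.startFlow m) u) :
    (view n m σ).Sound N ∧ (view n m σ).Balanced N := by
  have hcrit : ∀ u, (view n m σ).crit u = m := fun u => hv.crit u u.2
  have hclosed : ∀ a, (view n m σ).closed a = 0 := hcl
  have hact : ∀ u, N.Inner u → (view n m σ).act u = σ.natArr .firstOut u := fun u => hv.act u u.2
  have hact' : ∀ u, ¬ N.Inner u → (view n m σ).act u = m := fun u => hv.act_terminal u u.2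
  have hval : ∀ a, (N.tail a ∈ N.S ∧ (view n m σ).f a = N.c a) ∨
      (N.tail a ∉ N.S ∧ (view n m σ).f a = 0) := by
    intro a
    rw [hf]
    by_cases hS : N.tail a ∈ N.S
    · exact .inl ⟨hS, N.startFlow_of_mem a.2 hS⟩
    · exact .inr ⟨hS, N.startFlow_of_not_mem hS⟩
  -- All edges leaving inner vertices are free, so `act_after` is trivial and the excess of an inner
  -- vertex is pure inflow.
  have hinner0 : ∀ a, N.Inner (N.tail a) → (view n m σ).f a = 0 := fun a ha =>
    ((hval a).resolve_left fun h => ha (.inl h.1)).2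
  have hnonneg : ∀ a, 0 ≤ (view n m σ).f a := fun a => by
    rcases hval a with ⟨-, h⟩ | ⟨-, h⟩ <;> rw [h]
    exact N.c_nonneg a
  constructor
  · refine ⟨hnonneg, fun a => ?_, fun a => ?_, fun a hS _ => ?_, hact', fun u => ?_,
      fun a ha hm => ?_, fun a b ha hb hlt => ?_, fun a b ha hb hlt => hinner0 a ha,
      fun u => .inl (hcrit u), fun a _ => by simp [hclosed], fun a b hb => ?_, fun a b hb => ?_⟩
    · rcases hval a with ⟨-, h⟩ | ⟨-, h⟩ <;> rw [h]
      exact N.c_nonneg a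
    · rcases hval a with ⟨-, h⟩ | ⟨-, h⟩ <;> rw [h]
      · exact capacity_mem N a
      · exact zero_mem _
    · exact ((hval a).resolve_right fun h => h.1 hS).2
    · by_cases hu : N.Inner u
      · rw [hact u hu]
        rcases hσ.firstOut_cases hu with h | ⟨e, h₁, h₂, -⟩
        · exact .inl h.1
        · exact .inr ⟨e, h₁, h₂⟩
      · exact .inl (hact' u hu)
    · rw [hact _ ha] at hm
      rcases hσ.firstOut_cases ha with h | ⟨e, h₁, -⟩
      · exact absurd rfl (h.2 a)
      · omega
    · rw [hact _ ha] at hb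
      rcases hσ.firstOut_cases ha with h | ⟨e, h₁, h₂, h₃⟩
      · omega
      · obtain rfl : e = b := by omega
        rcases eq_or_ne a e with rfl | hae
        · exact absurd hlt (N.ltOut_irrefl ha)
        · exact absurd (N.ltOut_trans ha rfl h₂ rfl hlt (h₃ a rfl hae)) (N.ltOut_irrefl ha)
    · rw [hcrit] at hb
      omega
    · rw [hcrit] at hb
      omega
  · refine ⟨fun u => by rw [hf]; exact hex u, fun u hu => ?_⟩
    have hexu : (view n m σ).ex u = N.excess (view n m σ).f u := by rw [hf]; exact hex u
    rw [hexu, N.excess_eq, Finset.sum_eq_zero (s := Finset.univ)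
      (f := fun e => if N.tail e = u then (view n m σ).f e else 0), sub_zero]
    · exact Finset.sum_nonneg fun e _ => by split_ifs; exacts [hnonneg e, le_rfl]
    · rintro e -
      split_ifs with h
      · exact hinner0 e (h ▸ hu)
      · rfl

/-- Only sharpness is still missing, and it is established vertex by vertex. Each `advance`
preserves it at the vertices done before, as it moves only one pointer. -/
theorem init_active_runs (hσ : N.IsInput σ) (hs : (view n m σ).Sound N)
    (hb : (view n m σ).Balanced N) :
    Runs (Algorithm.forBelow .v .n [Algorithm.advance .v]) σ fun σ' t => N.IsInput σ' ∧
      (view n m σ').Valid N ∧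
        t + 200 * (view n m σ').potential N ≤ 200 * (view n m σ).potential N + 100 * n + 20 := by
  rw [Algorithm.forBelow, Algorithm.block, runs_seq, runs_set, Algorithm.block]
  refine (runs_loop (fun τ => N.IsInput τ ∧ (view n m τ).Sound N ∧ (view n m τ).Balanced N ∧
      ∀ u : Fin n, (u : ℕ) < τ.nat .v → (view n m τ).Sharp N u)
    (fun τ => 200 * (view n m τ).potential N + 100 * (n - τ.nat .v)) ?_
    ⟨hσ.set (by simp) _, hs, hb, by simp⟩).mono ?_
  · rintro τ ⟨hin, hsd, hbal, hsh⟩ hb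
    simp [hin.n_eq] at hb
    obtain ⟨v, hv⟩ : ∃ v : Fin n, τ.nat .v = v := ⟨⟨_, hb⟩, rfl⟩
    have hvn := v.2
    rw [List.cons_append, List.nil_append, Algorithm.block, runs_seq]
    refine (advance_runs hin hv hsd).mono ?_
    rintro _ t ⟨a, rfl, h₁, h₂, h₃, h₄⟩
    rw [Algorithm.block, runs_set]
    refine ⟨⟨(hin.put (by simp) _ _).set (by simp) _, ?_, ?_, fun u hu => ?_⟩, ?_⟩
    · rwa [view_set, view_put_act]
    · rw [view_set, view_put_act]
      exact hbal.setAct v a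
    · rw [view_set, view_put_act]
      have hu' : (u : ℕ) < v + 1 := by simpa [hv] using hu
      by_cases huv : u = v
      · exact huv ▸ h₂
      · have : (u : ℕ) ≠ v := fun h => huv (Fin.val_injective h)
        exact (hsh u (by omega)).setAct huv
    · simp [hv]
      omega
  · rintro τ t ⟨⟨hin, hsd, hbal, hsh⟩, hb, ht⟩
    simp [hin.n_eq] at hb
    refine ⟨hin, ⟨hsd, fun u => hsh u (u.2.trans_le hb), hbal⟩, ?_⟩
    simp at ht ⊢
    omega

theorem startPreflow_runs (hσ : N.IsInput σ) :
    Runs Algorithm.startPreflow σ fun σ' t => N.IsInput σ' ∧ (view n m σ').Valid N ∧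
      t ≤ 200 * n + 1000 * m + 100 := by
  unfold Algorithm.startPreflow
  rw [Algorithm.block, runs_seq]
  refine (init_vertices_runs hσ).mono ?_
  rintro τ t ⟨hin, hv, hex, ht⟩
  rw [Algorithm.block, runs_seq]
  refine (init_edges_runs hin hv hex).mono ?_
  rintro τ₁ t₁ ⟨hin₁, hv₁, hcl, hf, hex₁, ht₁⟩
  obtain ⟨hs, hb⟩ := initial_sound hin₁ hv₁ hcl hf hex₁
  rw [Algorithm.block]
  refine (init_active_runs hin₁ hs hb).mono ?_
  rintro τ₂ t₂ ⟨hin₂, hval, ht₂⟩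
  have := potential_le_four_mul N (view n m τ₁)
  exact ⟨hin₂, hval, by omega⟩

/-- An iteration starts with `changed = 1` and lowers the sum of the potential and `changed` by at
least one, which pays for its linear part. The sum starts at no more than `4 * m + 1`; the extra one
is the last iteration, in which nothing changes. -/
theorem modifiedAlgorithm_runs (hσ : N.IsInput σ) :
    Runs Algorithm.modifiedAlgorithm σ fun σ' t => (view n m σ').Valid N ∧
      (∀ u, N.Inner u → (view n m σ').ex u ≤ 0) ∧
      t ≤ 200 * n + 1800 * m + 200 + (2300 * n + 400) * (4 * m + 1) := by
  unfold Algorithm.modifiedAlgorithm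
  rw [Algorithm.block, runs_seq]
  refine (startPreflow_runs hσ).mono ?_
  rintro τ t ⟨hin, hval, ht⟩
  rw [Algorithm.block, runs_seq, runs_set, Algorithm.block]
  refine (runs_loop (fun τ => N.IsInput τ ∧ (view n m τ).Valid N ∧
      (τ.nat .changed = 1 ∨ (τ.nat .changed = 0 ∧ ∀ u, N.Inner u → (view n m τ).ex u ≤ 0)))
    (fun τ => 200 * (view n m τ).potential N +
      (2300 * n + 400) * ((view n m τ).potential N + τ.nat .changed)) ?_
    ⟨hin.set (by simp) _, hval, .inl (by simp)⟩).mono ?_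
  · rintro τ ⟨hin, hval, -⟩ hb
    have hc : τ.nat .changed = 1 := by simpa using hb
    rw [Algorithm.block]
    refine (bigIteration_runs hin hval).mono ?_
    rintro τ₁ t₁ ⟨h₁, h₂, h₃, hle, h₄⟩
    refine ⟨⟨h₁, h₂, h₃⟩, ?_⟩
    have := Nat.mul_le_mul_left (2300 * n + 400) hle
    rw [hc, Nat.mul_add_one]
    simp
    omega
  · rintro τ₁ t₁ ⟨⟨h₁, h₂, h₃⟩, hb, h₄⟩
    have hc : τ₁.nat .changed ≠ 1 := by simpa using hb
    obtain ⟨hc0, hex⟩ := h₃.resolve_left hc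
    refine ⟨h₂, hex, ?_⟩
    have := potential_le_four_mul N (view n m τ)
    have h₅ : (2300 * n + 400) * ((view n m τ).potential N + 1) ≤
      (2300 * n + 400) * (4 * m + 1) := by gcongr
    simp at h₄ ⊢
    omega

/-! ## The main theorem -/

/-- The integers form an additive subgroup of the reals that contains all capacities. -/
theorem Network.exists_int_of_mem_closure (hc : ∀ e, ∃ k : ℤ, N.c e = k) {x : ℝ}
    (hx : x ∈ AddSubgroup.closure (Set.range N.c)) : ∃ k : ℤ, x = k := by
  have hle : AddSubgroup.closure (Set.range N.c) ≤ (Int.castAddHom ℝ).range := by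
    rw [AddSubgroup.closure_le]
    rintro _ ⟨e, rfl⟩
    obtain ⟨k, hk⟩ := hc e
    exact ⟨k, hk.symm⟩
  obtain ⟨k, hk⟩ := hle hx
  exact ⟨k, hk.symm⟩

end StableFlow

theorem mainTheorem1 :
    ∃ C : ℕ, ∀ (n m : ℕ) (N : StableFlow.Network (Fin n) (Fin m)), N.CondP →
      ∀ σ : StableFlow.Store, N.IsInput σ →
        ∃ (σ' : StableFlow.Store) (t : ℕ),
          StableFlow.Exec StableFlow.Algorithm.modifiedAlgorithm σ σ' t ∧
          (0 < m → t ≤ C * (n * m)) ∧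
          N.IsStableFlow (fun e => σ'.realArr .f e) ∧
          ((∀ e, ∃ k : ℤ, N.c e = k) → ∀ e : Fin m, ∃ k : ℤ, σ'.realArr .f e = k) := by
  refine ⟨20000, fun n m N hP σ hσ => ?_⟩
  obtain ⟨σ', t, he, hval, hex, ht⟩ := StableFlow.modifiedAlgorithm_runs hσ
  refine ⟨σ', t, he, fun hm => ?_, hval.isStableFlow hP hex,
    fun hc e => StableFlow.Network.exists_int_of_mem_closure hc (hval.sound.f_mem e)⟩
  -- An edge has a tail, so `n` and `m` are both positive and the product absorbs the linear and
  -- constant terms; the coefficients add up to 15700.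
  have hn : 0 < n := (N.tail ⟨0, hm⟩).pos
  have h₁ : n ≤ n * m := Nat.le_mul_of_pos_right n hm
  have h₂ : m ≤ n * m := Nat.le_mul_of_pos_left m hn
  calc t ≤ 200 * n + 1800 * m + 200 + (2300 * n + 400) * (4 * m + 1) := ht
    _ = 9200 * (n * m) + 2500 * n + 3400 * m + 600 := by ring
    _ ≤ 20000 * (n * m) := by omega
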